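/- **Setting.** Let $G=\mathbb Z^d$, $S^1=\mathbb R/2\pi\mathbb Z$ with Lebesgue measure $\lambda$ (total mass $2\pi$), and let $\Phi=(\Phi_A)_{A\subset G \text{ finite}}$ be a measurable potential on $(S^1)^G$ ($\Phi_A$ depends only on the spins in $A$) that is absolutely summable ($\sum_{A\ni i}\|\Phi_A\|_\infty<\infty$ for all $i$), translation-invariant and invariant under joint rotations of all spins. Put $H_\Lambda=\sum_{A\cap\Lambda\ne\emptyset}\Phi_A$ and let $\gamma^\Phi$ be the Gibbsian specification $$\gamma^\Phi_\Lambda(B|\eta)=\frac{\int 1_B(\sigma_\Lambda\eta_{\Lambda^c})\,e^{-H_\Lambda(\sigma_\Lambda\eta_{\Lambda^c})}\lambda^{\otimes\Lambda}(d\sigma_\Lambda)}{\int e^{-H_\Lambda(\sigma_\Lambda\eta_{\Lambda^c})}\lambda^{\otimes\Lambda}(d\sigma_\Lambda)} .$$ For a specification $\gamma$, let $\mathcal G(\gamma)$ be the set of probability measures satisfying the DLR equations $\int\mu(d\eta)\gamma_\Lambda(B|\eta)=\mu(B)$ for all finite $\Lambda$, let $\mathcal G_\theta(\gamma)$ be the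 lattice-translation-invariant ones, and let $\mathrm{ex}\,\mathcal G_\theta(\gamma)$ be the extreme points of $\mathcal G_\theta(\gamma)$. Assume continuous symmetry breaking: for every $\varphi\in S^1$ the weak limit $\mu_\varphi=\lim_{\Lambda\nearrow G}\gamma^\Phi_\Lambda(\cdot|\eta_\varphi)$ with homogeneous boundary condition $(\eta_\varphi)_i=\varphi$ exists, $\mathrm{ex}\,\mathcal G_\theta(\gamma^\Phi)=\{\mu_\varphi:\varphi\in S^1\}$, and $\mu_\varphi\neq\mu_{\psi}$ for $\varphi\ne\psi$. For an integer $q\ge1$ let $T$ map $\varphi\in[0,2\pi)$ to the $k\in\{0,\dots,q-1\}$ with $2\pi k/q\le\varphi<2\pi(k+1)/q$, and apply $T$ sitewise to configurations. For $\sigma'\in\{0,\dots,q-1\}^G$, the constrained specification $\gamma^{\sigma'}$ is defined like $\gamma^\Phi$, but with the a priori measure at each site $i$ replaced by $\lambda$ restricted to the arc $T^{-1}(\sigma'_i)$. For finite $\Lambda$, the constrained model on $\Lambda^c$ is defined in the same way on the site set $\Lambda^c$, keeping only the interactions $\Phi_A$ with $A\subset\Lambda^c$. Assume that $q$ is large enough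 that Dobrushin's uniqueness condition holds for the constrained models: for every $\sigma'$, $\sup_i\sum_j C_{ij}[\sigma']<1$, where $$C_{ij}[\sigma']=\sup_{\omega,\tilde\omega}\ \sup_{B\subset S^1}\bigl|\gamma^{\sigma'}_{\{i\}}(\sigma_i\in B|\omega)-\gamma^{\sigma'}_{\{i\}}(\sigma_i\in B|\tilde\omega)\bigr| ,$$ the first supremum being over $\omega,\tilde\omega$ that agree off $j$ and satisfy $T(\omega)=T(\tilde\omega)=\sigma'$, and the second over measurable $B$. **Statement.** For every $\sigma'$ the constrained model on $G$ has exactly one Gibbs measure $\mu_G[\sigma']$, and for every finite $\Lambda$ the constrained model on $\Lambda^c$ has exactly one Gibbs measure $\mu_{\Lambda^c}[\sigma'_{\Lambda^c}]$. Hence the discrete specification $$\gamma'_\Lambda(\sigma'_\Lambda|\sigma'_{\Lambda^c})=\frac{\mu_{\Lambda^c}[\sigma'_{\Lambda^c}]\bigl(\lambda^{\Lambda}(e^{-H_\Lambda}1_{T(\sigma_\Lambda)=\sigma'_\Lambda})\bigr)}{\mu_{\Lambda^c}[\sigma'_{\Lambda^c}]\bigl(\lambda^{\Lambda}(e^{-H_\Lambda})\bigr)}$$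 and, for $\tau\in\mathbb R$, the Sample–Rotate–Project transition $M_\tau(\sigma',\cdot)$, the law of $T(\sigma+\tau)$ for $\sigma$ distributed according to $\mu_G[\sigma']$, are well defined, and $M_\tau$ is a Markov kernel on $\{0,\dots,q-1\}^G$. Let $\mu'_\varphi=T\mu_\varphi$ be the image of $\mu_\varphi$ under $T$. Then: 1. $\mathrm{ex}\,\mathcal G_\theta(\gamma')=\{\mu'_\varphi:\varphi\in S^1\}$, and $\mu'_\varphi\neq\mu'_\psi$ for $\varphi\neq\psi$. 2. $M_\tau\mu'_\varphi=\mu'_{\varphi+\tau}$ for all $\varphi\in S^1$ and all $\tau\in\mathbb R$ (in particular for $0\le\tau<2\pi$). 3. The map $\varphi\mapsto\mu'_\varphi$ is measurable, the uniform mixture $\mu'_*=\frac1{2\pi}\int_0^{2\pi}\mu'_\varphi\,d\varphi$ belongs to $\mathcal G_\theta(\gamma')$, and $M_\tau\mu'_*=\mu'_*$ for all $\tau\in\mathbb R$. -/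

import Mathlib

open scoped NNReal ENNReal Topology BoundedContinuousFunction

noncomputable section

namespace SampleRotateProject

open MeasureTheory

/-! ### Specifications and Gibbs measures on a general site set -/

/-- The configuration `ζ_Λ σ_{Λᶜ}`. -/
def join {S X : Type*} [DecidableEq S] (Λ : Finset S) (ζ : Λ → X) (σ : {i // i ∉ Λ} → X) : S → X :=
  fun i => if h : i ∈ Λ then ζ ⟨i, h⟩ else σ ⟨i, h⟩

/-- `H_Λ = ∑_{A ∩ Λ ≠ ∅} Φ_A`. -/
def hamiltonian {S X : Type*} [DecidableEq S] (Φ : Finset S → (S → X) → ℝ) (Λ : Finset S)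
    (ω : S → X) : ℝ :=
  ∑' A : {A : Finset S // (A ∩ Λ).Nonempty}, Φ A ω

/-- The probability measure proportional to `m` (for `m` finite and non-zero). -/
def normalize {Y : Type*} [MeasurableSpace Y] (m : Measure Y) : Measure Y :=
  (m Set.univ)⁻¹ • m

/-- The measure `exp (-H_Λ) m`. -/
def boltzmann {S X : Type*} [DecidableEq S] [MeasurableSpace X] (Φ : Finset S → (S → X) → ℝ)
    (Λ : Finset S) (m : Measure (S → X)) : Measure (S → X) :=
  m.withDensity fun ω => ENNReal.ofReal (Real.exp (-hamiltonian Φ Λ ω))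

/-- The Gibbsian specification `γ_Λ(· | η)` of the potential `Φ` with single-site a priori measures
`ρ i`: resample the spins in `Λ` with density proportional to `exp (-H_Λ)` with respect to the
product of the `ρ i`, and keep `η` outside `Λ`. -/
def gibbsSpec {S X : Type*} [DecidableEq S] [MeasurableSpace X] (Φ : Finset S → (S → X) → ℝ)
    (ρ : S → Measure X) (Λ : Finset S) (η : S → X) : Measure (S → X) :=
  normalize (boltzmann Φ Λ
    ((Measure.pi fun i : Λ => ρ i).map fun ζ => join Λ ζ fun i => η i))

/-- The Gibbs measures of a family of kernels: probability measures satisfying the DLR equations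
`∫ μ(dη) γ_Λ(B | η) = μ(B)`. -/
def gibbsMeasures {S X : Type*} [MeasurableSpace X]
    (γ : Finset S → (S → X) → Measure (S → X)) : Set (Measure (S → X)) :=
  {μ | IsProbabilityMeasure μ ∧
    ∀ (Λ : Finset S) (B : Set (S → X)), MeasurableSet B → ∫⁻ η, γ Λ η B ∂μ = μ B}

open Classical in
/-- The Gibbs measure of `γ`, meant for families `γ` that have exactly one Gibbs measure. -/
def theGibbsMeasure {S X : Type*} [MeasurableSpace X]
    (γ : Finset S → (S → X) → Measure (S → X)) : Measure (S → X) :=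
  if h : (gibbsMeasures γ).Nonempty then h.some else 0

/-- Entry `C_{ij}` of Dobrushin's interdependence matrix on the configuration set `K`: the largest
total variation distance of the distributions of the spin at `i` under `γ_{i}(· | ω)` and
`γ_{i}(· | ω')`, over `ω, ω' ∈ K` that agree off `j`. -/
def dobrushinCoeff {S X : Type*} [MeasurableSpace X]
    (γ : Finset S → (S → X) → Measure (S → X)) (K : Set (S → X)) (i j : S) : ℝ≥0∞ :=
  ⨆ (ω : S → X) (ω' : S → X) (_ : ω ∈ K) (_ : ω' ∈ K) (_ : ∀ k, k ≠ j → ω k = ω' k)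
    (B : Set X) (_ : MeasurableSet B),
    ENNReal.ofReal |(γ {i} ω).real {σ | σ i ∈ B} - (γ {i} ω').real {σ | σ i ∈ B}|

/-- Dobrushin's condition `sup_i ∑_j C_{ij} < 1` on the configuration set `K`. -/
def DobrushinCondition {S X : Type*} [MeasurableSpace X]
    (γ : Finset S → (S → X) → Measure (S → X)) (K : Set (S → X)) : Prop :=
  ⨆ i, ∑' j, dobrushinCoeff γ K i j < 1

/-! ### The lattice, translations, rotations -/

/-- The lattice `ℤ^d`. -/
abbrev Site (d : ℕ) : Type := Fin d → ℤ

instance fact_two_pi_pos : Fact (0 < 2 * Real.pi) := ⟨Real.two_pi_pos⟩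

/-- The local state space `S¹ = ℝ / 2πℤ`. Its `volume` is the Lebesgue measure of total
mass `2π`. -/
abbrev Spin : Type := AddCircle (2 * Real.pi)

/-- `(θ_i ω)_j = ω_{j + i}`. -/
def shift {d : ℕ} {X : Type*} (i : Site d) (ω : Site d → X) : Site d → X :=
  fun j => ω (j + i)

/-- Joint rotation of all spins by the angle `t`. -/
def rotate {d : ℕ} (t : Spin) (ω : Site d → Spin) : Site d → Spin :=
  fun i => ω i + t

/-- The lattice-translation invariant Gibbs measures. -/
def invGibbsMeasures {d : ℕ} {X : Type*} [MeasurableSpace X]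
    (γ : Finset (Site d) → (Site d → X) → Measure (Site d → X)) :
    Set (Measure (Site d → X)) :=
  {μ | μ ∈ gibbsMeasures γ ∧ ∀ i, μ.map (shift i) = μ}

/-- The extreme points of the convex set of translation-invariant Gibbs measures. -/
def exInvGibbsMeasures {d : ℕ} {X : Type*} [MeasurableSpace X]
    (γ : Finset (Site d) → (Site d → X) → Measure (Site d → X)) :
    Set (Measure (Site d → X)) :=
  Set.extremePoints ℝ≥0 (invGibbsMeasures γ)

/-! ### The first-layer model -/

/-- Absolutely summable, translation-invariant and `S¹`-invariant potentials on `(S¹)^{ℤ^d}`. -/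
structure IsRotatorPotential {d : ℕ}
    (Φ : Finset (Site d) → (Site d → Spin) → ℝ) : Prop where
  measurable : ∀ A, Measurable (Φ A)
  dependsOn : ∀ A ω ω', (∀ i ∈ A, ω i = ω' i) → Φ A ω = Φ A ω'
  absSummable : ∀ i, ∑' A : {A : Finset (Site d) // i ∈ A}, ⨆ ω, ‖Φ A ω‖ₑ ≠ ∞
  translationInvariant : ∀ i A ω, Φ (A.map (addRightEmbedding i)) ω = Φ A (shift i ω)
  rotationInvariant : ∀ t A ω, Φ A (rotate t ω) = Φ A ω

/-- The first-layer specification `γ^Φ`, with Lebesgue a priori measure. -/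
def rotatorSpec {d : ℕ} (Φ : Finset (Site d) → (Site d → Spin) → ℝ) :
    Finset (Site d) → (Site d → Spin) → Measure (Site d → Spin) :=
  gibbsSpec Φ fun _ => volume

/-- Continuous symmetry breaking: the extremal translation-invariant Gibbs measures are exactly the
weak limits `μ_φ = lim_{Λ ↗ G} γ_Λ(· | η_φ)` with homogeneous boundary conditions `(η_φ)_i = φ`, and
different angles `φ` give different measures. -/
structure SymmetryBreaking {d : ℕ} (Φ : Finset (Site d) → (Site d → Spin) → ℝ)
    (μ : Spin → Measure (Site d → Spin)) : Prop where
  weakLimit : ∀ (φ : Spin) (f : (Site d → Spin) →ᵇ ℝ),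
    Filter.Tendsto (fun Λ => ∫ ω, f ω ∂(rotatorSpec Φ Λ fun _ => φ)) Filter.atTop
      (𝓝 (∫ ω, f ω ∂(μ φ)))
  extremal : exInvGibbsMeasures (rotatorSpec Φ) = Set.range μ
  injective : Function.Injective μ

/-! ### Discretization and the constrained first-layer models -/

/-- The representative of an angle in `[0, 2π)`. -/
def angleRep (φ : Spin) : ℝ := (AddCircle.equivIco (2 * Real.pi) 0 φ : ℝ)

/-- The coarse-graining with `q` equal arcs: `φ ↦ k` iff `2πk/q ≤ φ < 2π(k+1)/q`, for
`k = 0, …, q-1`. -/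
def coarse (q : ℕ) [NeZero q] (φ : Spin) : Fin q :=
  ⟨⌊q * angleRep φ / (2 * Real.pi)⌋₊, by
    have hq : (0 : ℝ) < q := by exact_mod_cast Nat.pos_of_ne_zero (NeZero.ne q)
    have h := (AddCircle.equivIco (2 * Real.pi) 0 φ).2
    have h0 : 0 ≤ angleRep φ := h.1
    have h1 : angleRep φ < 2 * Real.pi := by simpa [angleRep] using h.2
    rw [Nat.floor_lt (by positivity), div_lt_iff₀ Real.two_pi_pos]
    exact mul_lt_mul_of_pos_left h1 hq⟩

/-- The sitewise coarse-graining `T`. -/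
def coarseConfig {d : ℕ} (q : ℕ) [NeZero q] (ω : Site d → Spin) : Site d → Fin q :=
  fun i => coarse q (ω i)

/-- The Lebesgue measure restricted to the arc with label `k`. -/
def arcMeasure (q : ℕ) [NeZero q] (k : Fin q) : Measure Spin :=
  volume.restrict {φ | coarse q φ = k}

/-- The constrained first-layer specification on the whole lattice: each spin `ω i` is constrained
to the arc with label `σ' i`. -/
def constrainedSpec {d : ℕ} (Φ : Finset (Site d) → (Site d → Spin) → ℝ)
    (q : ℕ) [NeZero q] (σ' : Site d → Fin q) :
    Finset (Site d) → (Site d → Spin) → Measure (Site d → Spin) :=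
  gibbsSpec Φ fun i => arcMeasure q (σ' i)

/-- The potential on the volume `Λᶜ` obtained by deleting all interactions with `Λ`, that is, by
keeping `Φ_A` for `A ⊆ Λᶜ` only. (Such a `Φ_A` ignores the spins that are set to `0` here.) -/
def deletedPotential {d : ℕ} (Φ : Finset (Site d) → (Site d → Spin) → ℝ)
    (Λ : Finset (Site d)) (A : Finset {i : Site d // i ∉ Λ})
    (σ : {i : Site d // i ∉ Λ} → Spin) : ℝ :=
  Φ (A.map (Function.Embedding.subtype _)) (join Λ (fun _ => 0) σ)

/-- The constrained first-layer specification on the volume `Λᶜ`, with all interactions with `Λ`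
deleted. It depends only on `σ'_{Λᶜ}`. -/
def outerConstrainedSpec {d : ℕ} (Φ : Finset (Site d) → (Site d → Spin) → ℝ)
    (q : ℕ) [NeZero q] (Λ : Finset (Site d)) (σ' : Site d → Fin q) :
    Finset {i : Site d // i ∉ Λ} → ({i : Site d // i ∉ Λ} → Spin) →
      Measure ({i : Site d // i ∉ Λ} → Spin) :=
  gibbsSpec (deletedPotential Φ Λ) fun i => arcMeasure q (σ' i)

/-- The discretization into `q` arcs is fine enough for `Φ`: every constrained first-layer model is
in Dobrushin's uniqueness regime. -/
def FineDiscretization {d : ℕ} (Φ : Finset (Site d) → (Site d → Spin) → ℝ)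
    (q : ℕ) [NeZero q] : Prop :=
  ∀ σ' : Site d → Fin q,
    DobrushinCondition (constrainedSpec Φ q σ') {ω | coarseConfig q ω = σ'}

/-- `μ_G[σ']`, the unique Gibbs measure of the constrained model on the whole lattice. -/
def constrainedGibbs {d : ℕ} (Φ : Finset (Site d) → (Site d → Spin) → ℝ)
    (q : ℕ) [NeZero q] (σ' : Site d → Fin q) : Measure (Site d → Spin) :=
  theGibbsMeasure (constrainedSpec Φ q σ')

/-- `μ_{Λᶜ}[σ'_{Λᶜ}]`, the unique Gibbs measure of the constrained model on `Λᶜ`. -/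
def outerConstrainedGibbs {d : ℕ} (Φ : Finset (Site d) → (Site d → Spin) → ℝ)
    (q : ℕ) [NeZero q] (Λ : Finset (Site d)) (σ' : Site d → Fin q) :
    Measure ({i : Site d // i ∉ Λ} → Spin) :=
  theGibbsMeasure (outerConstrainedSpec Φ q Λ σ')

/-! ### The second-layer model and the dynamics -/

/-- The discrete specification `γ'`: under `γ'_Λ(· | σ')` the configuration is `σ'` off `Λ`, and it
equals `ζ` on `Λ` with probability
`μ_{Λᶜ}[σ'_{Λᶜ}](λ^Λ(e^{-H_Λ} 1_{T = ζ})) / μ_{Λᶜ}[σ'_{Λᶜ}](λ^Λ(e^{-H_Λ}))`. -/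
def coarseSpec {d : ℕ} (Φ : Finset (Site d) → (Site d → Spin) → ℝ)
    (q : ℕ) [NeZero q] (Λ : Finset (Site d)) (σ' : Site d → Fin q) :
    Measure (Site d → Fin q) :=
  normalize ((boltzmann Φ Λ
    (((Measure.pi fun _ : Λ => (volume : Measure Spin)).prod (outerConstrainedGibbs Φ q Λ σ')).map
      fun p => join Λ p.1 p.2)).map
    fun ω => join Λ (fun i => coarse q (ω i)) fun i => σ' i)

/-- The Sample-Rotate-Project transition `M_τ(σ', ·)`: the law of `T(σ + τ)` for `σ` distributed
according to `μ_G[σ']`. -/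
def transition {d : ℕ} (Φ : Finset (Site d) → (Site d → Spin) → ℝ)
    (q : ℕ) [NeZero q] (τ : ℝ) (σ' : Site d → Fin q) : Measure (Site d → Fin q) :=
  (constrainedGibbs Φ q σ').map fun ω => coarseConfig q (rotate (τ : Spin) ω)

/-- The uniform mixture `(1/2π) ∫_0^{2π} ν_φ dφ`. -/
def uniformMixture {Y : Type*} [MeasurableSpace Y] (ν : Spin → Measure Y) : Measure Y :=
  (ENNReal.ofReal (2 * Real.pi))⁻¹ • (volume : Measure Spin).bind ν

/-- The discretized measure `μ'_φ = T μ_φ`. -/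
def discretized {d : ℕ} (μ : Spin → Measure (Site d → Spin)) (q : ℕ) [NeZero q] (φ : Spin) :
    Measure (Site d → Fin q) :=
  (μ φ).map (coarseConfig q)

end SampleRotateProject

end

open MeasureTheory SampleRotateProject

/-! On Gibbs measures the projection `T` loses no information. Given the arcs of all spins, a Gibbs
measure `μ` of the rotator model distributes the spins according to a Gibbs measure of the
constrained model, and under Dobrushin's condition there is only one, `K σ' = μ_G[σ']`. Hence
filling in by `K` recovers `μ` from `Tμ` (`map_coarseConfig_bind`). Conversely `K σ'` is carried by
configurations with arcs `σ'`, so `T` undoes `K` (`bind_constrainedGibbs_map`). It remains to see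
that both maps preserve the Gibbs property.

For this, consider the mixed model: Lebesgue a priori measure in `Λ`, arcs `σ'` off `Λ`. Dobrushin's
condition is not assumed for it, but its Gibbs measure is still unique. Reweighting by the partition
function of `Λ` matches Gibbs measures on the lattice with Gibbs measures on `Λᶜ` without the
interactions with `Λ`, whatever the a priori measures in `Λ` are (`outerLift`, `outerRestrict`).
Uniqueness thus passes from the constrained model on the lattice to `Λᶜ`, and from there to the
mixed model. The kernel `γ'_Λ(· | σ')` is the `T`-image of the mixed Gibbs measure
(`coarseSpec_eq_map`). A rotator Gibbs measure is a mixture of mixed Gibbs measures along the arcs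
off `Λ`, so its image satisfies the DLR equation of `γ'`. A mixed Gibbs measure is in turn a mixture
of measures `K` along the arcs in `Λ`, so filling in a `γ'`-Gibbs measure gives a mixture of mixed
Gibbs measures, each of which satisfies the rotator DLR equation in `Λ`.

So `T` is an affine bijection between the translation-invariant Gibbs measures of the two layers
(`bijOn_map_coarseConfig`), and it carries extreme points to extreme points. The transition `M_τ`
fills in, rotates and projects; since `μ_φ` rotated by `τ` is `μ_{φ+τ}`, it moves `μ'_φ` to
`μ'_{φ+τ}`, and the uniform mixture is stationary because Lebesgue measure on the circle is rotation
invariant.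

The analytic input is Dobrushin's uniqueness theorem (`gibbsMeasures_unique_of_dobrushin`) and the
disintegration `lintegral_conditional_gibbs`, which is a limit of finite-volume identities.
Potentials are only measurable, so weak limits do not preserve the DLR equations by themselves;
domination by a finite measure in each finite volume upgrades weak convergence to convergence on all
measurable cylinders (`tendsto_measure_cylinder`). -/

open MeasureTheory

noncomputable section

namespace SampleRotateProject

/-! ### Hamiltonians and Boltzmann weights: bounds, quasilocality, factorization. -/

variable {S X : Type*} [DecidableEq S] [MeasurableSpace X]

/-- Absolutely summable measurable potentials on a general site set. -/
structure AbsSummable (Φ : Finset S → (S → X) → ℝ) : Prop where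
  measurable : ∀ A, Measurable (Φ A)
  dependsOn : ∀ A ω ω', (∀ i ∈ A, ω i = ω' i) → Φ A ω = Φ A ω'
  absSummable : ∀ i, ∑' A : {A : Finset S // i ∈ A}, ⨆ ω, ‖Φ A ω‖ₑ ≠ ∞

/-- The Boltzmann weight `exp (-H_Λ)`. -/
def weight (Φ : Finset S → (S → X) → ℝ) (Λ : Finset S) (ω : S → X) : ℝ≥0∞ :=
  ENNReal.ofReal (Real.exp (-hamiltonian Φ Λ ω))

namespace AbsSummable

variable {Φ : Finset S → (S → X) → ℝ} (hΦ : AbsSummable Φ)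
include hΦ

/-- Union bound: a set that meets `Λ` contains some `i ∈ Λ`, so the sum is at most the finite sum
over `i ∈ Λ` of the single-site sums. -/
lemma tsum_iSup_enorm_ne_top (Λ : Finset S) :
    ∑' A : {A : Finset S // (A ∩ Λ).Nonempty}, ⨆ ω, ‖Φ A ω‖ₑ ≠ ∞ := by
  have key : ∑' A : {A : Finset S // (A ∩ Λ).Nonempty}, ⨆ ω, ‖Φ A ω‖ₑ ≤
      ∑ i ∈ Λ, ∑' A : {A : Finset S // i ∈ A}, ⨆ ω, ‖Φ A ω‖ₑ := by
    have h1 : ∑' A : {A : Finset S // (A ∩ Λ).Nonempty}, ⨆ ω, ‖Φ A ω‖ₑ = _ :=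
      tsum_subtype {A : Finset S | (A ∩ Λ).Nonempty} fun A => ⨆ ω, ‖Φ A ω‖ₑ
    have h2 (i : S) : ∑' A : {A : Finset S // i ∈ A}, ⨆ ω, ‖Φ A ω‖ₑ = _ :=
      tsum_subtype {A : Finset S | i ∈ A} fun A => ⨆ ω, ‖Φ A ω‖ₑ
    rw [h1, Finset.sum_congr rfl fun i _ => h2 i,
      ← Summable.tsum_finsetSum fun i _ => ENNReal.summable]
    refine ENNReal.tsum_le_tsum fun A => ?_
    by_cases hA : (A ∩ Λ).Nonempty
    · obtain ⟨i, hi⟩ := hA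
      rw [Finset.mem_inter] at hi
      refine (Set.indicator_le_self _ _ A).trans ?_
      refine le_trans ?_ (Finset.single_le_sum (fun _ _ => zero_le) hi.2)
      rw [Set.indicator_of_mem (by simpa using hi.1)]
    · rw [Set.indicator_of_notMem (by simpa using hA)]
      exact zero_le
  exact ne_top_of_le_ne_top (ENNReal.sum_ne_top.2 fun i _ => hΦ.absSummable i) key

lemma summable_toReal (Λ : Finset S) : Summable fun A : {A : Finset S // (A ∩ Λ).Nonempty} =>
    (⨆ ω, ‖Φ A ω‖ₑ).toReal :=
  ENNReal.summable_toReal (hΦ.tsum_iSup_enorm_ne_top Λ)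

lemma norm_le_toReal {Λ : Finset S} (A : {A : Finset S // (A ∩ Λ).Nonempty}) (ω : S → X) :
    ‖Φ A ω‖ ≤ (⨆ ω, ‖Φ A ω‖ₑ).toReal := by
  have h := ENNReal.ne_top_of_tsum_ne_top (hΦ.tsum_iSup_enorm_ne_top Λ) A
  rw [← toReal_enorm]
  exact ENNReal.toReal_mono h (le_iSup (fun ω => ‖Φ A ω‖ₑ) ω)

lemma summable (Λ : Finset S) (ω : S → X) :
    Summable fun A : {A : Finset S // (A ∩ Λ).Nonempty} => Φ A ω :=
  Summable.of_norm_bounded (hΦ.summable_toReal Λ) fun A => hΦ.norm_le_toReal A ω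

lemma summable_ite (Λ : Finset S) (ω : S → X) :
    Summable fun A : Finset S => if (A ∩ Λ).Nonempty then Φ A ω else 0 := by
  have := (summable_subtype_iff_indicator
    (s := {A : Finset S | (A ∩ Λ).Nonempty}) (f := fun A => Φ A ω)).1 (hΦ.summable Λ ω)
  refine this.congr fun A => ?_
  simp [Set.indicator_apply]

omit hΦ [MeasurableSpace X] in
-- Extension by zero puts the Hamiltonians of all volumes over one index set, so that they can be
-- subtracted or reindexed term by term.
lemma _root_.SampleRotateProject.hamiltonian_eq_tsum_ite (Λ : Finset S) (ω : S → X) :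
    hamiltonian Φ Λ ω = ∑' A : Finset S, if (A ∩ Λ).Nonempty then Φ A ω else 0 := by
  have : ∑' A : {A : Finset S // (A ∩ Λ).Nonempty}, Φ A ω = _ :=
    tsum_subtype {A : Finset S | (A ∩ Λ).Nonempty} fun A => Φ A ω
  rw [hamiltonian, this]
  exact tsum_congr fun A => by simp [Set.indicator_apply]

lemma measurable_hamiltonian [Countable S] (Λ : Finset S) : Measurable (hamiltonian Φ Λ) :=
  Measurable.tsum fun A => hΦ.measurable A

lemma exists_norm_hamiltonian_le (Λ : Finset S) : ∃ h : ℝ, ∀ ω, |hamiltonian Φ Λ ω| ≤ h :=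
  ⟨_, fun ω => tsum_of_norm_bounded (hΦ.summable_toReal Λ).hasSum fun A => hΦ.norm_le_toReal A ω⟩

/-- The Hamiltonian is quasilocal. -/
lemma exists_hamiltonian_sub_le (Λ : Finset S) {ε : ℝ} (hε : 0 < ε) :
    ∃ Δ : Finset S, ∀ ω ω' : S → X, (∀ i ∈ Δ, ω i = ω' i) →
      |hamiltonian Φ Λ ω - hamiltonian Φ Λ ω'| ≤ ε := by
  have h := tendstoUniformly_tsum (hΦ.summable_toReal Λ) fun A ω => hΦ.norm_le_toReal A ω
  rw [Metric.tendstoUniformly_iff] at h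
  obtain ⟨t, ht⟩ := (h (ε / 2) (by positivity)).exists
  refine ⟨t.biUnion fun A => A.1, fun ω ω' hω => ?_⟩
  have heq : ∑ A ∈ t, Φ A ω = ∑ A ∈ t, Φ A ω' :=
    Finset.sum_congr rfl fun A hA => hΦ.dependsOn A _ _ fun i hi =>
      hω i (Finset.mem_biUnion.2 ⟨A, hA, hi⟩)
  have h1 := ht ω
  have h2 := ht ω'
  rw [Real.dist_eq] at h1 h2
  change |hamiltonian Φ Λ ω - _| < _ at h1
  change |hamiltonian Φ Λ ω' - _| < _ at h2
  rw [heq] at h1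
  have := abs_sub_le (hamiltonian Φ Λ ω) (∑ A ∈ t, Φ A ω') (hamiltonian Φ Λ ω')
  rw [abs_sub_comm (∑ A ∈ t, Φ A ω')] at this
  linarith

/-- The difference of two Hamiltonians depends only on the spins off the smaller volume. -/
lemma hamiltonian_sub_eq {Λ Δ : Finset S} (hΛ : Λ ⊆ Δ) (ω : S → X) :
    hamiltonian Φ Δ ω - hamiltonian Φ Λ ω =
      ∑' A : Finset S, if (A ∩ Δ).Nonempty ∧ ¬(A ∩ Λ).Nonempty then Φ A ω else 0 := by
  rw [hamiltonian_eq_tsum_ite, hamiltonian_eq_tsum_ite,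
    ← (hΦ.summable_ite Δ ω).tsum_sub (hΦ.summable_ite Λ ω)]
  refine tsum_congr fun A => ?_
  by_cases h1 : (A ∩ Λ).Nonempty
  · have h2 : (A ∩ Δ).Nonempty := h1.mono (Finset.inter_subset_inter_left hΛ)
    simp [h1, h2]
  · simp [h1]

lemma dependsOn_hamiltonian_sub {Λ Δ : Finset S} (hΛ : Λ ⊆ Δ) :
    DependsOn (fun ω => hamiltonian Φ Δ ω - hamiltonian Φ Λ ω) ((Λ : Set S)ᶜ) := by
  intro ω ω' h
  simp only [hΦ.hamiltonian_sub_eq hΛ]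
  refine tsum_congr fun A => ?_
  split_ifs with hA
  · refine hΦ.dependsOn A _ _ fun i hi => h i fun hi' => hA.2 ⟨i, ?_⟩
    exact Finset.mem_inter.2 ⟨hi, hi'⟩
  · rfl

lemma measurable_weight [Countable S] (Λ : Finset S) : Measurable (weight Φ Λ) :=
  ENNReal.measurable_ofReal.comp (Real.measurable_exp.comp (hΦ.measurable_hamiltonian Λ).neg)

lemma exists_weight_bounds (Λ : Finset S) :
    ∃ c : ℝ≥0∞, c ≠ 0 ∧ c ≠ ∞ ∧ ∀ ω, c⁻¹ ≤ weight Φ Λ ω ∧ weight Φ Λ ω ≤ c := by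
  obtain ⟨h, hh⟩ := hΦ.exists_norm_hamiltonian_le Λ
  refine ⟨ENNReal.ofReal (Real.exp h), by simp [Real.exp_pos], ENNReal.ofReal_ne_top,
    fun ω => ⟨?_, ?_⟩⟩
  · rw [← ENNReal.ofReal_inv_of_pos (Real.exp_pos h), ← Real.exp_neg]
    exact ENNReal.ofReal_le_ofReal (Real.exp_le_exp.2 (neg_le_neg (abs_le.1 (hh ω)).2))
  · exact ENNReal.ofReal_le_ofReal (Real.exp_le_exp.2 (by linarith [(abs_le.1 (hh ω)).1]))

/-- The Boltzmann weights factorize. -/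
lemma exists_weight_eq_mul [Countable S] {Λ Δ : Finset S} (hΛ : Λ ⊆ Δ) :
    ∃ v : (S → X) → ℝ≥0∞, Measurable v ∧ DependsOn v ((Λ : Set S)ᶜ) ∧
      weight Φ Δ = v * weight Φ Λ := by
  refine ⟨fun ω => ENNReal.ofReal (Real.exp (-(hamiltonian Φ Δ ω - hamiltonian Φ Λ ω))), ?_, ?_, ?_⟩
  · exact ENNReal.measurable_ofReal.comp (Real.measurable_exp.comp
      ((hΦ.measurable_hamiltonian Δ).sub (hΦ.measurable_hamiltonian Λ)).neg)
  · intro ω ω' h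
    have := hΦ.dependsOn_hamiltonian_sub hΛ h
    simp only at this
    simp only [this]
  · funext ω
    rw [Pi.mul_apply, weight, weight, ← ENNReal.ofReal_mul (Real.exp_nonneg _), ← Real.exp_add]
    congr 3
    ring

/-- The Boltzmann weights are quasilocal. -/
lemma exists_weight_le_mul (Λ : Finset S) {r : ℝ} (hr : 1 < r) :
    ∃ Δ : Finset S, ∀ ω ω' : S → X, (∀ i ∈ Δ, ω i = ω' i) →
      weight Φ Λ ω ≤ ENNReal.ofReal r * weight Φ Λ ω' := by
  obtain ⟨Δ, hΔ⟩ := hΦ.exists_hamiltonian_sub_le Λ (Real.log_pos hr)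
  refine ⟨Δ, fun ω ω' h => ?_⟩
  rw [weight, weight, ← ENNReal.ofReal_mul (by linarith)]
  refine ENNReal.ofReal_le_ofReal ?_
  nth_rewrite 1 [← Real.exp_log (by linarith : (0 : ℝ) < r)]
  rw [← Real.exp_add]
  exact Real.exp_le_exp.2 (by linarith [(abs_le.1 (hΔ ω ω' h)).1])

end AbsSummable

end SampleRotateProject
end

/-! ### The Gibbsian specification as an operator on functions; consistency and DLR equations. -/

open MeasureTheory

noncomputable section

namespace SampleRotateProject

set_option linter.unusedSectionVars false

variable {S X : Type*} [DecidableEq S] [MeasurableSpace X]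

/-- Identifies integration over the spins in `Λ` with the marginal integral `∫⋯∫⁻_Λ`, whose Fubini
rules drive all later computations. -/
lemma join_eq_updateFinset (Λ : Finset S) (ζ : Λ → X) (η : S → X) :
    (join Λ ζ fun i => η i) = Function.updateFinset η Λ ζ := by
  funext i
  simp [join, Function.updateFinset]

section lmarginal

variable {ρ : S → Measure X}

lemma dependsOn_lmarginal (Λ : Finset S) (f : (S → X) → ℝ≥0∞) :
    DependsOn (∫⋯∫⁻_Λ, f ∂ρ) ((Λ : Set S)ᶜ) :=
  fun _ _ h => lmarginal_congr ρ f fun i hi => h i (by simpa using hi)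

lemma lmarginal_mul_left {Λ : Finset S} {g f : (S → X) → ℝ≥0∞} (hg : DependsOn g ((Λ : Set S)ᶜ))
    (hf : Measurable f) : ∫⋯∫⁻_Λ, g * f ∂ρ = g * ∫⋯∫⁻_Λ, f ∂ρ := by
  funext η
  have h (ζ : Λ → X) : g (Function.updateFinset η Λ ζ) = g η :=
    hg fun i hi => by simp [Function.updateFinset, show i ∉ Λ by simpa using hi]
  simp only [lmarginal, Pi.mul_apply, h]
  rw [lintegral_const_mul]
  exact hf.comp measurable_updateFinset

lemma lmarginal_of_subset [∀ i, IsFiniteMeasure (ρ i)] {Λ Δ : Finset S} (hΛ : Λ ⊆ Δ)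
    {f : (S → X) → ℝ≥0∞} (hf : Measurable f) :
    ∫⋯∫⁻_Δ, f ∂ρ = ∫⋯∫⁻_Δ \ Λ, ∫⋯∫⁻_Λ, f ∂ρ ∂ρ := by
  conv_lhs => rw [← Finset.sdiff_union_of_subset hΛ]
  exact lmarginal_union ρ f hf Finset.sdiff_disjoint

/-- The total mass of the a priori measure in the volume `Λ`. -/
def volMass (ρ : S → Measure X) (Λ : Finset S) : ℝ≥0∞ := Measure.pi (fun i : Λ => ρ i) Set.univ

lemma lmarginal_const (Λ : Finset S) (c : ℝ≥0∞) (η : S → X) :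
    (∫⋯∫⁻_Λ, fun _ => c ∂ρ) η = c * volMass ρ Λ := by
  simp [lmarginal, volMass]

lemma volMass_ne_top [∀ i, IsFiniteMeasure (ρ i)] (Λ : Finset S) : volMass ρ Λ ≠ ∞ :=
  measure_ne_top _ _

lemma volMass_ne_zero [∀ i, IsFiniteMeasure (ρ i)] [∀ i, NeZero (ρ i)] (Λ : Finset S) :
    volMass ρ Λ ≠ 0 := by
  rw [volMass, Measure.pi_univ, Finset.prod_ne_zero_iff]
  intro i _
  simpa using NeZero.ne (ρ i)

end lmarginal

/-- The partition function. -/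
def partitionFun (Φ : Finset S → (S → X) → ℝ) (ρ : S → Measure X) (Λ : Finset S) :
    (S → X) → ℝ≥0∞ :=
  ∫⋯∫⁻_Λ, weight Φ Λ ∂ρ

/-- The action of the Gibbsian specification on functions. -/
def gibbsOp (Φ : Finset S → (S → X) → ℝ) (ρ : S → Measure X) (Λ : Finset S)
    (f : (S → X) → ℝ≥0∞) : (S → X) → ℝ≥0∞ :=
  (partitionFun Φ ρ Λ)⁻¹ * ∫⋯∫⁻_Λ, weight Φ Λ * f ∂ρ

variable {Φ : Finset S → (S → X) → ℝ} {ρ : S → Measure X}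

lemma lintegral_normalize {Y : Type*} [MeasurableSpace Y] (m : Measure Y) (f : Y → ℝ≥0∞) :
    ∫⁻ y, f y ∂(normalize m) = (m Set.univ)⁻¹ * ∫⁻ y, f y ∂m := by
  rw [normalize, lintegral_smul_measure, smul_eq_mul]

lemma isProbabilityMeasure_normalize {Y : Type*} [MeasurableSpace Y] {m : Measure Y}
    (h0 : m Set.univ ≠ 0) (h1 : m Set.univ ≠ ∞) : IsProbabilityMeasure (normalize m) :=
  ⟨by rw [normalize, Measure.smul_apply, smul_eq_mul, ENNReal.inv_mul_cancel h0 h1]⟩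

section

variable [Countable S] (hΦ : AbsSummable Φ)
include hΦ

lemma lintegral_boltzmann (Λ : Finset S) (m : Measure (S → X)) {f : (S → X) → ℝ≥0∞}
    (hf : Measurable f) : ∫⁻ ω, f ω ∂(boltzmann Φ Λ m) = ∫⁻ ω, (weight Φ Λ * f) ω ∂m :=
  lintegral_withDensity_eq_lintegral_mul m (hΦ.measurable_weight Λ) hf

lemma lintegral_boltzmann_map_join (ρ : S → Measure X) (Λ : Finset S) (η : S → X)
    {f : (S → X) → ℝ≥0∞} (hf : Measurable f) :
    ∫⁻ ω, f ω ∂(boltzmann Φ Λ ((Measure.pi fun i : Λ => ρ i).map fun ζ => join Λ ζ fun i => η i)) =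
      (∫⋯∫⁻_Λ, weight Φ Λ * f ∂ρ) η := by
  rw [lintegral_boltzmann hΦ Λ _ hf, lintegral_map ((hΦ.measurable_weight Λ).mul hf)]
  · simp only [join_eq_updateFinset]
    rfl
  · simp only [join_eq_updateFinset]
    exact measurable_updateFinset

lemma lintegral_gibbsSpec (ρ : S → Measure X) (Λ : Finset S) (η : S → X)
    {f : (S → X) → ℝ≥0∞} (hf : Measurable f) :
    ∫⁻ ω, f ω ∂(gibbsSpec Φ ρ Λ η) = gibbsOp Φ ρ Λ f η := by
  rw [gibbsSpec, lintegral_normalize, lintegral_boltzmann_map_join hΦ ρ Λ η hf, gibbsOp,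
    Pi.mul_apply, Pi.inv_apply, ← lintegral_one,
    lintegral_boltzmann_map_join hΦ ρ Λ η measurable_const]
  congr 2
  simp only [partitionFun]
  congr 1
  funext ω
  simp

lemma gibbsSpec_apply (ρ : S → Measure X) (Λ : Finset S) (η : S → X) {B : Set (S → X)}
    (hB : MeasurableSet B) : gibbsSpec Φ ρ Λ η B = gibbsOp Φ ρ Λ (B.indicator 1) η := by
  rw [← lintegral_gibbsSpec hΦ ρ Λ η (measurable_one.indicator hB), lintegral_indicator_one hB]

/-- The constant comes from the sup norm of `H_Λ` alone, so it serves all boundary conditions and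
all a priori measures at once. -/
lemma partitionFun_bounds (Λ : Finset S) : ∃ c : ℝ≥0∞, c ≠ 0 ∧ c ≠ ∞ ∧ (∀ ω, weight Φ Λ ω ≤ c) ∧
    ∀ (ρ : S → Measure X) (η : S → X), c⁻¹ * volMass ρ Λ ≤ partitionFun Φ ρ Λ η ∧
      partitionFun Φ ρ Λ η ≤ c * volMass ρ Λ := by
  obtain ⟨c, h0, h1, hc⟩ := hΦ.exists_weight_bounds Λ
  refine ⟨c, h0, h1, fun ω => (hc ω).2, fun ρ η => ⟨?_, ?_⟩⟩
  · rw [← lmarginal_const Λ c⁻¹ η]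
    exact lmarginal_mono (fun ω => (hc ω).1) η
  · rw [← lmarginal_const Λ c η]
    exact lmarginal_mono (fun ω => (hc ω).2) η

lemma partitionFun_ne_top [∀ i, IsFiniteMeasure (ρ i)] (Λ : Finset S) (η : S → X) :
    partitionFun Φ ρ Λ η ≠ ∞ := by
  obtain ⟨c, -, h1, -, hc⟩ := partitionFun_bounds hΦ Λ
  exact ne_top_of_le_ne_top (ENNReal.mul_ne_top h1 (volMass_ne_top Λ)) (hc ρ η).2

lemma partitionFun_ne_zero [∀ i, IsFiniteMeasure (ρ i)] [∀ i, NeZero (ρ i)]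
    (Λ : Finset S) (η : S → X) : partitionFun Φ ρ Λ η ≠ 0 := by
  obtain ⟨c, -, h1, -, hc⟩ := partitionFun_bounds hΦ Λ
  intro h
  have := (hc ρ η).1
  rw [h, nonpos_iff_eq_zero, mul_eq_zero] at this
  exact this.elim (by simpa using h1) (volMass_ne_zero Λ)

end

lemma dependsOn_partitionFun (Λ : Finset S) : DependsOn (partitionFun Φ ρ Λ) ((Λ : Set S)ᶜ) :=
  dependsOn_lmarginal Λ _

lemma dependsOn_gibbsOp (Λ : Finset S) (f : (S → X) → ℝ≥0∞) :
    DependsOn (gibbsOp Φ ρ Λ f) ((Λ : Set S)ᶜ) := by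
  intro ω ω' h
  simp only [gibbsOp, Pi.mul_apply, Pi.inv_apply]
  rw [dependsOn_partitionFun Λ h, dependsOn_lmarginal Λ _ h]

/-- The DLR equation for the volume `Λ`. -/
def IsDLR (Φ : Finset S → (S → X) → ℝ) (ρ : S → Measure X) (Λ : Finset S)
    (μ : Measure (S → X)) : Prop :=
  ∀ f : (S → X) → ℝ≥0∞, Measurable f → ∫⁻ η, gibbsOp Φ ρ Λ f η ∂μ = ∫⁻ ω, f ω ∂μ

section

variable [Countable S] (hΦ : AbsSummable Φ) [∀ i, IsFiniteMeasure (ρ i)]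
include hΦ

lemma measurable_partitionFun (Λ : Finset S) : Measurable (partitionFun Φ ρ Λ) :=
  (hΦ.measurable_weight Λ).lmarginal ρ

lemma measurable_gibbsOp (Λ : Finset S) {f : (S → X) → ℝ≥0∞} (hf : Measurable f) :
    Measurable (gibbsOp Φ ρ Λ f) :=
  (measurable_partitionFun hΦ Λ).inv.mul (((hΦ.measurable_weight Λ).mul hf).lmarginal ρ)

lemma measurable_gibbsSpec (Λ : Finset S) : Measurable (gibbsSpec Φ ρ Λ) := by
  refine Measure.measurable_of_measurable_coe _ fun B hB => ?_
  simp only [gibbsSpec_apply hΦ ρ Λ _ hB]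
  exact measurable_gibbsOp hΦ Λ (measurable_one.indicator hB)

lemma isDLR_iff (Λ : Finset S) (μ : Measure (S → X)) : IsDLR Φ ρ Λ μ ↔
    ∀ B : Set (S → X), MeasurableSet B → ∫⁻ η, gibbsSpec Φ ρ Λ η B ∂μ = μ B := by
  constructor
  · intro h B hB
    simp only [gibbsSpec_apply hΦ ρ Λ _ hB]
    rw [h _ (measurable_one.indicator hB), lintegral_indicator_one hB]
  · intro h f hf
    have hm := measurable_gibbsSpec hΦ (ρ := ρ) Λ
    have : μ.bind (gibbsSpec Φ ρ Λ) = μ := by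
      ext B hB
      rw [Measure.bind_apply hB hm.aemeasurable, h B hB]
    conv_rhs => rw [← this]
    rw [Measure.lintegral_bind hm.aemeasurable hf.aemeasurable]
    simp only [lintegral_gibbsSpec hΦ ρ Λ _ hf]

lemma mem_gibbsMeasures_iff (μ : Measure (S → X)) : μ ∈ gibbsMeasures (gibbsSpec Φ ρ) ↔
    IsProbabilityMeasure μ ∧ ∀ Λ, IsDLR Φ ρ Λ μ := by
  simp only [isDLR_iff hΦ]
  rfl

/-- `L_Δ (w_Δ · g · γ_Λ f) = L_Δ (w_Δ · g · f)` for `g` that only depends on the spins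
off `Λ ⊆ Δ`. -/
lemma lmarginal_weight_mul_gibbsOp [∀ i, NeZero (ρ i)] {Λ Δ : Finset S} (hΛ : Λ ⊆ Δ)
    {f : (S → X) → ℝ≥0∞} (hf : Measurable f) :
    ∫⋯∫⁻_Δ, weight Φ Δ * gibbsOp Φ ρ Λ f ∂ρ = ∫⋯∫⁻_Δ, weight Φ Δ * f ∂ρ := by
  -- With `w_Δ = v w_Λ` and `v` independent of the spins in `Λ`, integrating over `Λ` first reduces
  -- the claim to `L_Λ(w_Λ) γ_Λ f = L_Λ(w_Λ f)`.
  obtain ⟨v, hv, hvd, hw⟩ := hΦ.exists_weight_eq_mul hΛ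
  have hwm := hΦ.measurable_weight Λ
  have hg := measurable_gibbsOp hΦ (ρ := ρ) Λ hf
  rw [hw, mul_assoc, mul_assoc, lmarginal_of_subset hΛ (hv.mul (hwm.mul hg)),
    lmarginal_of_subset hΛ (hv.mul (hwm.mul hf)), lmarginal_mul_left hvd (hwm.mul hg),
    lmarginal_mul_left hvd (hwm.mul hf), mul_comm (weight Φ Λ) (gibbsOp Φ ρ Λ f),
    lmarginal_mul_left (dependsOn_gibbsOp Λ f) hwm]
  congr 2
  funext η
  simp only [gibbsOp, Pi.mul_apply, Pi.inv_apply]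
  change (partitionFun Φ ρ Λ η)⁻¹ * _ * partitionFun Φ ρ Λ η = _
  rw [mul_comm, ← mul_assoc, ENNReal.mul_inv_cancel (partitionFun_ne_zero hΦ Λ η)
    (partitionFun_ne_top hΦ Λ η), one_mul]

lemma gibbsOp_gibbsOp [∀ i, NeZero (ρ i)] {Λ Δ : Finset S} (hΛ : Λ ⊆ Δ)
    {f : (S → X) → ℝ≥0∞} (hf : Measurable f) :
    gibbsOp Φ ρ Δ (gibbsOp Φ ρ Λ f) = gibbsOp Φ ρ Δ f := by
  rw [gibbsOp, lmarginal_weight_mul_gibbsOp hΦ hΛ hf]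
  rfl

/-- Consistency: the DLR equation for a volume implies the one for smaller volumes. -/
lemma IsDLR.mono [∀ i, NeZero (ρ i)] {Λ Δ : Finset S} (hΛ : Λ ⊆ Δ) {μ : Measure (S → X)}
    (h : IsDLR Φ ρ Δ μ) : IsDLR Φ ρ Λ μ := by
  intro f hf
  rw [← h _ (measurable_gibbsOp hΦ Λ hf), gibbsOp_gibbsOp hΦ hΛ hf, h f hf]

lemma isDLR_gibbsSpec [∀ i, NeZero (ρ i)] {Λ Δ : Finset S} (hΛ : Λ ⊆ Δ) (η : S → X) :
    IsDLR Φ ρ Λ (gibbsSpec Φ ρ Δ η) := by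
  intro f hf
  rw [lintegral_gibbsSpec hΦ ρ Δ η (measurable_gibbsOp hΦ Λ hf), gibbsOp_gibbsOp hΦ hΛ hf,
    lintegral_gibbsSpec hΦ ρ Δ η hf]

lemma gibbsOp_const [∀ i, NeZero (ρ i)] (Λ : Finset S) (c : ℝ≥0∞) (η : S → X) :
    gibbsOp Φ ρ Λ (fun _ => c) η = c := by
  have : weight Φ Λ * (fun _ => c) = (fun _ => c) * weight Φ Λ := mul_comm _ _
  rw [gibbsOp, this, lmarginal_mul_left (fun _ _ _ => rfl) (hΦ.measurable_weight Λ)]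
  change (partitionFun Φ ρ Λ η)⁻¹ * (c * partitionFun Φ ρ Λ η) = c
  rw [mul_left_comm, ENNReal.inv_mul_cancel (partitionFun_ne_zero hΦ Λ η)
    (partitionFun_ne_top hΦ Λ η), mul_one]

omit [Countable S] hΦ [∀ i, IsFiniteMeasure (ρ i)] in
lemma gibbsOp_mono (Λ : Finset S) {f g : (S → X) → ℝ≥0∞} (h : f ≤ g) :
    gibbsOp Φ ρ Λ f ≤ gibbsOp Φ ρ Λ g := by
  intro η
  exact mul_le_mul_right (lmarginal_mono (fun ω => mul_le_mul_right (h ω) _) η) _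

lemma isProbabilityMeasure_gibbsSpec [∀ i, NeZero (ρ i)] (Λ : Finset S) (η : S → X) :
    IsProbabilityMeasure (gibbsSpec Φ ρ Λ η) :=
  ⟨by rw [← lintegral_one, lintegral_gibbsSpec hΦ ρ Λ η measurable_const, gibbsOp_const hΦ]⟩

end

end SampleRotateProject
end

/-! ### Compactness: limits of DLR measures, existence, and infinite-volume limits under uniqueness.
-/

open MeasureTheory

noncomputable section

namespace SampleRotateProject

set_option linter.unusedSectionVars false

variable {S X : Type*} [DecidableEq S] [MeasurableSpace X]
  {Φ : Finset S → (S → X) → ℝ} {ρ : S → Measure X}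

/-- Functions that, up to a uniformly small error, depend on finitely many spins only. -/
def IsQuasilocal (f : (S → X) → ℝ≥0∞) : Prop :=
  ∀ ε : ℝ≥0∞, ε ≠ 0 → ∃ Δ : Finset S, ∀ ω ω' : S → X, (∀ i ∈ Δ, ω i = ω' i) → f ω ≤ f ω' + ε

lemma isQuasilocal_indicator_cylinder (Δ : Finset S) (B : Set (Δ → X)) :
    IsQuasilocal ((cylinder Δ B).indicator (1 : (S → X) → ℝ≥0∞)) := by
  refine fun ε _ => ⟨Δ, fun ω ω' h => ?_⟩
  have : Δ.restrict ω = Δ.restrict ω' := funext fun i => h i i.2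
  have h2 : ω ∈ cylinder Δ B ↔ ω' ∈ cylinder Δ B := by rw [mem_cylinder, mem_cylinder, this]
  by_cases hω : ω ∈ cylinder Δ B
  · rw [Set.indicator_of_mem hω, Set.indicator_of_mem (h2.1 hω)]
    exact le_self_add
  · rw [Set.indicator_of_notMem hω]
    exact zero_le

lemma updateFinset_congr_of_agree {Λ Δ : Finset S} {ω ω' : S → X} (h : ∀ i ∈ Δ, ω i = ω' i)
    (ζ : Λ → X) : ∀ i ∈ Δ, Function.updateFinset ω Λ ζ i = Function.updateFinset ω' Λ ζ i := by
  intro i hi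
  simp only [Function.updateFinset]
  split_ifs
  · rfl
  · exact h i hi

lemma gibbsOp_le_one [Countable S] (hΦ : AbsSummable Φ) [∀ i, IsFiniteMeasure (ρ i)]
    [∀ i, NeZero (ρ i)] (Λ : Finset S) {f : (S → X) → ℝ≥0∞} (hf : f ≤ 1) :
    gibbsOp Φ ρ Λ f ≤ 1 := by
  intro η
  calc gibbsOp Φ ρ Λ f η ≤ gibbsOp Φ ρ Λ (fun _ => 1) η := gibbsOp_mono Λ hf η
    _ = 1 := gibbsOp_const hΦ Λ 1 η

/-- For boundary conditions that agree on a large set, the weights differ by a factor `R` close to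
`1` and `f` by a small `δ`. Numerator and partition function inherit these errors, and their
quotient is at most 1. -/
lemma isQuasilocal_gibbsOp [Countable S] (hΦ : AbsSummable Φ) [∀ i, IsFiniteMeasure (ρ i)]
    [∀ i, NeZero (ρ i)] (Λ : Finset S) {f : (S → X) → ℝ≥0∞} (hf1 : f ≤ 1) (hfm : Measurable f)
    (hf : IsQuasilocal f) : IsQuasilocal (gibbsOp Φ ρ Λ f) := by
  intro ε hε
  obtain ⟨e, he0, he1, heε⟩ : ∃ e : ℝ, 0 < e ∧ e ≤ 1 ∧ ENNReal.ofReal e ≤ ε := by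
    refine ⟨(min ε 1).toReal, ?_, ?_, ?_⟩
    · exact ENNReal.toReal_pos (by simp [hε]) (by simp)
    · exact ENNReal.toReal_le_of_le_ofReal zero_le_one (by simp)
    · rw [ENNReal.ofReal_toReal (by simp)]
      exact min_le_left _ _
  -- The error at the end is at most `r² - 1 + r² · e/4`, which for `r = 1 + e/8` and `e ≤ 1` is
  -- below `e`.
  set r : ℝ := 1 + e / 8 with hr
  obtain ⟨Δ₁, h₁⟩ := hΦ.exists_weight_le_mul Λ (by linarith : 1 < r)
  obtain ⟨Δ₂, h₂⟩ := hf (ENNReal.ofReal (e / 4)) (by simpa using he0)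
  refine ⟨Δ₁ ∪ Δ₂, fun ω ω' h => ?_⟩
  have h1 (ω ω' : S → X) (h : ∀ i ∈ Δ₁ ∪ Δ₂, ω i = ω' i) :=
    h₁ ω ω' fun i hi => h i (Finset.mem_union_left _ hi)
  have h2 (ω ω' : S → X) (h : ∀ i ∈ Δ₁ ∪ Δ₂, ω i = ω' i) :=
    h₂ ω ω' fun i hi => h i (Finset.mem_union_right _ hi)
  set R := ENNReal.ofReal r
  set δ := ENNReal.ofReal (e / 4)
  set Z := partitionFun Φ ρ Λ
  have hZ (ω ω' : S → X) (h : ∀ i ∈ Δ₁ ∪ Δ₂, ω i = ω' i) : Z ω ≤ R * Z ω' := by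
    rw [show R * Z ω' = ∫⁻ ζ : Λ → X, R * weight Φ Λ (Function.updateFinset ω' Λ ζ)
        ∂Measure.pi fun i : Λ => ρ i from
      (lintegral_const_mul _ ((hΦ.measurable_weight Λ).comp measurable_updateFinset)).symm]
    exact lintegral_mono fun ζ => h1 _ _ (updateFinset_congr_of_agree h ζ)
  have hN : (∫⋯∫⁻_Λ, weight Φ Λ * f ∂ρ) ω ≤
      R * ((∫⋯∫⁻_Λ, weight Φ Λ * f ∂ρ) ω' + δ * Z ω') := by
    have hw := (hΦ.measurable_weight Λ).comp (measurable_updateFinset (x := ω') (s := Λ))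
    have hf' := hfm.comp (measurable_updateFinset (x := ω') (s := Λ))
    rw [show R * ((∫⋯∫⁻_Λ, weight Φ Λ * f ∂ρ) ω' + δ * Z ω') =
        ∫⁻ ζ : Λ → X, R * ((weight Φ Λ * f) (Function.updateFinset ω' Λ ζ) +
          δ * weight Φ Λ (Function.updateFinset ω' Λ ζ)) ∂Measure.pi fun i : Λ => ρ i by
      rw [lintegral_const_mul _ (by exact (hw.mul hf').add (hw.const_mul _)),
        lintegral_add_left (by exact hw.mul hf'), lintegral_const_mul _ (by exact hw)]
      rfl]
    refine lintegral_mono fun ζ => ?_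
    have ha := updateFinset_congr_of_agree h ζ
    calc _ ≤ R * weight Φ Λ (Function.updateFinset ω' Λ ζ) *
          (f (Function.updateFinset ω' Λ ζ) + δ) := mul_le_mul' (h1 _ _ ha) (h2 _ _ ha)
      _ = _ := by simp only [Pi.mul_apply]; ring
  have hZ0 := partitionFun_ne_zero hΦ (ρ := ρ) Λ ω'
  have hZt := partitionFun_ne_top hΦ (ρ := ρ) Λ ω'
  have hR0 : R ≠ 0 := by
    simp only [R, ne_eq, ENNReal.ofReal_eq_zero, not_le]
    linarith
  have hRt : R ≠ ∞ := ENNReal.ofReal_ne_top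
  have hinv : (Z ω)⁻¹ ≤ R * (Z ω')⁻¹ := by
    have := hZ ω' ω fun i hi => (h i hi).symm
    have h3 := ENNReal.inv_le_inv.2 this
    rw [ENNReal.mul_inv (Or.inl hR0) (Or.inl hRt)] at h3
    calc (Z ω)⁻¹ = R * (R⁻¹ * (Z ω)⁻¹) := by
          rw [← mul_assoc, ENNReal.mul_inv_cancel hR0 hRt, one_mul]
      _ ≤ _ := mul_le_mul_right h3 R
  set x := gibbsOp Φ ρ Λ f ω' with hx
  have hx1 : x ≤ 1 := gibbsOp_le_one hΦ Λ hf1 ω'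
  have hRR : R * R = 1 + ENNReal.ofReal (r * r - 1) := by
    rw [← ENNReal.ofReal_mul (by linarith), ← ENNReal.ofReal_one,
      ← ENNReal.ofReal_add zero_le_one (by nlinarith)]
    congr 1
    ring
  calc gibbsOp Φ ρ Λ f ω = (Z ω)⁻¹ * (∫⋯∫⁻_Λ, weight Φ Λ * f ∂ρ) ω := rfl
    _ ≤ (R * (Z ω')⁻¹) * (R * ((∫⋯∫⁻_Λ, weight Φ Λ * f ∂ρ) ω' + δ * Z ω')) := mul_le_mul' hinv hN
    _ = R * R * (x + δ * ((Z ω')⁻¹ * Z ω')) := by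
      rw [hx, gibbsOp, Pi.mul_apply, Pi.inv_apply]
      ring
    _ = x + (ENNReal.ofReal (r * r - 1) * x + (1 + ENNReal.ofReal (r * r - 1)) * δ) := by
      rw [ENNReal.inv_mul_cancel hZ0 hZt, hRR]
      ring
    _ ≤ x + (ENNReal.ofReal (r * r - 1) * 1 + (1 + ENNReal.ofReal (r * r - 1)) * δ) := by gcongr
    _ ≤ x + ε := by
      gcongr
      refine le_trans ?_ heε
      rw [mul_one, ← ENNReal.ofReal_one, ← ENNReal.ofReal_add zero_le_one (by nlinarith),
        ← ENNReal.ofReal_mul (by nlinarith), ← ENNReal.ofReal_add (by nlinarith)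
          (mul_nonneg (by nlinarith) (by linarith))]
      refine ENNReal.ofReal_le_ofReal ?_
      rw [hr]
      nlinarith [mul_pos he0 he0, mul_le_mul he1 he1 he0.le zero_le_one]

/-- Gibbs measures are locally dominated by a finite measure. -/
lemma exists_dominating_measure [Countable S] (hΦ : AbsSummable Φ) [∀ i, IsFiniteMeasure (ρ i)]
    [∀ i, NeZero (ρ i)] (Δ : Finset S) : ∃ m : Measure (Δ → X), IsFiniteMeasure m ∧
      ∀ ν : Measure (S → X), IsProbabilityMeasure ν → IsDLR Φ ρ Δ ν →
        ∀ B : Set (Δ → X), MeasurableSet B → ν (cylinder Δ B) ≤ m B := by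
  obtain ⟨c, h0, h1, hw, hc⟩ := partitionFun_bounds hΦ Δ
  set V := volMass ρ Δ with hV
  have hV0 : V ≠ 0 := volMass_ne_zero Δ
  have hC : (c⁻¹ * V)⁻¹ * c ≠ ∞ := by
    refine ENNReal.mul_ne_top (ENNReal.inv_ne_top.2 (mul_ne_zero ?_ hV0)) h1
    simpa using h1
  refine ⟨((c⁻¹ * V)⁻¹ * c) • Measure.pi fun i : Δ => ρ i, ?_, fun ν hν hd B hB => ?_⟩
  · exact ⟨by
      rw [Measure.smul_apply, smul_eq_mul]
      exact ENNReal.mul_lt_top hC.lt_top (measure_lt_top _ _)⟩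
  · have hcyl : MeasurableSet (cylinder Δ B : Set (S → X)) := hB.cylinder Δ
    rw [← lintegral_indicator_one hcyl, ← hd _ (measurable_one.indicator hcyl)]
    refine (lintegral_mono (g := fun _ => (c⁻¹ * V)⁻¹ * c * Measure.pi (fun i : Δ => ρ i) B)
      fun η => ?_).trans (by simp)
    simp only [gibbsOp, Pi.mul_apply, Pi.inv_apply]
    rw [mul_assoc]
    refine mul_le_mul' (ENNReal.inv_le_inv.2 (hc ρ η).1) ?_
    rw [← lintegral_indicator_one hB, ← lintegral_const_mul _ (measurable_one.indicator hB)]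
    refine lintegral_mono fun ζ => ?_
    simp only [Pi.mul_apply]
    refine mul_le_mul' (hw _) (le_of_eq ?_)
    have h3 : Function.updateFinset η Δ ζ ∈ cylinder Δ B ↔ ζ ∈ B := by
      rw [mem_cylinder, Function.restrict_updateFinset]
    by_cases h : ζ ∈ B
    · rw [Set.indicator_of_mem h, Set.indicator_of_mem (h3.2 h)]
      rfl
    · rw [Set.indicator_of_notMem h, Set.indicator_of_notMem (fun h' => h (h3.1 h'))]

section limits

variable [TopologicalSpace X] [CompactSpace X] [TopologicalSpace.MetrizableSpace X] [BorelSpace X]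

/-- A base `B` is approximated from inside by a closed set up to `m`-measure `ε`. The domination
makes this error uniform along the filter, and the portmanteau bound for closed sets gives the upper
limit. Passing to the complement gives the lower limit. -/
lemma tendsto_measure_cylinder [Countable S] {I : Type*} {L : Filter I}
    {ν : I → ProbabilityMeasure (S → X)} {ν₀ : ProbabilityMeasure (S → X)}
    (hν : Filter.Tendsto ν L (𝓝 ν₀)) {Δ : Finset S} {m : Measure (Δ → X)} [IsFiniteMeasure m]
    (hm : ∀ᶠ i in L, ∀ B : Set (Δ → X), MeasurableSet B →
      (ν i : Measure (S → X)) (cylinder Δ B) ≤ m B)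
    {B : Set (Δ → X)} (hB : MeasurableSet B) :
    Filter.Tendsto (fun i => (ν i : Measure (S → X)) (cylinder Δ B)) L
      (𝓝 ((ν₀ : Measure (S → X)) (cylinder Δ B))) := by
  rcases L.eq_or_neBot with rfl | hL
  · exact Filter.tendsto_bot
  have key (B : Set (Δ → X)) (hB : MeasurableSet B) :
      Filter.limsup (fun i => (ν i : Measure (S → X)) (cylinder Δ B)) L ≤
        (ν₀ : Measure (S → X)) (cylinder Δ B) := by
    refine ENNReal.le_of_forall_pos_le_add fun ε hε _ => ?_
    obtain ⟨F, hFB, hF, hFε⟩ := hB.exists_isClosed_sdiff_lt (μ := m) (measure_ne_top _ _)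
      (ε := ε) (by simpa using hε.ne')
    have hFc : IsClosed (cylinder Δ F : Set (S → X)) := hF.cylinder Δ
    calc Filter.limsup (fun i => (ν i : Measure (S → X)) (cylinder Δ B)) L
        ≤ Filter.limsup (fun i => (ν i : Measure (S → X)) (cylinder Δ F) + ε) L := by
          refine Filter.limsup_le_limsup (hm.mono fun i hi => ?_)
          calc (ν i : Measure (S → X)) (cylinder Δ B)
              ≤ (ν i : Measure (S → X)) (cylinder Δ F ∪ cylinder Δ (B \ F)) := by
                refine measure_mono fun ω hω => ?_
                rw [Set.mem_union, mem_cylinder, mem_cylinder]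
                rw [mem_cylinder] at hω
                by_cases h : Δ.restrict ω ∈ F
                · exact Or.inl h
                · exact Or.inr ⟨hω, h⟩
            _ ≤ _ := measure_union_le _ _
            _ ≤ (ν i : Measure (S → X)) (cylinder Δ F) + ε :=
              add_le_add_right ((hi _ (hB.diff hF.measurableSet)).trans hFε.le) _
      _ = Filter.limsup (fun i => (ν i : Measure (S → X)) (cylinder Δ F)) L + ε :=
          limsup_add_const L _ _ (by isBoundedDefault) (by isBoundedDefault)
      _ ≤ (ν₀ : Measure (S → X)) (cylinder Δ F) + ε := by
          gcongr
          exact ProbabilityMeasure.limsup_measure_closed_le_of_tendsto hν hFc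
      _ ≤ _ := by
          gcongr
          exact fun ω hω => hFB hω
  refine tendsto_measure_of_le_liminf_measure_of_limsup_measure_le (μ := (ν₀ : Measure (S → X)))
    (μs := fun i => (ν i : Measure (S → X))) subset_rfl subset_rfl (by simp) ?_ (key B hB)
  refine le_measure_liminf_of_limsup_measure_compl_le (hB.cylinder Δ) ?_
  rw [compl_cylinder]
  exact key _ hB.compl

end limits

/-- Setwise convergence on cylinders gives lower semicontinuity of the integrals of
local functions. -/
lemma eventually_lt_lintegral_restrict {I : Type*} {L : Filter I}
    {ν : I → Measure (S → X)} {ν₀ : Measure (S → X)} {Δ : Finset S}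
    (h : ∀ B : Set (Δ → X), MeasurableSet B →
      Filter.Tendsto (fun i => ν i (cylinder Δ B)) L (𝓝 (ν₀ (cylinder Δ B))))
    {g : (Δ → X) → ℝ≥0∞} (hg : Measurable g)
    (hgt : ∀ y, g y ≠ ∞) {a : ℝ≥0∞}
    (ha : a < ∫⁻ ω, g (Δ.restrict ω) ∂ν₀) : ∀ᶠ i in L, a < ∫⁻ ω, g (Δ.restrict ω) ∂(ν i) := by
  have hr : Measurable (Δ.restrict : (S → X) → Δ → X) := Finset.measurable_restrict Δ
  rw [← lintegral_map hg hr, lintegral, lt_iSup_iff] at ha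
  obtain ⟨φ, hφ⟩ := ha
  rw [lt_iSup_iff] at hφ
  obtain ⟨hφg, hφ⟩ := hφ
  have hlim : Filter.Tendsto (fun i => φ.lintegral ((ν i).map Δ.restrict)) L
      (𝓝 (φ.lintegral (ν₀.map Δ.restrict))) := by
    simp only [SimpleFunc.lintegral]
    refine tendsto_finsetSum _ fun x hx0 => ?_
    have hms := φ.measurableSet_preimage {x}
    have hx : Filter.Tendsto (fun i => (ν i).map Δ.restrict (φ ⁻¹' {x})) L
        (𝓝 (ν₀.map Δ.restrict (φ ⁻¹' {x}))) := by
      simp only [Measure.map_apply hr hms]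
      exact h _ hms
    refine ENNReal.Tendsto.const_mul hx (Or.inr ?_)
    obtain ⟨y, rfl⟩ := SimpleFunc.mem_range.1 hx0
    exact ne_top_of_le_ne_top (hgt y) (hφg y)
  filter_upwards [hlim.eventually_const_lt hφ] with i hi
  rw [← lintegral_map hg hr]
  refine hi.trans_le ?_
  rw [← SimpleFunc.lintegral_eq_lintegral]
  exact lintegral_mono hφg

/-- A limit of measures that eventually satisfy the DLR equations is a Gibbs measure. -/
theorem exists_gibbs_of_ultrafilter [TopologicalSpace X] [CompactSpace X]
    [TopologicalSpace.MetrizableSpace X] [BorelSpace X] [Countable S] (hΦ : AbsSummable Φ)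
    [∀ i, IsFiniteMeasure (ρ i)] [∀ i, NeZero (ρ i)] {I : Type*} (U : Ultrafilter I)
    (ν : I → Measure (S → X)) [hν : ∀ i, IsProbabilityMeasure (ν i)]
    (hd : ∀ Λ, ∀ᶠ i in (U : Filter I), IsDLR Φ ρ Λ (ν i)) :
    ∃ ν₀ ∈ gibbsMeasures (gibbsSpec Φ ρ), ∀ B ∈ measurableCylinders fun _ : S => X,
      Filter.Tendsto (fun i => ν i B) U (𝓝 (ν₀ B)) := by
  let P (i : I) : ProbabilityMeasure (S → X) := ⟨ν i, hν i⟩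
  obtain ⟨ν₀, -, hlim⟩ := isCompact_univ.ultrafilter_le_nhds (U.map P) (by simp)
  have hlim' : Filter.Tendsto P U (𝓝 ν₀) := hlim
  have hset (Δ : Finset S) (B : Set (Δ → X)) (hB : MeasurableSet B) :
      Filter.Tendsto (fun i => ν i (cylinder Δ B)) U
        (𝓝 ((ν₀ : Measure (S → X)) (cylinder Δ B))) := by
    obtain ⟨m, _, hm⟩ := exists_dominating_measure hΦ (ρ := ρ) Δ
    exact tendsto_measure_cylinder hlim' ((hd Δ).mono fun i hi => hm _ (hν i) hi) hB
  refine ⟨ν₀, (mem_gibbsMeasures_iff hΦ _).2 ⟨inferInstance, fun Λ => ?_⟩, fun B hB => ?_⟩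
  swap
  · obtain ⟨Δ, B, hB', rfl⟩ := (mem_measurableCylinders _).1 hB
    exact hset Δ B hB'
  have hm := measurable_gibbsSpec hΦ (ρ := ρ) Λ
  have hpr (η : S → X) := isProbabilityMeasure_gibbsSpec hΦ (ρ := ρ) Λ η
  -- One inequality on cylinders suffices: between probability measures, applying it to the
  -- complement yields equality.
  have hle (Δ : Finset S) (B : Set (Δ → X)) (hB : MeasurableSet B) :
      (ν₀ : Measure (S → X)).bind (gibbsSpec Φ ρ Λ) (cylinder Δ B) ≤
        (ν₀ : Measure (S → X)) (cylinder Δ B) := by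
    have hcyl : MeasurableSet (cylinder Δ B : Set (S → X)) := hB.cylinder Δ
    set g := gibbsOp Φ ρ Λ ((cylinder Δ B).indicator 1) with hg
    have hgm : Measurable g := measurable_gibbsOp hΦ Λ (measurable_one.indicator hcyl)
    have h01 : (cylinder Δ B).indicator (1 : (S → X) → ℝ≥0∞) ≤ 1 :=
      Set.indicator_le_self _ _
    have hg1 : g ≤ 1 := gibbsOp_le_one hΦ Λ h01
    have hgq : IsQuasilocal g := isQuasilocal_gibbsOp hΦ Λ h01 (measurable_one.indicator hcyl)
      (isQuasilocal_indicator_cylinder Δ B)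
    rw [Measure.bind_apply hcyl hm.aemeasurable]
    simp only [gibbsSpec_apply hΦ ρ Λ _ hcyl]
    obtain ⟨a⟩ : Nonempty (S → X) := ProbabilityMeasure.nonempty ν₀
    refine ENNReal.le_of_forall_pos_le_add fun ε hε _ => ?_
    have hε2 : (ε : ℝ≥0∞) / 2 ≠ 0 := by simpa using hε.ne'
    obtain ⟨V, hV⟩ := hgq _ hε2
    -- Freezing the spins off `V` at `a` replaces the quasilocal `g` by a function of finitely many
    -- spins, up to `ε / 2`. Convergence on cylinders applies to that function.
    let gV (ζ : V → X) : ℝ≥0∞ := g (Function.updateFinset a V ζ)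
    have hagree (ω : S → X) : ∀ i ∈ V, ω i = Function.updateFinset a V (V.restrict ω) i :=
      fun i hi => by simp [Function.updateFinset, hi]
    have hgV1 (ω : S → X) : g ω ≤ gV (V.restrict ω) + ε / 2 := hV _ _ (hagree ω)
    have hgV2 (ω : S → X) : gV (V.restrict ω) ≤ g ω + ε / 2 :=
      hV _ _ fun i hi => (hagree ω i hi).symm
    have hint (ν : Measure (S → X)) (hν : IsProbabilityMeasure ν) (f : (S → X) → ℝ≥0∞) :
        ∫⁻ ω, (f ω + ε / 2) ∂ν = ∫⁻ ω, f ω ∂ν + ε / 2 := by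
      rw [lintegral_add_right _ measurable_const, lintegral_const, measure_univ, mul_one]
    have hgVm : Measurable gV := hgm.comp measurable_updateFinset
    have hlow : ∫⁻ ω, gV (V.restrict ω) ∂(ν₀ : Measure (S → X)) ≤
        (ν₀ : Measure (S → X)) (cylinder Δ B) + ε / 2 := by
      refine le_of_forall_lt_imp_le_of_dense fun b hb => ?_
      have h1 := eventually_lt_lintegral_restrict (hset V) hgVm
        (fun ζ => ne_top_of_le_ne_top ENNReal.one_ne_top (hg1 _)) hb
      have h2 : ∀ᶠ i in (U : Filter I), b ≤ ν i (cylinder Δ B) + ε / 2 := by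
        filter_upwards [h1, hd Λ] with i hi hdi
        calc b ≤ ∫⁻ ω, gV (V.restrict ω) ∂(ν i) := hi.le
          _ ≤ ∫⁻ ω, (g ω + ε / 2) ∂(ν i) := lintegral_mono hgV2
          _ = ∫⁻ ω, g ω ∂(ν i) + ε / 2 := hint _ (hν i) _
          _ = _ := by rw [hdi _ (measurable_one.indicator hcyl), lintegral_indicator_one hcyl]
      exact ge_of_tendsto ((hset Δ B hB).add_const _) h2
    calc ∫⁻ ω, g ω ∂(ν₀ : Measure (S → X))
        ≤ ∫⁻ ω, (gV (V.restrict ω) + ε / 2) ∂(ν₀ : Measure (S → X)) := lintegral_mono hgV1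
      _ = _ := hint _ inferInstance _
      _ ≤ (ν₀ : Measure (S → X)) (cylinder Δ B) + ε / 2 + ε / 2 := by gcongr
      _ = _ := by rw [add_assoc, ENNReal.add_halves]
  have hbp : IsProbabilityMeasure ((ν₀ : Measure (S → X)).bind (gibbsSpec Φ ρ Λ)) :=
    ⟨by
      rw [Measure.bind_apply MeasurableSet.univ hm.aemeasurable]
      simp⟩
  have heq : (ν₀ : Measure (S → X)).bind (gibbsSpec Φ ρ Λ) = ν₀ := by
    refine ext_of_generate_finite _ (generateFrom_measurableCylinders (α := fun _ : S => X)).symm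
      (isPiSystem_measurableCylinders) (fun B hB => ?_) (by simp)
    obtain ⟨Δ, B, hB', rfl⟩ := (mem_measurableCylinders _).1 hB
    refine le_antisymm (hle Δ B hB') ?_
    have hcyl : MeasurableSet (cylinder Δ B : Set (S → X)) := hB'.cylinder Δ
    have h1 := hle Δ Bᶜ hB'.compl
    rw [← compl_cylinder, prob_compl_eq_one_sub hcyl, prob_compl_eq_one_sub hcyl] at h1
    exact (ENNReal.sub_le_sub_iff_left prob_le_one ENNReal.one_ne_top).1 h1
  rw [isDLR_iff hΦ]
  intro B hB
  rw [← Measure.bind_apply hB hm.aemeasurable, heq]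

theorem gibbsMeasures_nonempty [TopologicalSpace X] [CompactSpace X] [Nonempty X]
    [TopologicalSpace.MetrizableSpace X] [BorelSpace X] [Countable S] (hΦ : AbsSummable Φ)
    [∀ i, IsFiniteMeasure (ρ i)] [∀ i, NeZero (ρ i)] :
    (gibbsMeasures (gibbsSpec Φ ρ)).Nonempty := by
  let η : S → X := fun _ => Classical.arbitrary X
  have hpr (Λ : Finset S) := isProbabilityMeasure_gibbsSpec hΦ (ρ := ρ) Λ η
  obtain ⟨ν, hν, -⟩ := exists_gibbs_of_ultrafilter hΦ (ρ := ρ) (Ultrafilter.of Filter.atTop)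
    (fun Λ => gibbsSpec Φ ρ Λ η) fun Λ => Ultrafilter.of_le _ <|
      (Filter.eventually_ge_atTop Λ).mono fun Δ hΔ => isDLR_gibbsSpec hΦ hΔ η
  exact ⟨ν, hν⟩

/-- If there is only one Gibbs measure, then it is the infinite volume limit. -/
theorem tendsto_gibbsSpec_of_unique [TopologicalSpace X] [CompactSpace X]
    [TopologicalSpace.MetrizableSpace X] [BorelSpace X] [Countable S] (hΦ : AbsSummable Φ)
    [∀ i, IsFiniteMeasure (ρ i)] [∀ i, NeZero (ρ i)] {ν : Measure (S → X)}
    (hν : ∀ ν' ∈ gibbsMeasures (gibbsSpec Φ ρ), ν' = ν) (η : S → X) {B : Set (S → X)}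
    (hB : B ∈ measurableCylinders fun _ : S => X) :
    Filter.Tendsto (fun Λ => gibbsSpec Φ ρ Λ η B) Filter.atTop (𝓝 (ν B)) := by
  have hpr (Λ : Finset S) := isProbabilityMeasure_gibbsSpec hΦ (ρ := ρ) Λ η
  -- Along every ultrafilter finer than `atTop` the kernels converge on cylinders to some Gibbs
  -- measure, which must be `ν`.
  rw [Filter.tendsto_iff_ultrafilter]
  intro U hU
  obtain ⟨ν', hν', h⟩ := exists_gibbs_of_ultrafilter hΦ (ρ := ρ) U
    (fun Λ => gibbsSpec Φ ρ Λ η) fun Λ => hU <|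
      (Filter.eventually_ge_atTop Λ).mono fun Δ hΔ => isDLR_gibbsSpec hΦ hΔ η
  rw [← hν ν' hν']
  exact h B hB

end SampleRotateProject
end

/-! ### Dobrushin's uniqueness theorem. -/

open MeasureTheory

noncomputable section

namespace SampleRotateProject

set_option linter.unusedSectionVars false

/-- The integrals of a function of oscillation `D` differ by at most `D` times the total variation
distance. -/
lemma lintegral_le_add_of_forall_measure_le_add {X : Type*} [MeasurableSpace X] {α β : Measure X}
    [IsProbabilityMeasure α] [IsProbabilityMeasure β] {A : Set X}
    (hα : ∀ᵐ x ∂α, x ∈ A) (hβ : ∀ᵐ x ∂β, x ∈ A) {c : ℝ≥0∞}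
    (hc : ∀ B, MeasurableSet B → α B ≤ β B + c) {g : X → ℝ≥0∞} (hg : Measurable g) (hg1 : g ≤ 1)
    {D : ℝ≥0∞} (hDt : D ≠ ∞) (hD : ∀ x ∈ A, ∀ y ∈ A, g x ≤ g y + D) :
    ∫⁻ x, g x ∂α ≤ ∫⁻ x, g x ∂β + c * D := by
  -- Both measures live on `A`, so subtracting the infimum over `A` changes both integrals by `m`
  -- and leaves a function with values in `[0, D]` on `A`.
  set m := ⨅ x ∈ A, g x with hm
  have hmA (x : X) (hx : x ∈ A) : m + (g x - m) = g x :=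
    add_tsub_cancel_of_le (iInf₂_le x hx)
  have hD' (x : X) (hx : x ∈ A) : g x - m ≤ D := by
    rw [tsub_le_iff_left, hm, ENNReal.iInf_add]
    refine le_iInf fun y => ?_
    rw [ENNReal.iInf_add]
    exact le_iInf fun hy => hD x hx y hy
  have hgt (x : X) : g x - m ≠ ∞ :=
    ne_top_of_le_ne_top ENNReal.one_ne_top (tsub_le_self.trans (hg1 x))
  have hgm : Measurable fun x => g x - m := hg.sub_const m
  set h : X → ℝ := fun x => (g x - m).toReal with hh
  have hhm : Measurable h := hgm.ennreal_toReal
  have hhD (x : X) (hx : x ∈ A) : h x ≤ D.toReal := ENNReal.toReal_mono hDt (hD' x hx)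
  have hint (ν : Measure X) [IsProbabilityMeasure ν] (hν : ∀ᵐ x ∂ν, x ∈ A) :
      ∫⁻ x, g x ∂ν = m + ∫⁻ x, ENNReal.ofReal (h x) ∂ν := by
    have h1 : ∫⁻ x, g x ∂ν = ∫⁻ x, (m + ENNReal.ofReal (h x)) ∂ν := by
      refine lintegral_congr_ae (hν.mono fun x hx => ?_)
      simp only [hh, ENNReal.ofReal_toReal (hgt x), hmA x hx]
    rw [h1, lintegral_add_left measurable_const, lintegral_const, measure_univ, mul_one]
  rw [hint α hα, hint β hβ, add_assoc]
  refine add_le_add_right ?_ _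
  have hh0 (x : X) : 0 ≤ h x := ENNReal.toReal_nonneg
  rw [lintegral_eq_lintegral_meas_lt α (ae_of_all _ hh0) hhm.aemeasurable,
    lintegral_eq_lintegral_meas_lt β (ae_of_all _ hh0) hhm.aemeasurable]
  -- In the layer-cake formula each level `t < D` costs at most `c`, and the levels above have
  -- `α`-measure zero.
  have hcD : c * D = ∫⁻ t in Set.Ioi (0 : ℝ), (Set.Iio D.toReal).indicator (fun _ => c) t := by
    rw [lintegral_indicator measurableSet_Iio, lintegral_const,
      Measure.restrict_restrict measurableSet_Iio, Measure.restrict_apply_univ,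
      Set.inter_comm, Set.Ioi_inter_Iio, Real.volume_Ioo, sub_zero, ENNReal.ofReal_toReal hDt]
  rw [hcD, ← lintegral_add_right _ (measurable_const.indicator measurableSet_Iio)]
  refine lintegral_mono fun t => ?_
  by_cases ht : t < D.toReal
  · simp only [Set.indicator_of_mem (show t ∈ Set.Iio D.toReal from ht)]
    exact hc _ (measurableSet_lt measurable_const hhm)
  · have : α {a | t < h a} = 0 := by
      have h1 : ∀ᵐ x ∂α, ¬ t < h x :=
        hα.mono fun x hxA hx => ht (lt_of_lt_of_le hx (hhD x hxA))
      rw [ae_iff] at h1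
      simpa only [not_not] using h1
    simp [this]

variable {S X : Type*} [DecidableEq S] [MeasurableSpace X]
  {Φ : Finset S → (S → X) → ℝ} {ρ : S → Measure X}

/-- The oscillation of `f` at the site `j` on the configuration set `K`. -/
def oscAt (K : Set (S → X)) (f : (S → X) → ℝ≥0∞) (j : S) : ℝ≥0∞ :=
  ⨆ (ω : S → X) (ω' : S → X) (_ : ω ∈ K) (_ : ω' ∈ K) (_ : ∀ k, k ≠ j → ω k = ω' k), f ω - f ω'

lemma le_add_oscAt {K : Set (S → X)} (f : (S → X) → ℝ≥0∞) {j : S} {ω ω' : S → X} (hω : ω ∈ K)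
    (hω' : ω' ∈ K) (h : ∀ k, k ≠ j → ω k = ω' k) : f ω ≤ f ω' + oscAt K f j := by
  rw [← tsub_le_iff_left]
  exact le_iSup_of_le ω <| le_iSup_of_le ω' <| le_iSup_of_le hω <| le_iSup_of_le hω' <|
    le_iSup_of_le h le_rfl

lemma oscAt_le {K : Set (S → X)} {f : (S → X) → ℝ≥0∞} {j : S} {c : ℝ≥0∞}
    (h : ∀ ω ∈ K, ∀ ω' ∈ K, (∀ k, k ≠ j → ω k = ω' k) → f ω ≤ f ω' + c) : oscAt K f j ≤ c :=
  iSup_le fun ω => iSup_le fun ω' => iSup_le fun hω => iSup_le fun hω' => iSup_le fun hj =>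
    tsub_le_iff_left.2 (h ω hω ω' hω' hj)

lemma oscAt_le_one {K : Set (S → X)} {f : (S → X) → ℝ≥0∞} (hf : f ≤ 1) (j : S) :
    oscAt K f j ≤ 1 :=
  oscAt_le fun ω _ _ _ _ => (hf ω).trans le_add_self

/-- The configurations whose spins lie in the sets `A i`. -/
def boxConfig (A : S → Set X) : Set (S → X) := {ω | ∀ i, ω i ∈ A i}

/-- Telescoping: spins are changed one site at a time. The product form of `boxConfig` keeps the
intermediate configurations admissible, and quasilocality absorbs the sites that are never changed.
-/
lemma le_add_tsum_oscAt (A : S → Set X) {f : (S → X) → ℝ≥0∞} (hf : IsQuasilocal f) {ω ω' : S → X}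
    (hω : ω ∈ boxConfig A) (hω' : ω' ∈ boxConfig A) :
    f ω ≤ f ω' + ∑' j, oscAt (boxConfig A) f j := by
  have key (Δ : Finset S) : f ω ≤ f (fun i => if i ∈ Δ then ω' i else ω i) +
      ∑ j ∈ Δ, oscAt (boxConfig A) f j := by
    induction Δ using Finset.induction_on with
    | empty => simp
    | insert i Δ hi ih =>
      refine ih.trans ?_
      rw [Finset.sum_insert hi, ← add_assoc]
      refine add_le_add_left (le_add_oscAt f ?_ ?_ fun k hk => by simp [hk]) _
      · intro k
        dsimp only
        split_ifs
        exacts [hω' k, hω k]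
      · intro k
        dsimp only
        split_ifs
        exacts [hω' k, hω k]
  refine ENNReal.le_of_forall_pos_le_add fun ε hε _ => ?_
  obtain ⟨Δ, hΔ⟩ := hf ε (by simpa using hε.ne')
  calc f ω ≤ _ := key Δ
    _ ≤ (f ω' + ε) + ∑' j, oscAt (boxConfig A) f j :=
      add_le_add (hΔ _ _ fun i hi => by simp [hi]) (ENNReal.sum_le_tsum Δ)
    _ = _ := by ring

variable [Countable S] (hΦ : AbsSummable Φ) [∀ i, IsFiniteMeasure (ρ i)]
include hΦ

lemma IsDLR.ae_mem {i : S} {μ : Measure (S → X)} (h : IsDLR Φ ρ {i} μ) {A : Set X}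
    (hA : MeasurableSet A) (hρ : ∀ᵐ x ∂(ρ i), x ∈ A) : ∀ᵐ ω ∂μ, ω i ∈ A := by
  have hB : MeasurableSet {ω : S → X | ω i ∉ A}  :=
    (measurable_pi_apply i : Measurable fun ω : S → X => ω i) hA.compl
  change μ {ω | ω i ∉ A} = 0
  rw [← lintegral_indicator_one hB, ← h _ (measurable_one.indicator hB)]
  have : gibbsOp Φ ρ {i} ({ω : S → X | ω i ∉ A}.indicator 1) = fun _ => 0 := by
    funext η
    rw [gibbsOp, lmarginal_singleton, Pi.mul_apply]
    rw [lintegral_congr_ae (g := fun _ => 0), lintegral_zero, mul_zero]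
    filter_upwards [hρ] with x hx
    simp [hx]
  rw [this, lintegral_zero]

variable [∀ i, NeZero (ρ i)]

lemma IsDLR.ae_mem_boxConfig {A : S → Set X} (hA : ∀ i, MeasurableSet (A i))
    (hρ : ∀ i, ∀ᵐ x ∂(ρ i), x ∈ A i) {μ : Measure (S → X)} (h : ∀ Λ, IsDLR Φ ρ Λ μ) :
    ∀ᵐ ω ∂μ, ω ∈ boxConfig A :=
  ae_all_iff.2 fun i => (h {i}).ae_mem hΦ (hA i) (hρ i)

/-- The law of the spin at `i` under the specification. -/
lemma gibbsOp_singleton_eq (i : S) {f : (S → X) → ℝ≥0∞} (hf : Measurable f) (ω : S → X) :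
    gibbsOp Φ ρ {i} f ω =
      ∫⁻ x, f (Function.update ω i x) ∂((gibbsSpec Φ ρ {i} ω).map fun σ => σ i) := by
  rw [lintegral_map (f := fun x => f (Function.update ω i x)) (hf.comp (measurable_update ω))
      (measurable_pi_apply i),
    lintegral_gibbsSpec hΦ ρ {i} ω (f := fun σ => f (Function.update ω i (σ i)))
      (hf.comp ((measurable_update ω).comp (measurable_pi_apply i)))]
  simp only [gibbsOp, lmarginal_singleton, Pi.mul_apply, Function.update_self]

lemma oscAt_gibbsOp_self (K : Set (S → X)) (i : S) (f : (S → X) → ℝ≥0∞) :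
    oscAt K (gibbsOp Φ ρ {i} f) i = 0 := by
  refine le_antisymm (oscAt_le fun ω _ ω' _ h => ?_) zero_le
  rw [dependsOn_gibbsOp {i} f (x := ω) (y := ω') fun k hk => h k (by simpa using hk)]
  simp

/-- A change at `j` acts in two ways. It changes the integrand, by at most the oscillation of `f` at
`j`. It also changes the law of the spin at `i`, by at most `C_ij` in total variation, and as a
function of that spin the integrand oscillates by at most the oscillation of `f` at `i`. -/
lemma oscAt_gibbsOp_le {A : S → Set X} (hA : ∀ i, MeasurableSet (A i))
    (hρ : ∀ i, ∀ᵐ x ∂(ρ i), x ∈ A i) {i j : S} (hij : j ≠ i) {f : (S → X) → ℝ≥0∞}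
    (hf : Measurable f) (hf1 : f ≤ 1) :
    oscAt (boxConfig A) (gibbsOp Φ ρ {i} f) j ≤ oscAt (boxConfig A) f j +
      dobrushinCoeff (gibbsSpec Φ ρ) (boxConfig A) i j * oscAt (boxConfig A) f i := by
  have hup (ω : S → X) (hω : ω ∈ boxConfig A) (x : X) (hx : x ∈ A i) :
      Function.update ω i x ∈ boxConfig A := by
    intro k
    rcases eq_or_ne k i with rfl | hk
    · simpa using hx
    · simpa [hk] using hω k
  refine oscAt_le fun ω hω ω' hω' h => ?_
  have hp (ω : S → X) := isProbabilityMeasure_gibbsSpec hΦ (ρ := ρ) {i} ω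
  have hm : Measurable fun σ : S → X => σ i := measurable_pi_apply i
  have hpm (ω : S → X) : IsProbabilityMeasure ((gibbsSpec Φ ρ {i} ω).map fun σ => σ i) :=
    Measure.isProbabilityMeasure_map hm.aemeasurable
  have hs (ω : S → X) : ∀ᵐ x ∂((gibbsSpec Φ ρ {i} ω).map fun σ => σ i), x ∈ A i := by
    refine (ae_map_iff hm.aemeasurable (hA i)).2 ?_
    exact (isDLR_gibbsSpec hΦ subset_rfl ω).ae_mem hΦ (hA i) (hρ i)
  rw [gibbsOp_singleton_eq hΦ i hf, gibbsOp_singleton_eq hΦ i hf]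
  have hosc : oscAt (boxConfig A) f j ≠ ∞ :=
    ne_top_of_le_ne_top ENNReal.one_ne_top (oscAt_le_one hf1 j)
  calc ∫⁻ x, f (Function.update ω i x) ∂((gibbsSpec Φ ρ {i} ω).map fun σ => σ i)
      ≤ ∫⁻ x, (f (Function.update ω' i x) + oscAt (boxConfig A) f j)
          ∂((gibbsSpec Φ ρ {i} ω).map fun σ => σ i) := by
        refine lintegral_mono_ae ((hs ω).mono fun x hx => ?_)
        refine le_add_oscAt f (hup ω hω x hx) (hup ω' hω' x hx) fun k hk => ?_
        rcases eq_or_ne k i with rfl | hki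
        · simp
        · simpa [hki] using h k hk
    _ = ∫⁻ x, f (Function.update ω' i x) ∂((gibbsSpec Φ ρ {i} ω).map fun σ => σ i) +
          oscAt (boxConfig A) f j := by
        rw [lintegral_add_right _ measurable_const, lintegral_const, measure_univ, mul_one]
    _ ≤ ∫⁻ x, f (Function.update ω' i x) ∂((gibbsSpec Φ ρ {i} ω').map fun σ => σ i) +
          dobrushinCoeff (gibbsSpec Φ ρ) (boxConfig A) i j * oscAt (boxConfig A) f i +
          oscAt (boxConfig A) f j := by
        refine add_le_add_left ?_ _
        refine lintegral_le_add_of_forall_measure_le_add (hs ω) (hs ω') (fun B hB => ?_)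
          (hf.comp (measurable_update ω')) (fun x => hf1 _)
          (ne_top_of_le_ne_top ENNReal.one_ne_top (oscAt_le_one hf1 i)) fun x hx y hy => ?_
        · rw [Measure.map_apply hm hB, Measure.map_apply hm hB]
          have hC : ENNReal.ofReal |(gibbsSpec Φ ρ {i} ω).real {σ | σ i ∈ B} -
              (gibbsSpec Φ ρ {i} ω').real {σ | σ i ∈ B}| ≤
              dobrushinCoeff (gibbsSpec Φ ρ) (boxConfig A) i j :=
            le_iSup_of_le ω <| le_iSup_of_le ω' <| le_iSup_of_le hω <| le_iSup_of_le hω' <|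
              le_iSup_of_le h <| le_iSup_of_le B <| le_iSup_of_le hB le_rfl
          refine le_trans ?_ (add_le_add_right hC _)
          change gibbsSpec Φ ρ {i} ω {σ | σ i ∈ B} ≤ gibbsSpec Φ ρ {i} ω' {σ | σ i ∈ B} + _
          rw [← ofReal_measureReal (μ := gibbsSpec Φ ρ {i} ω),
            ← ofReal_measureReal (μ := gibbsSpec Φ ρ {i} ω'),
            ← ENNReal.ofReal_add measureReal_nonneg (abs_nonneg _)]
          refine ENNReal.ofReal_le_ofReal ?_
          linarith [le_abs_self ((gibbsSpec Φ ρ {i} ω).real {σ | σ i ∈ B} -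
              (gibbsSpec Φ ρ {i} ω').real {σ | σ i ∈ B})]
        · exact le_add_oscAt f (hup ω' hω' x hx) (hup ω' hω' y hy) fun k hk => by simp [hk]
    _ = _ := by ring

/-- The vector `a` estimates the difference of `μ` and `ν` on the configuration set `K`. -/
def IsEstimate (K : Set (S → X)) (μ ν : Measure (S → X)) (a : S → ℝ≥0∞) : Prop :=
  ∀ f : (S → X) → ℝ≥0∞, Measurable f → f ≤ 1 → IsQuasilocal f →
    ∫⁻ ω, f ω ∂μ ≤ ∫⁻ ω, f ω ∂ν + ∑' j, a j * oscAt K f j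

omit [DecidableEq S] [Countable S] hΦ [∀ i, IsFiniteMeasure (ρ i)] [∀ i, NeZero (ρ i)] in
lemma IsEstimate.mono {K : Set (S → X)} {μ ν : Measure (S → X)} {a b : S → ℝ≥0∞}
    (h : IsEstimate K μ ν a) (hab : a ≤ b) : IsEstimate K μ ν b := by
  intro f hf hf1 hfq
  refine (h f hf hf1 hfq).trans (add_le_add_right (ENNReal.tsum_le_tsum fun j => ?_) _)
  exact mul_le_mul_left (hab j) _

/-- Both measures are invariant under resampling at `i`, so the estimate may be applied to `γ_{i} f`
instead of `f`. This function does not depend on the spin at `i`, and by `oscAt_gibbsOp_le` the term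
`j ≠ i` passes `C_ij a_j` on to the oscillation of `f` at `i`. -/
lemma IsEstimate.update {A : S → Set X} (hA : ∀ i, MeasurableSet (A i))
    (hρ : ∀ i, ∀ᵐ x ∂(ρ i), x ∈ A i) {μ ν : Measure (S → X)} {a : S → ℝ≥0∞} {i : S}
    (hμ : IsDLR Φ ρ {i} μ) (hν : IsDLR Φ ρ {i} ν) (h : IsEstimate (boxConfig A) μ ν a) :
    IsEstimate (boxConfig A) μ ν (Function.update a i
      (∑' j, dobrushinCoeff (gibbsSpec Φ ρ) (boxConfig A) i j * a j)) := by
  intro f hf hf1 hfq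
  have h1 := h _ (measurable_gibbsOp hΦ (ρ := ρ) {i} hf) (gibbsOp_le_one hΦ {i} hf1)
    (isQuasilocal_gibbsOp hΦ {i} hf1 hf hfq)
  rw [hμ f hf, hν f hf] at h1
  refine h1.trans (add_le_add_right ?_ _)
  set K := boxConfig A
  set C := dobrushinCoeff (gibbsSpec Φ ρ) K
  calc ∑' j, a j * oscAt K (gibbsOp Φ ρ {i} f) j
      ≤ ∑' j, ((if j = i then 0 else Function.update a i (∑' j, C i j * a j) j * oscAt K f j) +
          C i j * a j * oscAt K f i) := by
        refine ENNReal.tsum_le_tsum fun j => ?_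
        rcases eq_or_ne j i with rfl | hj
        · rw [oscAt_gibbsOp_self hΦ, mul_zero]
          exact zero_le
        · rw [if_neg hj, Function.update_of_ne hj]
          calc _ ≤ a j * (oscAt K f j + C i j * oscAt K f i) :=
                mul_le_mul_right (oscAt_gibbsOp_le hΦ hA hρ hj hf hf1) _
            _ = _ := by ring
    _ = _ := by
        rw [ENNReal.tsum_add, ENNReal.tsum_mul_right, add_comm, ENNReal.tsum_eq_add_tsum_ite
          (f := fun j => Function.update a i (∑' j, C i j * a j) j * oscAt K f j) i,
          Function.update_self]
        refine congrArg (_ + ·) (tsum_congr fun j => ?_)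
        by_cases hj : j = i <;> simp [hj]

/-- **Dobrushin's uniqueness theorem.** -/
theorem gibbsMeasures_unique_of_dobrushin {A : S → Set X} (hA : ∀ i, MeasurableSet (A i))
    (hρ : ∀ i, ∀ᵐ x ∂(ρ i), x ∈ A i)
    (hD : DobrushinCondition (gibbsSpec Φ ρ) (boxConfig A)) {μ ν : Measure (S → X)}
    (hμ : μ ∈ gibbsMeasures (gibbsSpec Φ ρ)) (hν : ν ∈ gibbsMeasures (gibbsSpec Φ ρ)) :
    μ = ν := by
  rw [mem_gibbsMeasures_iff hΦ] at hμ hν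
  obtain ⟨c, hc0, hc1⟩ := exists_between (show ⨆ i, ∑' j, dobrushinCoeff (gibbsSpec Φ ρ)
    (boxConfig A) i j < 1 from hD)
  have hc0' : c ≠ 0 := (zero_le.trans_lt hc0).ne'
  set K := boxConfig A
  set C := dobrushinCoeff (gibbsSpec Φ ρ) K
  have hC (i : S) : ∑' j, C i j ≤ c := (le_iSup (fun i => ∑' j, C i j) i).trans hc0.le
  have key (μ ν : Measure (S → X)) (hμp : IsProbabilityMeasure μ) (hνp : IsProbabilityMeasure ν)
      (hμ : ∀ Λ, IsDLR Φ ρ Λ μ) (hν : ∀ Λ, IsDLR Φ ρ Λ ν) (n : ℕ) :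
      IsEstimate K μ ν fun _ => c ^ n := by
    induction n with
    | zero =>
      intro f hf hf1 hfq
      simp only [pow_zero, one_mul]
      have h1 : ∀ᵐ ω ∂μ, f ω ≤ ∫⁻ ω, f ω ∂ν + ∑' j, oscAt K f j := by
        filter_upwards [IsDLR.ae_mem_boxConfig hΦ hA hρ hμ] with ω hω
        have h2 : ∫⁻ _, f ω ∂ν ≤ ∫⁻ ω', (f ω' + ∑' j, oscAt K f j) ∂ν :=
          lintegral_mono_ae ((IsDLR.ae_mem_boxConfig hΦ hA hρ hν).mono fun ω' hω' =>
            le_add_tsum_oscAt A hfq hω hω')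
        rw [lintegral_add_right _ measurable_const] at h2
        simpa using h2
      simpa using lintegral_mono_ae h1
    | succ n ih =>
      -- Updating the sites of a finite `Δ` one after another improves `c ^ n` to `c ^ (n + 1)` on
      -- `Δ`. Sites already updated do no harm, since their entries only got smaller.
      have hΔ (Δ : Finset S) :
          IsEstimate K μ ν fun j => if j ∈ Δ then c ^ (n + 1) else c ^ n := by
        induction Δ using Finset.induction_on with
        | empty => simpa using ih
        | insert i Δ hi ihΔ =>
          refine (ihΔ.update hΦ hA hρ (hμ {i}) (hν {i})).mono fun j => ?_
          rcases eq_or_ne j i with rfl | hj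
          · rw [Function.update_self, if_pos (Finset.mem_insert_self _ _)]
            calc ∑' k, C j k * (if k ∈ Δ then c ^ (n + 1) else c ^ n)
                ≤ ∑' k, C j k * c ^ n := by
                  refine ENNReal.tsum_le_tsum fun k => mul_le_mul_right ?_ _
                  split_ifs
                  · exact pow_le_pow_right_of_le_one' hc1.le n.le_succ
                  · exact le_rfl
              _ ≤ _ := by
                  rw [ENNReal.tsum_mul_right, pow_succ, mul_comm]
                  exact mul_le_mul_right (hC j) _
          · rw [Function.update_of_ne hj]
            simp [hj]
      intro f hf hf1 hfq
      by_cases hs : ∑' j, oscAt K f j = ∞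
      · rw [ENNReal.tsum_mul_left, hs, ENNReal.mul_top (pow_ne_zero _ hc0')]
        simp
      -- As `Δ` grows, the sites not yet updated contribute only the tail of a convergent sum of
      -- oscillations.
      refine ge_of_tendsto (x := (Filter.atTop : Filter (Finset S)))
        (f := fun Δ => ∫⁻ ω, f ω ∂ν + (∑' j, c ^ (n + 1) * oscAt K f j +
          ∑' j : {j // j ∉ Δ}, oscAt K f j)) ?_ (Filter.Eventually.of_forall fun Δ => ?_)
      · have ht := (ENNReal.tendsto_tsum_compl_atTop_zero hs).const_add
          (∑' j, c ^ (n + 1) * oscAt K f j)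
        rw [add_zero] at ht
        exact ht.const_add _
      · refine (hΔ Δ f hf hf1 hfq).trans (add_le_add_right ?_ _)
        have hsub : ∑' j : {j // j ∉ Δ}, oscAt K f j = _ :=
          tsum_subtype {j | j ∉ Δ} fun j => oscAt K f j
        rw [hsub, ← ENNReal.tsum_add]
        refine ENNReal.tsum_le_tsum fun j => ?_
        dsimp only
        by_cases hj : j ∈ Δ
        · rw [if_pos hj]
          exact le_self_add
        · rw [if_neg hj, Set.indicator_of_mem (show j ∈ {j | j ∉ Δ} from hj)]
          refine le_trans ?_ le_add_self
          calc c ^ n * oscAt K f j ≤ 1 * oscAt K f j := mul_le_mul_left (pow_le_one' hc1.le n) _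
            _ = _ := one_mul _
  have hle (μ ν : Measure (S → X)) (hμp : IsProbabilityMeasure μ) (hνp : IsProbabilityMeasure ν)
      (hμ : ∀ Λ, IsDLR Φ ρ Λ μ) (hν : ∀ Λ, IsDLR Φ ρ Λ ν) (Δ : Finset S) (B : Set (Δ → X))
      (hB : MeasurableSet B) : μ (cylinder Δ B) ≤ ν (cylinder Δ B) := by
    have hcyl : MeasurableSet (cylinder Δ B : Set (S → X)) := hB.cylinder Δ
    set f : (S → X) → ℝ≥0∞ := (cylinder Δ B).indicator 1 with hf
    have hf1 : f ≤ 1 := Set.indicator_le_self _ _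
    -- A cylinder indicator oscillates only at the finitely many sites of `Δ`, so the estimate `c ^
    -- n` times the total oscillation tends to zero.
    have hosc : ∑' j, oscAt K f j ≠ ∞ := by
      rw [tsum_eq_sum (s := Δ) fun j hj => ?_]
      · exact ENNReal.sum_ne_top.2 fun j _ =>
          ne_top_of_le_ne_top ENNReal.one_ne_top (oscAt_le_one hf1 j)
      · refine le_antisymm (oscAt_le fun ω _ ω' _ h => ?_) zero_le
        have h1 : Δ.restrict ω = Δ.restrict ω' :=
          funext fun i => h i fun hi => hj (hi ▸ i.2)
        have h2 : ω ∈ cylinder Δ B ↔ ω' ∈ cylinder Δ B := by rw [mem_cylinder, mem_cylinder, h1]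
        rw [add_zero, hf]
        by_cases hω : ω ∈ cylinder Δ B
        · rw [Set.indicator_of_mem hω, Set.indicator_of_mem (h2.1 hω)]
          exact le_rfl
        · rw [Set.indicator_of_notMem hω]
          exact zero_le
    have hlim : Filter.Tendsto (fun n : ℕ => ν (cylinder Δ B) + c ^ n * ∑' j, oscAt K f j)
        Filter.atTop (𝓝 (ν (cylinder Δ B) + 0 * ∑' j, oscAt K f j)) :=
      (ENNReal.Tendsto.mul_const (ENNReal.tendsto_pow_atTop_nhds_zero_of_lt_one hc1)
        (Or.inr hosc)).const_add _
    rw [zero_mul, add_zero] at hlim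
    refine ge_of_tendsto' hlim fun n => ?_
    have := key μ ν hμp hνp hμ hν n f (measurable_one.indicator hcyl) hf1
      (isQuasilocal_indicator_cylinder Δ B)
    rwa [ENNReal.tsum_mul_left, hf, lintegral_indicator_one hcyl,
      lintegral_indicator_one hcyl] at this
  have := hμ.1
  have := hν.1
  refine ext_of_generate_finite _ (generateFrom_measurableCylinders (α := fun _ : S => X)).symm
    isPiSystem_measurableCylinders (fun B hB => ?_) (by simp)
  obtain ⟨Δ, B, hB', rfl⟩ := (mem_measurableCylinders _).1 hB
  exact le_antisymm (hle μ ν hμ.1 hν.1 hμ.2 hν.2 Δ B hB') (hle ν μ hν.1 hμ.1 hν.2 hμ.2 Δ B hB')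

end SampleRotateProject
end

/-! ### Disintegration of Gibbs measures along finite-valued labels. -/

open MeasureTheory

noncomputable section

namespace SampleRotateProject

set_option linter.unusedSectionVars false

section labels

variable {S X : Type*} [DecidableEq S] [MeasurableSpace X]
  {Φ : Finset S → (S → X) → ℝ} {ρ : S → Measure X} [∀ i, IsFiniteMeasure (ρ i)]

lemma lmarginal_restrict (Δ : Finset S) {A : S → Set X} (hA : ∀ i, MeasurableSet (A i))
    (g : (S → X) → ℝ≥0∞) :
    ∫⋯∫⁻_Δ, g ∂(fun i => (ρ i).restrict (A i)) =
      ∫⋯∫⁻_Δ, {ω | ∀ i ∈ Δ, ω i ∈ A i}.indicator g ∂ρ := by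
  funext η
  rw [lmarginal, lmarginal, ← Measure.restrict_pi_pi,
    ← lintegral_indicator (MeasurableSet.univ_pi fun i : Δ => hA i)]
  refine lintegral_congr fun ζ => ?_
  have h : Function.updateFinset η Δ ζ ∈ {ω : S → X | ∀ i ∈ Δ, ω i ∈ A i} ↔
      ζ ∈ Set.univ.pi fun i : Δ => A i := by
    simp only [Set.mem_pi, Set.mem_univ, true_imp_iff, Subtype.forall]
    refine forall_congr' fun i => forall_congr' fun hi => ?_
    simp [Function.updateFinset, hi]
  by_cases hζ : ζ ∈ Set.univ.pi fun i : Δ => A i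
  · rw [Set.indicator_of_mem hζ, Set.indicator_of_mem (h.2 hζ)]
  · rw [Set.indicator_of_notMem hζ, Set.indicator_of_notMem fun h' => hζ (h.1 h')]

variable [Countable S] (hΦ : AbsSummable Φ) {L : Type*} [Finite L] [MeasurableSpace L]
  [MeasurableSingletonClass L] {t : S → X → L} (ht : ∀ i, Measurable (t i))
include hΦ ht

/-- The a priori measures conditioned on the labels of the configuration `η`. -/
def labelMeasure (ρ : S → Measure X) (t : S → X → L) (η : S → X) (i : S) : Measure X :=
  (ρ i).restrict {x | t i x = t i (η i)}

/-- Tower property in finite volume: the kernel restricted to the labels of `η` averages `f` given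
the labels in `Δ` and the spins off `Δ`. On each of the finitely many label patterns `k` it equals
`N k / D k`, with `η` entering only through the spins off `Δ`. Measurability is part of the claim
because `η` is both boundary condition and constraint. -/
lemma IsDLR.lintegral_gibbsOp_labelMeasure {Δ : Finset S} {μ : Measure (S → X)}
    (h : IsDLR Φ ρ Δ μ) {f : (S → X) → ℝ≥0∞} (hf : Measurable f) (hf1 : f ≤ 1) :
    Measurable (fun η => gibbsOp Φ (labelMeasure ρ t η) Δ f η) ∧
      ∫⁻ η, gibbsOp Φ (labelMeasure ρ t η) Δ f η ∂μ = ∫⁻ ω, f ω ∂μ := by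
  classical
  have := Fintype.ofFinite L
  let E (k : Δ → L) : Set (S → X) := {ω | ∀ i (hi : i ∈ Δ), t i (ω i) = k ⟨i, hi⟩}
  have hE (k : Δ → L) : MeasurableSet (E k) := by
    have : E k = ⋂ i, ⋂ hi : i ∈ Δ, (fun ω : S → X => t i (ω i)) ⁻¹' {k ⟨i, hi⟩} := by
      ext ω
      simp [E]
    rw [this]
    exact MeasurableSet.iInter fun i => MeasurableSet.iInter fun hi =>
      (ht i).comp (measurable_pi_apply i) (measurableSet_singleton _)
  have hmem (k : Δ → L) (ω : S → X) : ω ∈ E k ↔ k = fun i : Δ => t i (ω i) :=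
    ⟨fun h => funext fun i => (h i i.2).symm, fun h i hi => by rw [h]⟩
  have hsum (g : (S → X) → ℝ≥0∞) (ω : S → X) : g ω = ∑ k, (E k).indicator g ω := by
    rw [Finset.sum_eq_single (fun i : Δ => t i (ω i))]
    · rw [Set.indicator_of_mem ((hmem _ _).2 rfl)]
    · exact fun k _ hk => Set.indicator_of_notMem (fun h => hk ((hmem _ _).1 h)) _
    · simp
  have hw := hΦ.measurable_weight Δ
  let N (k : Δ → L) := ∫⋯∫⁻_Δ, (E k).indicator (weight Φ Δ * f) ∂ρ
  let D (k : Δ → L) := ∫⋯∫⁻_Δ, (E k).indicator (weight Φ Δ) ∂ρ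
  have hN (k : Δ → L) : Measurable (N k) := ((hw.mul hf).indicator (hE k)).lmarginal ρ
  have hD (k : Δ → L) : Measurable (D k) := (hw.indicator (hE k)).lmarginal ρ
  have hop (η : S → X) : gibbsOp Φ (labelMeasure ρ t η) Δ f η =
      ∑ k, (E k).indicator ((D k)⁻¹ * N k) η := by
    rw [hsum (fun η => gibbsOp Φ (labelMeasure ρ t η) Δ f η) η]
    refine Finset.sum_congr rfl fun k _ => ?_
    by_cases hk : η ∈ E k
    · rw [Set.indicator_of_mem hk, Set.indicator_of_mem hk]
      have hset : {ω : S → X | ∀ i ∈ Δ, ω i ∈ {x | t i x = t i (η i)}} = E k := by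
        ext ω
        refine forall_congr' fun i => forall_congr' fun hi => ?_
        rw [← hk i hi]
        rfl
      have hAm (i : S) : MeasurableSet {x | t i x = t i (η i)} :=
        ht i (measurableSet_singleton _)
      simp only [gibbsOp, partitionFun, Pi.mul_apply, Pi.inv_apply]
      change (lmarginal (fun i => (ρ i).restrict {x | t i x = t i (η i)}) Δ _ η)⁻¹ *
        lmarginal (fun i => (ρ i).restrict {x | t i x = t i (η i)}) Δ _ η = _
      rw [lmarginal_restrict Δ hAm, lmarginal_restrict Δ hAm, hset]
    · rw [Set.indicator_of_notMem hk, Set.indicator_of_notMem hk]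
  have hm (k : Δ → L) : Measurable ((E k).indicator ((D k)⁻¹ * N k)) :=
    ((hD k).inv.mul (hN k)).indicator (hE k)
  simp only [hop]
  refine ⟨Finset.measurable_sum _ fun k _ => hm k, ?_⟩
  rw [lintegral_finsetSum _ fun k _ => hm k, lintegral_congr (hsum f),
    lintegral_finsetSum _ fun k _ => hf.indicator (hE k)]
  refine Finset.sum_congr rfl fun k _ => ?_
  rw [← h _ (hm k), ← h _ (hf.indicator (hE k))]
  refine lintegral_congr fun η => ?_
  simp only [gibbsOp, Pi.mul_apply, Pi.inv_apply]
  congr 1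
  have h1 : weight Φ Δ * (E k).indicator ((D k)⁻¹ * N k) =
      ((D k)⁻¹ * N k) * (E k).indicator (weight Φ Δ) := by
    funext ω
    by_cases hk : ω ∈ E k
    · simp [hk, mul_comm]
    · simp [hk]
  have h2 : weight Φ Δ * (E k).indicator f = (E k).indicator (weight Φ Δ * f) := by
    funext ω
    by_cases hk : ω ∈ E k <;> simp [hk]
  have h3 : DependsOn ((D k)⁻¹ * N k) ((Δ : Set S)ᶜ) := by
    intro ω ω' hω
    simp only [Pi.mul_apply, Pi.inv_apply, N, D]
    rw [dependsOn_lmarginal Δ _ hω, dependsOn_lmarginal Δ _ hω]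
  rw [h1, h2, lmarginal_mul_left h3 (hw.indicator (hE k))]
  change (D k η)⁻¹ * N k η * D k η = N k η
  have hND : N k η ≤ D k η := by
    refine lmarginal_mono (fun ω => Set.indicator_le_indicator ?_) η
    simpa using mul_le_mul_right (hf1 ω) (weight Φ Δ ω)
  have hDt : D k η ≠ ∞ :=
    ne_top_of_le_ne_top (partitionFun_ne_top hΦ (ρ := ρ) Δ η)
      (lmarginal_mono (fun ω => Set.indicator_le_self _ _ ω) η)
  -- Where `D k` vanishes its inverse is `∞`, but `N k ≤ D k` (from `f ≤ 1`) makes both sides zero.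
  rcases eq_or_ne (D k η) 0 with h0 | h0
  · have : N k η = 0 := le_antisymm (hND.trans h0.le) zero_le
    rw [this, h0, mul_zero]
  · rw [mul_right_comm, ENNReal.inv_mul_cancel h0 hDt, one_mul]

/-- Disintegration of a Gibbs measure along labels of the spins: if the models conditioned on the
labels have unique Gibbs measures `K η`, then the Gibbs measure is a mixture of them. -/
theorem lintegral_conditional_gibbs [TopologicalSpace X] [CompactSpace X]
    [TopologicalSpace.MetrizableSpace X] [BorelSpace X]
    (hpos : ∀ η i, NeZero (labelMeasure ρ t η i)) {K : (S → X) → Measure (S → X)}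
    (hK : ∀ η, ∀ ν ∈ gibbsMeasures (gibbsSpec Φ (labelMeasure ρ t η)), ν = K η)
    {μ : Measure (S → X)} (hμ : IsProbabilityMeasure μ) (hd : ∀ Λ, IsDLR Φ ρ Λ μ)
    {B : Set (S → X)} (hB : B ∈ measurableCylinders fun _ : S => X) :
    ∫⁻ η, K η B ∂μ = μ B := by
  have hBm : MeasurableSet B := MeasurableSet.of_mem_measurableCylinders hB
  have hfin (η : S → X) (i : S) : IsFiniteMeasure (labelMeasure ρ t η i) := by
    unfold labelMeasure
    infer_instance
  have hB1 : B.indicator (1 : (S → X) → ℝ≥0∞) ≤ 1 := Set.indicator_le_self _ _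
  have hBi := (measurable_one (α := ℝ≥0∞) (β := S → X)).indicator hBm
  -- The integrals on the left equal `μ B` for every `Δ`. By uniqueness their integrands tend
  -- pointwise to `K η B`, with `η` itself as boundary condition, and dominated convergence applies.
  have hlim : Filter.Tendsto
      (fun Δ => ∫⁻ η, gibbsOp Φ (labelMeasure ρ t η) Δ (B.indicator 1) η ∂μ) Filter.atTop
      (𝓝 (∫⁻ η, K η B ∂μ)) := by
    refine tendsto_lintegral_filter_of_dominated_convergence (fun _ => 1)
      (Filter.Eventually.of_forall fun Δ =>
        ((hd Δ).lintegral_gibbsOp_labelMeasure hΦ ht hBi hB1).1)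
      (Filter.Eventually.of_forall fun Δ => ae_of_all _ fun η => ?_) (by simp)
      (ae_of_all _ fun η => ?_)
    · have := hpos η
      exact gibbsOp_le_one hΦ Δ hB1 η
    · have := hpos η
      have h := tendsto_gibbsSpec_of_unique hΦ (ρ := labelMeasure ρ t η) (hK η) η hB
      simpa only [gibbsSpec_apply hΦ _ _ _ hBm] using h
  refine tendsto_nhds_unique hlim ?_
  simp only [fun Δ => ((hd Δ).lintegral_gibbsOp_labelMeasure hΦ ht hBi hB1).2,
    lintegral_indicator_one hBm]
  exact tendsto_const_nhds

end labels

end SampleRotateProject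
end

/-! ### Deleting the interactions with `Λ`: Gibbs measures on the lattice and on `Λᶜ`. -/

open MeasureTheory

noncomputable section

namespace SampleRotateProject

set_option linter.unusedSectionVars false

section outer

variable {d : ℕ} {Φ : Finset (Site d) → (Site d → Spin) → ℝ} {Λ : Finset (Site d)}

/-- The restriction of a configuration to the complement of `Λ`. -/
def offRestrict (Λ : Finset (Site d)) (ω : Site d → Spin) : {i // i ∉ Λ} → Spin := fun i => ω i

/-- The extension of a configuration off `Λ` by zero. -/
def offExtend (Λ : Finset (Site d)) (σ : {i // i ∉ Λ} → Spin) : Site d → Spin :=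
  join Λ (fun _ => 0) σ

lemma measurable_offRestrict : Measurable (offRestrict Λ) :=
  measurable_pi_lambda _ fun i => measurable_pi_apply i.1

lemma measurable_join {X : Type*} [MeasurableSpace X] :
    Measurable fun p : (Λ → X) × ({i // i ∉ Λ} → X) => join Λ p.1 p.2 := by
  refine measurable_pi_lambda _ fun i => ?_
  by_cases h : i ∈ Λ
  · simp only [join, h, dif_pos]
    exact (measurable_pi_apply _).comp measurable_fst
  · simp only [join, h, dif_neg, not_false_eq_true]
    exact (measurable_pi_apply _).comp measurable_snd

lemma measurable_offExtend : Measurable (offExtend Λ) :=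
  measurable_join.comp (measurable_const.prodMk measurable_id)

lemma offRestrict_offExtend (σ : {i // i ∉ Λ} → Spin) : offRestrict Λ (offExtend Λ σ) = σ := by
  funext i
  simp [offRestrict, offExtend, join, i.2]

lemma offExtend_offRestrict (ω : Site d → Spin) :
    ∀ i ∈ ((Λ : Set (Site d))ᶜ), offExtend Λ (offRestrict Λ ω) i = ω i := by
  intro i hi
  simp [offRestrict, offExtend, join, show i ∉ Λ by simpa using hi]

lemma dependsOn_comp_offRestrict {β : Type*} (g : ({i // i ∉ Λ} → Spin) → β) :
    DependsOn (fun ω => g (offRestrict Λ ω)) ((Λ : Set (Site d))ᶜ) := by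
  intro ω ω' h
  have : offRestrict Λ ω = offRestrict Λ ω' := funext fun i => h i (by simp)
  simp only [this]

lemma offExtend_offRestrict_eq {β : Type*} {g : (Site d → Spin) → β}
    (hg : DependsOn g ((Λ : Set (Site d))ᶜ)) (ω : Site d → Spin) :
    g (offExtend Λ (offRestrict Λ ω)) = g ω := hg (offExtend_offRestrict ω)

/-- The inclusion of volumes of `Λᶜ` into volumes of the lattice. -/
def liftVol (V : Finset {i // i ∉ Λ}) : Finset (Site d) := V.map (Function.Embedding.subtype _)

lemma mem_liftVol {V : Finset {i // i ∉ Λ}} {i : Site d} :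
    i ∈ liftVol V ↔ ∃ h : i ∉ Λ, (⟨i, h⟩ : {i // i ∉ Λ}) ∈ V := by
  simp [liftVol]

lemma union_liftVol_sdiff (V : Finset {i // i ∉ Λ}) : (Λ ∪ liftVol V) \ Λ = liftVol V := by
  ext i
  simp only [Finset.mem_sdiff, Finset.mem_union, mem_liftVol]
  constructor
  · rintro ⟨h1 | h1, h2⟩
    exacts [absurd h1 h2, h1]
  · rintro ⟨h1, h2⟩
    exact ⟨Or.inr ⟨h1, h2⟩, h1⟩

/-- Volumes `Λ ∪ V` with `V ⊆ Λᶜ` are cofinal, so by consistency only these need to be tested. -/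
lemma subset_union_liftVol (Δ : Finset (Site d)) :
    Δ ⊆ Λ ∪ liftVol (Δ.subtype fun i => i ∉ Λ) := by
  intro i hi
  by_cases h : i ∈ Λ
  · exact Finset.mem_union_left _ h
  · exact Finset.mem_union_right _ (mem_liftVol.2 ⟨h, by simp [hi]⟩)

section

variable (hΦ : AbsSummable Φ)
include hΦ

lemma deletedPotential_offRestrict (A : Finset {i // i ∉ Λ}) (ω : Site d → Spin) :
    deletedPotential Φ Λ A (offRestrict Λ ω) = Φ (liftVol A) ω := by
  refine hΦ.dependsOn _ _ _ fun i hi => ?_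
  obtain ⟨h, -⟩ := mem_liftVol.1 hi
  exact offExtend_offRestrict ω i (by simpa using h)

lemma absSummable_deletedPotential : AbsSummable (deletedPotential Φ Λ) where
  measurable A := (hΦ.measurable _).comp measurable_offExtend
  dependsOn A σ σ' h := by
    refine hΦ.dependsOn _ _ _ fun i hi => ?_
    obtain ⟨hi1, hi2⟩ := mem_liftVol.1 hi
    simpa [join, hi1] using h _ hi2
  absSummable i := by
    let e : {A : Finset {i // i ∉ Λ} // i ∈ A} → {A : Finset (Site d) // i.1 ∈ A} :=
      fun A => ⟨liftVol A.1, mem_liftVol.2 ⟨i.2, A.2⟩⟩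
    have he : Function.Injective e := fun A B h =>
      Subtype.ext (Finset.map_injective _ (congrArg Subtype.val h))
    refine ne_top_of_le_ne_top (hΦ.absSummable i.1) (le_trans (ENNReal.tsum_le_tsum fun A => ?_)
      (ENNReal.tsum_comp_le_tsum_of_injective he fun A => ⨆ ω, ‖Φ A ω‖ₑ))
    exact iSup_le fun σ => le_iSup (fun ω => ‖Φ (liftVol A.1) ω‖ₑ) (offExtend Λ σ)

/-- The interactions that meet `Λ ∪ V` but not `Λ` are exactly those of the deleted model that meet
`V`. -/
lemma hamiltonian_union_liftVol (V : Finset {i // i ∉ Λ}) (ω : Site d → Spin) :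
    hamiltonian Φ (Λ ∪ liftVol V) ω =
      hamiltonian Φ Λ ω + hamiltonian (deletedPotential Φ Λ) V (offRestrict Λ ω) := by
  rw [← sub_eq_iff_eq_add', hΦ.hamiltonian_sub_eq Finset.subset_union_left,
    hamiltonian_eq_tsum_ite]
  have hinj : Function.Injective (liftVol : Finset {i // i ∉ Λ} → Finset (Site d)) :=
    Finset.map_injective _
  rw [← hinj.tsum_eq]
  · refine tsum_congr fun A => ?_
    rw [deletedPotential_offRestrict hΦ]
    have h1 : ¬(liftVol A ∩ Λ).Nonempty := by
      rintro ⟨i, hi⟩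
      rw [Finset.mem_inter, mem_liftVol] at hi
      exact hi.1.1 hi.2
    have h2 : (liftVol A ∩ (Λ ∪ liftVol V)).Nonempty ↔ (A ∩ V).Nonempty := by
      constructor
      · rintro ⟨i, hi⟩
        rw [Finset.mem_inter, Finset.mem_union, mem_liftVol, mem_liftVol] at hi
        obtain ⟨⟨h, hA⟩, hV | ⟨h', hV⟩⟩ := hi
        exacts [absurd hV h, ⟨_, Finset.mem_inter.2 ⟨hA, hV⟩⟩]
      · rintro ⟨i, hi⟩
        rw [Finset.mem_inter] at hi
        exact ⟨i, Finset.mem_inter.2 ⟨mem_liftVol.2 ⟨i.2, hi.1⟩,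
          Finset.mem_union_right _ (mem_liftVol.2 ⟨i.2, hi.2⟩)⟩⟩
    simp only [h1, h2, not_false_eq_true, and_true]
  · intro A hA
    simp only [Function.mem_support, ne_eq, ite_eq_right_iff, Classical.not_imp] at hA
    refine ⟨A.subtype fun i => i ∉ Λ, ?_⟩
    ext i
    simp only [mem_liftVol, Finset.mem_subtype, exists_prop, and_iff_right_iff_imp]
    exact fun hi hiΛ => hA.1.2 ⟨i, Finset.mem_inter.2 ⟨hi, hiΛ⟩⟩

lemma weight_union_liftVol (V : Finset {i // i ∉ Λ}) :
    weight Φ (Λ ∪ liftVol V) =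
      (fun ω => weight (deletedPotential Φ Λ) V (offRestrict Λ ω)) * weight Φ Λ := by
  funext ω
  rw [Pi.mul_apply, weight, weight, weight, hamiltonian_union_liftVol hΦ,
    ← ENNReal.ofReal_mul (Real.exp_nonneg _), ← Real.exp_add]
  congr 2
  ring

end

variable {ρ : Site d → Measure Spin} [∀ i, IsFiniteMeasure (ρ i)]

lemma lmarginal_liftVol (V : Finset {i // i ∉ Λ}) {g : ({i // i ∉ Λ} → Spin) → ℝ≥0∞}
    (hg : Measurable g) (ω : Site d → Spin) :
    (∫⋯∫⁻_liftVol V, (fun ω => g (offRestrict Λ ω)) ∂ρ) ω =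
      (∫⋯∫⁻_V, g ∂(fun i : {i // i ∉ Λ} => ρ i)) (offRestrict Λ ω) := by
  have h := lmarginal_image (μ := ρ) (e := fun i : {i // i ∉ Λ} => i.1) Subtype.val_injective V
    (f := g) hg ω
  have h2 : V.image (fun i : {i // i ∉ Λ} => i.1) = liftVol V := by
    rw [liftVol, Finset.map_eq_image]
    rfl
  rw [h2] at h
  exact h

/-- The measure on the lattice with finite-volume conditional density in `Λ` and marginal `ν`
off `Λ`. -/
def outerLift (Φ : Finset (Site d) → (Site d → Spin) → ℝ) (ρ : Site d → Measure Spin)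
    (Λ : Finset (Site d)) (ν : Measure ({i // i ∉ Λ} → Spin)) : Measure (Site d → Spin) :=
  normalize (boltzmann Φ Λ
    (((Measure.pi fun i : Λ => ρ i).prod ν).map fun p => join Λ p.1 p.2))

/-- The Gibbs measure off `Λ` corresponding to a Gibbs measure on the whole lattice. -/
def outerRestrict (Φ : Finset (Site d) → (Site d → Spin) → ℝ) (ρ : Site d → Measure Spin)
    (Λ : Finset (Site d)) (μ : Measure (Site d → Spin)) : Measure ({i // i ∉ Λ} → Spin) :=
  normalize ((μ.withDensity (partitionFun Φ ρ Λ)⁻¹).map (offRestrict Λ))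

variable (hΦ : AbsSummable Φ)
include hΦ

lemma lintegral_boltzmann_prod (ν : Measure ({i // i ∉ Λ} → Spin)) [IsProbabilityMeasure ν]
    {f : (Site d → Spin) → ℝ≥0∞} (hf : Measurable f) :
    ∫⁻ ω, f ω ∂(boltzmann Φ Λ
      (((Measure.pi fun i : Λ => ρ i).prod ν).map fun p => join Λ p.1 p.2)) =
      ∫⁻ σ, (∫⋯∫⁻_Λ, weight Φ Λ * f ∂ρ) (offExtend Λ σ) ∂ν := by
  have hm := (hΦ.measurable_weight Λ).mul hf
  rw [lintegral_boltzmann hΦ Λ _ hf, lintegral_map hm measurable_join,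
    lintegral_prod_symm (fun p : (Λ → Spin) × ({i // i ∉ Λ} → Spin) =>
      (weight Φ Λ * f) (join Λ p.1 p.2)) (hm.comp measurable_join).aemeasurable]
  refine lintegral_congr fun σ => lintegral_congr fun ζ => ?_
  rw [← join_eq_updateFinset]
  have h : (fun i : {i // i ∉ Λ} => offExtend Λ σ i) = σ := offRestrict_offExtend σ
  rw [h]

variable [∀ i, NeZero (ρ i)]

lemma boltzmann_prod_univ (ν : Measure ({i // i ∉ Λ} → Spin)) [IsProbabilityMeasure ν] :
    boltzmann Φ Λ (((Measure.pi fun i : Λ => ρ i).prod ν).map fun p => join Λ p.1 p.2) Set.univ =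
      ∫⁻ σ, partitionFun Φ ρ Λ (offExtend Λ σ) ∂ν := by
  rw [← lintegral_one, lintegral_boltzmann_prod hΦ ν measurable_const]
  refine lintegral_congr fun σ => ?_
  congr 2
  funext ω
  simp

omit [∀ i, NeZero (ρ i)] in
lemma lintegral_withDensity_map_offRestrict (μ : Measure (Site d → Spin))
    {g : ({i // i ∉ Λ} → Spin) → ℝ≥0∞} (hg : Measurable g) :
    ∫⁻ σ, g σ ∂((μ.withDensity (partitionFun Φ ρ Λ)⁻¹).map (offRestrict Λ)) =
      ∫⁻ ω, (partitionFun Φ ρ Λ ω)⁻¹ * g (offRestrict Λ ω) ∂μ := by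
  rw [lintegral_map hg measurable_offRestrict,
    lintegral_withDensity_eq_lintegral_mul _ (measurable_partitionFun hΦ Λ).inv
      (g := fun ω => g (offRestrict Λ ω)) (hg.comp measurable_offRestrict)]
  rfl

lemma exists_lintegral_bounds {Y : Type*} [MeasurableSpace Y] (ν : Measure Y)
    [IsProbabilityMeasure ν] (e : Y → Site d → Spin) :
    (∫⁻ y, partitionFun Φ ρ Λ (e y) ∂ν ≠ 0 ∧ ∫⁻ y, partitionFun Φ ρ Λ (e y) ∂ν ≠ ∞) ∧
      ∫⁻ y, (partitionFun Φ ρ Λ (e y))⁻¹ ∂ν ≠ 0 ∧ ∫⁻ y, (partitionFun Φ ρ Λ (e y))⁻¹ ∂ν ≠ ∞ := by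
  obtain ⟨c, h0, h1, -, hc⟩ := partitionFun_bounds hΦ Λ
  have hV0 := volMass_ne_zero (ρ := ρ) Λ
  have hVt := volMass_ne_top (ρ := ρ) Λ
  have ha : c⁻¹ * volMass ρ Λ ≠ 0 := mul_ne_zero (by simpa using h1) hV0
  have hb : c * volMass ρ Λ ≠ ∞ := ENNReal.mul_ne_top h1 hVt
  have key (a b : ℝ≥0∞) (ha : a ≠ 0) (hb : b ≠ ∞) (f : Y → ℝ≥0∞) (h1 : ∀ y, a ≤ f y)
      (h2 : ∀ y, f y ≤ b) : ∫⁻ y, f y ∂ν ≠ 0 ∧ ∫⁻ y, f y ∂ν ≠ ∞ := by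
    have ha' : a ≤ ∫⁻ y, f y ∂ν := by simpa using lintegral_mono (μ := ν) h1
    have hb' : ∫⁻ y, f y ∂ν ≤ b := by simpa using lintegral_mono (μ := ν) h2
    exact ⟨fun h => ha (by simpa [h] using ha'), ne_top_of_le_ne_top hb hb'⟩
  exact ⟨key _ _ ha hb _ (fun y => (hc ρ (e y)).1) fun y => (hc ρ (e y)).2,
    key _ _ (ENNReal.inv_ne_zero.2 hb) (ENNReal.inv_ne_top.2 ha) _
      (fun y => ENNReal.inv_le_inv.2 (hc ρ (e y)).2) fun y => ENNReal.inv_le_inv.2 (hc ρ (e y)).1⟩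

lemma isProbabilityMeasure_outerLift (ν : Measure ({i // i ∉ Λ} → Spin))
    [IsProbabilityMeasure ν] : IsProbabilityMeasure (outerLift Φ ρ Λ ν) := by
  refine isProbabilityMeasure_normalize ?_ ?_
  · rw [boltzmann_prod_univ hΦ]
    exact (exists_lintegral_bounds hΦ ν _).1.1
  · rw [boltzmann_prod_univ hΦ]
    exact (exists_lintegral_bounds hΦ ν _).1.2

lemma lintegral_outerLift (ν : Measure ({i // i ∉ Λ} → Spin)) [IsProbabilityMeasure ν]
    {f : (Site d → Spin) → ℝ≥0∞} (hf : Measurable f) :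
    ∫⁻ ω, f ω ∂(outerLift Φ ρ Λ ν) = (∫⁻ σ, partitionFun Φ ρ Λ (offExtend Λ σ) ∂ν)⁻¹ *
      ∫⁻ σ, (∫⋯∫⁻_Λ, weight Φ Λ * f ∂ρ) (offExtend Λ σ) ∂ν := by
  rw [outerLift, lintegral_normalize, lintegral_boltzmann_prod hΦ ν hf, boltzmann_prod_univ hΦ]

lemma withDensity_map_univ (μ : Measure (Site d → Spin)) :
    (μ.withDensity (partitionFun Φ ρ Λ)⁻¹).map (offRestrict Λ) Set.univ =
      ∫⁻ ω, (partitionFun Φ ρ Λ ω)⁻¹ ∂μ := by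
  rw [← lintegral_one, lintegral_withDensity_map_offRestrict hΦ μ measurable_const]
  simp

lemma isProbabilityMeasure_outerRestrict (μ : Measure (Site d → Spin))
    [IsProbabilityMeasure μ] : IsProbabilityMeasure (outerRestrict Φ ρ Λ μ) := by
  refine isProbabilityMeasure_normalize ?_ ?_
  · rw [withDensity_map_univ hΦ]
    exact (exists_lintegral_bounds hΦ μ id).2.1
  · rw [withDensity_map_univ hΦ]
    exact (exists_lintegral_bounds hΦ μ id).2.2

lemma lintegral_outerRestrict (μ : Measure (Site d → Spin))
    {g : ({i // i ∉ Λ} → Spin) → ℝ≥0∞} (hg : Measurable g) :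
    ∫⁻ σ, g σ ∂(outerRestrict Φ ρ Λ μ) = (∫⁻ ω, (partitionFun Φ ρ Λ ω)⁻¹ ∂μ)⁻¹ *
      ∫⁻ ω, (partitionFun Φ ρ Λ ω)⁻¹ * g (offRestrict Λ ω) ∂μ := by
  rw [outerRestrict, lintegral_normalize, lintegral_withDensity_map_offRestrict hΦ μ hg,
    withDensity_map_univ hΦ]

/-- The specification of the outer model, pulled back to the whole lattice. -/
lemma gibbsOp_deleted_offRestrict (V : Finset {i // i ∉ Λ})
    {g : ({i // i ∉ Λ} → Spin) → ℝ≥0∞} (hg : Measurable g) (ω : Site d → Spin) :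
    gibbsOp (deletedPotential Φ Λ) (fun i : {i // i ∉ Λ} => ρ i) V g (offRestrict Λ ω) =
      (partitionFun (deletedPotential Φ Λ) (fun i : {i // i ∉ Λ} => ρ i) V (offRestrict Λ ω))⁻¹ *
      (∫⋯∫⁻_liftVol V, (fun ω => weight (deletedPotential Φ Λ) V (offRestrict Λ ω)) *
        (fun ω => g (offRestrict Λ ω)) ∂ρ) ω := by
  rw [gibbsOp, Pi.mul_apply, Pi.inv_apply]
  congr 1
  exact (lmarginal_liftVol V (((absSummable_deletedPotential hΦ).measurable_weight V).mul hg)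
    ω).symm

/-- Integrating over `Λ` first pulls out the weight of the deleted model. Testing `f` on the lattice
becomes testing `L_Λ(w_Λ f)` on `Λᶜ`. -/
lemma lmarginal_union_liftVol (V : Finset {i // i ∉ Λ}) {f : (Site d → Spin) → ℝ≥0∞}
    (hf : Measurable f) : ∫⋯∫⁻_Λ ∪ liftVol V, weight Φ (Λ ∪ liftVol V) * f ∂ρ =
      ∫⋯∫⁻_liftVol V, (fun ω => weight (deletedPotential Φ Λ) V (offRestrict Λ ω)) *
        ∫⋯∫⁻_Λ, weight Φ Λ * f ∂ρ ∂ρ := by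
  have hw := hΦ.measurable_weight Λ
  have hu := ((absSummable_deletedPotential hΦ (Λ := Λ)).measurable_weight V).comp
    measurable_offRestrict
  rw [weight_union_liftVol hΦ, mul_assoc,
    lmarginal_of_subset Finset.subset_union_left (by exact hu.mul (hw.mul hf)),
    union_liftVol_sdiff, lmarginal_mul_left (dependsOn_comp_offRestrict _) (hw.mul hf)]

theorem outerLift_mem_gibbsMeasures {ν : Measure ({i // i ∉ Λ} → Spin)}
    (hν : ν ∈ gibbsMeasures (gibbsSpec (deletedPotential Φ Λ) fun i : {i // i ∉ Λ} => ρ i)) :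
    outerLift Φ ρ Λ ν ∈ gibbsMeasures (gibbsSpec Φ ρ) := by
  have hdel := absSummable_deletedPotential hΦ (Λ := Λ)
  rw [mem_gibbsMeasures_iff hdel] at hν
  obtain ⟨hνp, hν⟩ := hν
  rw [mem_gibbsMeasures_iff hΦ]
  refine ⟨isProbabilityMeasure_outerLift hΦ ν, fun Δ₀ => ?_⟩
  refine IsDLR.mono hΦ (subset_union_liftVol (Λ := Λ) Δ₀) ?_
  generalize Δ₀.subtype (fun i => i ∉ Λ) = V
  intro f hf
  have hw := hΦ.measurable_weight Λ
  set Δ := Λ ∪ liftVol V with hΔ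
  set G := gibbsOp Φ ρ Δ f with hG
  have hGm : Measurable G := measurable_gibbsOp hΦ Δ hf
  have hGd : DependsOn G ((Δ : Set (Site d))ᶜ) := dependsOn_gibbsOp Δ f
  have hGΛ : DependsOn G ((Λ : Set (Site d))ᶜ) := fun ω ω' h => hGd fun i hi => h i fun hi' =>
    hi (by
      rw [hΔ, Finset.coe_union]
      exact Or.inl hi')
  have hGV : DependsOn G ((liftVol V : Set (Site d))ᶜ) := fun ω ω' h => hGd fun i hi => h i
    fun hi' => hi (by
      rw [hΔ, Finset.coe_union]
      exact Or.inr hi')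
  rw [lintegral_outerLift hΦ ν hGm, lintegral_outerLift hΦ ν hf]
  congr 1
  have hL (f : (Site d → Spin) → ℝ≥0∞) (hf : Measurable f) :
      Measurable fun σ => (∫⋯∫⁻_Λ, weight Φ Λ * f ∂ρ) (offExtend Λ σ) :=
    ((hw.mul hf).lmarginal ρ).comp measurable_offExtend
  rw [← hν V _ (hL G hGm), ← hν V _ (hL f hf)]
  refine lintegral_congr fun σ => ?_
  rw [← offRestrict_offExtend σ, gibbsOp_deleted_offRestrict hΦ V (hL G hGm),
    gibbsOp_deleted_offRestrict hΦ V (hL f hf)]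
  congr 1
  have hr (f : (Site d → Spin) → ℝ≥0∞) : (fun ω => (∫⋯∫⁻_Λ, weight Φ Λ * f ∂ρ)
      (offExtend Λ (offRestrict Λ ω))) = ∫⋯∫⁻_Λ, weight Φ Λ * f ∂ρ :=
    funext fun ω => offExtend_offRestrict_eq (dependsOn_lmarginal Λ _) ω
  rw [hr, hr, ← lmarginal_union_liftVol hΦ V hGm, ← lmarginal_union_liftVol hΦ V hf,
    lmarginal_weight_mul_gibbsOp hΦ subset_rfl hf]

/-- Dividing by the partition function cancels the effect of integrating out `Λ`; this is why
`outerRestrict` carries the density `(partitionFun Φ ρ Λ)⁻¹`. -/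
lemma lmarginal_weight_mul_inv_partitionFun (g : ({i // i ∉ Λ} → Spin) → ℝ≥0∞) :
    (∫⋯∫⁻_Λ, weight Φ Λ * (fun ω => (partitionFun Φ ρ Λ ω)⁻¹ * g (offRestrict Λ ω)) ∂ρ) =
      fun ω => g (offRestrict Λ ω) := by
  have h1 : weight Φ Λ * (fun ω => (partitionFun Φ ρ Λ ω)⁻¹ * g (offRestrict Λ ω)) =
    (fun ω => (partitionFun Φ ρ Λ ω)⁻¹ * g (offRestrict Λ ω)) * weight Φ Λ := mul_comm _ _
  rw [h1, lmarginal_mul_left _ (hΦ.measurable_weight Λ)]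
  · funext ω
    change (partitionFun Φ ρ Λ ω)⁻¹ * g (offRestrict Λ ω) * partitionFun Φ ρ Λ ω = _
    rw [mul_right_comm, ENNReal.inv_mul_cancel (partitionFun_ne_zero hΦ Λ ω)
      (partitionFun_ne_top hΦ Λ ω), one_mul]
  · intro ω ω' h
    have h2 := dependsOn_comp_offRestrict g h
    simp only at h2 ⊢
    rw [h2, dependsOn_partitionFun Λ h]

theorem outerRestrict_mem_gibbsMeasures {μ : Measure (Site d → Spin)}
    (hμ : μ ∈ gibbsMeasures (gibbsSpec Φ ρ)) : outerRestrict Φ ρ Λ μ ∈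
      gibbsMeasures (gibbsSpec (deletedPotential Φ Λ) fun i : {i // i ∉ Λ} => ρ i) := by
  have hdel := absSummable_deletedPotential hΦ (Λ := Λ)
  rw [mem_gibbsMeasures_iff hΦ] at hμ
  obtain ⟨hμp, hμ⟩ := hμ
  rw [mem_gibbsMeasures_iff hdel]
  refine ⟨isProbabilityMeasure_outerRestrict hΦ μ, fun V g hg => ?_⟩
  have hGm := measurable_gibbsOp hdel (ρ := fun i : {i // i ∉ Λ} => ρ i) V hg
  rw [lintegral_outerRestrict hΦ μ hGm, lintegral_outerRestrict hΦ μ hg]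
  congr 1
  have hw := hΦ.measurable_weight Λ
  have hZ := measurable_partitionFun hΦ (ρ := ρ) Λ
  have hfm (g : ({i // i ∉ Λ} → Spin) → ℝ≥0∞) (hg : Measurable g) :
      Measurable fun ω => (partitionFun Φ ρ Λ ω)⁻¹ * g (offRestrict Λ ω) :=
    hZ.inv.mul (hg.comp measurable_offRestrict)
  rw [← hμ (Λ ∪ liftVol V) _ (hfm _ hGm), ← hμ (Λ ∪ liftVol V) _ (hfm _ hg)]
  refine lintegral_congr fun ω => ?_
  simp only [gibbsOp.eq_1 Φ, Pi.mul_apply]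
  congr 1
  rw [lmarginal_union_liftVol hΦ V (hfm _ hGm), lmarginal_union_liftVol hΦ V (hfm _ hg)]
  rw [lmarginal_weight_mul_inv_partitionFun hΦ, lmarginal_weight_mul_inv_partitionFun hΦ]
  have hu := hdel.measurable_weight V
  have h1 := lmarginal_liftVol (ρ := ρ) V (hu.mul hGm) ω
  have h2 := lmarginal_liftVol (ρ := ρ) V (hu.mul hg) ω
  rw [lmarginal_weight_mul_gibbsOp hdel subset_rfl hg] at h1
  exact h1.trans h2.symm

/-- The factors `Z_Λ` and `Z_Λ⁻¹` cancel, and what remains is the DLR equation of `μ` in `Λ`. -/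
theorem outerLift_outerRestrict {μ : Measure (Site d → Spin)}
    (hμ : μ ∈ gibbsMeasures (gibbsSpec Φ ρ)) :
    outerLift Φ ρ Λ (outerRestrict Φ ρ Λ μ) = μ := by
  rw [mem_gibbsMeasures_iff hΦ] at hμ
  obtain ⟨hμp, hμ⟩ := hμ
  have := isProbabilityMeasure_outerRestrict hΦ (ρ := ρ) (Λ := Λ) μ
  obtain ⟨h0, ht⟩ := (exists_lintegral_bounds hΦ (ρ := ρ) (Λ := Λ) μ id).2
  simp only [id_eq] at h0 ht
  have hZ := measurable_partitionFun hΦ (ρ := ρ) Λ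
  refine Measure.ext_of_lintegral _ fun f hf => ?_
  have hL := (((hΦ.measurable_weight Λ).mul hf).lmarginal ρ (s := Λ))
  rw [lintegral_outerLift hΦ _ hf,
    lintegral_outerRestrict hΦ μ (g := fun σ => partitionFun Φ ρ Λ (offExtend Λ σ))
      (hZ.comp measurable_offExtend),
    lintegral_outerRestrict hΦ μ
      (g := fun σ => (∫⋯∫⁻_Λ, weight Φ Λ * f ∂ρ) (offExtend Λ σ))
      (hL.comp measurable_offExtend)]
  simp only [offExtend_offRestrict_eq (dependsOn_partitionFun Λ),
    offExtend_offRestrict_eq (dependsOn_lmarginal Λ _)]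
  simp only [ENNReal.inv_mul_cancel (partitionFun_ne_zero hΦ Λ _) (partitionFun_ne_top hΦ Λ _),
    lintegral_one, measure_univ, mul_one, inv_inv, ← mul_assoc]
  rw [ENNReal.mul_inv_cancel h0 ht, one_mul]
  exact hμ Λ f hf

theorem outerRestrict_outerLift (ν : Measure ({i // i ∉ Λ} → Spin)) [IsProbabilityMeasure ν] :
    outerRestrict Φ ρ Λ (outerLift Φ ρ Λ ν) = ν := by
  obtain ⟨h0, ht⟩ := (exists_lintegral_bounds hΦ (ρ := ρ) (Λ := Λ) ν (offExtend Λ)).1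
  have hZ := measurable_partitionFun hΦ (ρ := ρ) Λ
  have key (g : ({i // i ∉ Λ} → Spin) → ℝ≥0∞) (hg : Measurable g) :
      ∫⁻ ω, (partitionFun Φ ρ Λ ω)⁻¹ * g (offRestrict Λ ω) ∂(outerLift Φ ρ Λ ν) =
        (∫⁻ σ, partitionFun Φ ρ Λ (offExtend Λ σ) ∂ν)⁻¹ * ∫⁻ σ, g σ ∂ν := by
    rw [lintegral_outerLift hΦ ν
        (f := fun ω => (partitionFun Φ ρ Λ ω)⁻¹ * g (offRestrict Λ ω))
        (hZ.inv.mul (hg.comp measurable_offRestrict)),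
      lmarginal_weight_mul_inv_partitionFun hΦ]
    simp only [offRestrict_offExtend]
  refine Measure.ext_of_lintegral _ fun g hg => ?_
  have h1 := key (fun _ => 1) measurable_const
  simp only [mul_one, lintegral_one, measure_univ] at h1
  rw [lintegral_outerRestrict hΦ _ hg, h1, key g hg, inv_inv, ← mul_assoc,
    ENNReal.mul_inv_cancel h0 ht, one_mul]

/-- Uniqueness of the Gibbs measure on the whole lattice implies uniqueness off `Λ`. -/
theorem existsUnique_outer (h : ∃! μ, μ ∈ gibbsMeasures (gibbsSpec Φ ρ)) :
    ∃! ν, ν ∈ gibbsMeasures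
      (gibbsSpec (deletedPotential Φ Λ) fun i : {i // i ∉ Λ} => ρ i) := by
  obtain ⟨μ, hμ, hu⟩ := h
  refine ⟨_, outerRestrict_mem_gibbsMeasures hΦ hμ, fun ν hν => ?_⟩
  have := hν.1
  rw [← hu _ (outerLift_mem_gibbsMeasures hΦ hν), outerRestrict_outerLift hΦ ν]

end outer

end SampleRotateProject
end

/-! ### Arcs, constrained and mixed models: uniqueness and measurable dependence on the labels. -/

open MeasureTheory

noncomputable section

namespace SampleRotateProject

set_option linter.unusedSectionVars false

lemma IsRotatorPotential.absSummable' {d : ℕ} {Φ : Finset (Site d) → (Site d → Spin) → ℝ}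
    (hΦ : IsRotatorPotential Φ) : AbsSummable Φ :=
  ⟨hΦ.measurable, hΦ.dependsOn, hΦ.absSummable⟩

section arcs

variable (q : ℕ) [NeZero q]

lemma measurable_coarse : Measurable (coarse q) := by
  have h1 : Measurable angleRep :=
    measurable_subtype_coe.comp (AddCircle.measurableEquivIco (2 * Real.pi) 0).measurable
  refine measurable_to_countable' fun k => ?_
  have h2 : coarse q ⁻¹' {k} = (fun φ => ⌊q * angleRep φ / (2 * Real.pi)⌋₊) ⁻¹' {k.1} := by
    ext φ
    simp [coarse, Fin.ext_iff]
  rw [h2]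
  exact (Nat.measurable_floor.comp ((h1.const_mul _).div_const _)) (measurableSet_singleton _)

lemma measurableSet_arc (k : Fin q) : MeasurableSet {φ | coarse q φ = k} :=
  measurable_coarse q (measurableSet_singleton k)

lemma measurable_coarseConfig (d : ℕ) : Measurable (coarseConfig (d := d) q) :=
  measurable_pi_lambda _ fun i => (measurable_coarse q).comp (measurable_pi_apply i)

instance (k : Fin q) : IsFiniteMeasure (arcMeasure q k) := by
  unfold arcMeasure
  infer_instance

instance (k : Fin q) : NeZero (arcMeasure q k) := by
  refine ⟨fun h => ?_⟩
  have hq : (0 : ℝ) < q := by exact_mod_cast Nat.pos_of_ne_zero (NeZero.ne q)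
  have hπ := Real.two_pi_pos
  have h0 : volume {φ : Spin | coarse q φ = k} = 0 := by
    rw [arcMeasure, Measure.restrict_eq_zero] at h
    exact h
  rw [← (AddCircle.measurePreserving_mk (2 * Real.pi) 0).measure_preimage
    (measurableSet_arc q k).nullMeasurableSet] at h0
  have hk1 : (k : ℝ) + 1 ≤ q := by exact_mod_cast k.2
  -- The open interval avoids the endpoint mismatch between the fundamental domains `[0, 2π)` of
  -- `angleRep` and `(0, 2π]` of `measurePreserving_mk`.
  have hsub : Set.Ioo (2 * Real.pi * k / q) (2 * Real.pi * (k + 1) / q) ⊆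
      (fun x : ℝ => (x : Spin)) ⁻¹' {φ : Spin | coarse q φ = k} ∩ Set.Ioc 0 (0 + 2 * Real.pi) := by
    intro x hx
    rw [Set.mem_Ioo, div_lt_iff₀ hq, lt_div_iff₀ hq] at hx
    have hx0 : 0 < x := by
      have : 0 ≤ 2 * Real.pi * k := by positivity
      by_contra hneg
      nlinarith [hx.1]
    have hx1 : x < 2 * Real.pi := by
      by_contra hneg
      nlinarith [hx.2]
    refine ⟨?_, hx0, by linarith⟩
    have hrep : angleRep (x : Spin) = x := by
      rw [angleRep, AddCircle.equivIco_coe_eq (by constructor <;> linarith)]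
    change coarse q (x : Spin) = k
    rw [Fin.ext_iff]
    change ⌊q * angleRep (x : Spin) / (2 * Real.pi)⌋₊ = k.1
    rw [hrep, Nat.floor_eq_iff (by positivity), le_div_iff₀ hπ, div_lt_iff₀ hπ]
    constructor <;> nlinarith [hx.1, hx.2]
  have hpos : 0 < volume (Set.Ioo (2 * Real.pi * k / q) (2 * Real.pi * (k + 1) / q)) := by
    rw [Real.volume_Ioo, ENNReal.ofReal_pos, sub_pos]
    exact div_lt_div_of_pos_right (by nlinarith) hq
  rw [Measure.restrict_apply' measurableSet_Ioc] at h0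
  exact (hpos.trans_le (measure_mono hsub)).ne' h0

instance : NeZero (volume : Measure Spin) :=
  ⟨fun h => by
    have := AddCircle.measure_univ (2 * Real.pi)
    rw [h] at this
    simp at this
    linarith [Real.pi_pos]⟩

lemma ae_arcMeasure (k : Fin q) : ∀ᵐ φ ∂(arcMeasure q k), φ ∈ {φ | coarse q φ = k} :=
  ae_restrict_mem (measurableSet_arc q k)

end arcs

lemma theGibbsMeasure_mem {S X : Type*} [MeasurableSpace X]
    {γ : Finset S → (S → X) → Measure (S → X)} (h : ∃! μ, μ ∈ gibbsMeasures γ) :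
    theGibbsMeasure γ ∈ gibbsMeasures γ := by
  have : (gibbsMeasures γ).Nonempty := h.exists
  rw [theGibbsMeasure, dif_pos this]
  exact this.some_mem

lemma gibbsSpec_congr {S X : Type*} [DecidableEq S] [MeasurableSpace X]
    (Φ : Finset S → (S → X) → ℝ) {ρ ρ' : S → Measure X} {Λ : Finset S}
    (h : ∀ i ∈ Λ, ρ i = ρ' i) : gibbsSpec Φ ρ Λ = gibbsSpec Φ ρ' Λ := by
  have : (fun i : Λ => ρ i) = fun i : Λ => ρ' i := funext fun i => h i i.2
  funext η
  rw [gibbsSpec, gibbsSpec, this]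

/-- Unique Gibbs measures depend measurably on labels of the a priori measures. -/
lemma measurable_of_forall_unique {S X L : Type*} [DecidableEq S] [Countable S]
    [TopologicalSpace X] [CompactSpace X] [TopologicalSpace.MetrizableSpace X]
    [MeasurableSpace X] [BorelSpace X] [Nonempty X]
    [Finite L] [Nonempty L] [MeasurableSpace L] [MeasurableSingletonClass L]
    {Φ : Finset S → (S → X) → ℝ} (hΦ : AbsSummable Φ) {r : S → L → Measure X}
    (hr1 : ∀ i l, IsFiniteMeasure (r i l)) (hr2 : ∀ i l, NeZero (r i l))
    {K : (S → L) → Measure (S → X)} (hKp : ∀ ξ, IsProbabilityMeasure (K ξ))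
    (hK : ∀ ξ, ∀ ν ∈ gibbsMeasures (gibbsSpec Φ fun i => r i (ξ i)), ν = K ξ) : Measurable K := by
  classical
  refine Measurable.measure_of_isPiSystem_of_isProbabilityMeasure
    (generateFrom_measurableCylinders (α := fun _ : S => X)).symm
    isPiSystem_measurableCylinders fun B hB => ?_
  let η₀ : S → X := fun _ => Classical.arbitrary X
  -- By uniqueness the measure is the limit of finite-volume kernels with one fixed boundary
  -- condition. Each of them depends only on the finitely many labels in `Δ`, hence is measurable.
  refine measurable_of_tendsto_metrizable' (Filter.atTop : Filter (Finset S))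
    (f := fun Δ ξ => gibbsSpec Φ (fun i => r i (ξ i)) Δ η₀ B) (fun Δ => ?_) ?_
  · have hF : (fun ξ : S → L => gibbsSpec Φ (fun i => r i (ξ i)) Δ η₀ B) =
        (fun k : Δ → L => gibbsSpec Φ (fun i => r i (if h : i ∈ Δ then k ⟨i, h⟩ else
          Classical.arbitrary L)) Δ η₀ B) ∘ (Δ.restrict : (S → L) → Δ → L) := by
      funext ξ
      simp only [Function.comp_apply]
      refine congrArg (fun γ => γ η₀ B) (gibbsSpec_congr Φ fun i hi => ?_)
      simp [hi]
    rw [hF]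
    exact (measurable_of_finite _).comp (Finset.measurable_restrict Δ)
  · rw [tendsto_pi_nhds]
    intro ξ
    exact tendsto_gibbsSpec_of_unique hΦ (ρ := fun i => r i (ξ i)) (hK ξ) η₀ hB

section models

variable {d : ℕ} {Φ : Finset (Site d) → (Site d → Spin) → ℝ} {q : ℕ} [NeZero q]

/-- The a priori measures that are constrained to arcs only off `Λ`. -/
def mixedMeasure (q : ℕ) [NeZero q] (Λ : Finset (Site d)) (σ' : Site d → Fin q) (i : Site d) :
    Measure Spin :=
  if i ∈ Λ then volume else arcMeasure q (σ' i)

instance (Λ : Finset (Site d)) (σ' : Site d → Fin q) (i : Site d) :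
    IsFiniteMeasure (mixedMeasure q Λ σ' i) := by
  unfold mixedMeasure
  split_ifs <;> infer_instance

instance (Λ : Finset (Site d)) (σ' : Site d → Fin q) (i : Site d) :
    NeZero (mixedMeasure q Λ σ' i) := by
  unfold mixedMeasure
  split_ifs <;> infer_instance

/-- The Gibbs measure with spins constrained to arcs off `Λ`. -/
def mixedGibbs (Φ : Finset (Site d) → (Site d → Spin) → ℝ) (q : ℕ) [NeZero q]
    (Λ : Finset (Site d)) (σ' : Site d → Fin q) : Measure (Site d → Spin) :=
  outerLift Φ (mixedMeasure q Λ σ') Λ (outerConstrainedGibbs Φ q Λ σ')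

lemma gibbsSpec_mixedMeasure_outer (Φ : Finset (Site d) → (Site d → Spin) → ℝ)
    (Λ : Finset (Site d)) (σ' : Site d → Fin q) :
    (gibbsSpec (deletedPotential Φ Λ) fun i : {i // i ∉ Λ} => mixedMeasure q Λ σ' i) =
      outerConstrainedSpec Φ q Λ σ' := by
  have : (fun i : {i // i ∉ Λ} => mixedMeasure q Λ σ' i) =
      fun i : {i // i ∉ Λ} => arcMeasure q (σ' i) :=
    funext fun i => if_neg i.2
  rw [this]
  rfl

variable (hΦ : AbsSummable Φ) (hq : FineDiscretization Φ q)
include hΦ hq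

theorem existsUnique_constrained (σ' : Site d → Fin q) :
    ∃! ν, ν ∈ gibbsMeasures (constrainedSpec Φ q σ') := by
  obtain ⟨ν, hν⟩ := gibbsMeasures_nonempty hΦ (ρ := fun i => arcMeasure q (σ' i))
  refine ⟨ν, hν, fun ν' hν' => ?_⟩
  refine gibbsMeasures_unique_of_dobrushin hΦ (A := fun i => {φ | coarse q φ = σ' i})
    (fun i => measurableSet_arc q _) (fun i => ae_arcMeasure q _) ?_ hν' hν
  convert! hq σ' using 1
  ext ω
  exact funext_iff.symm

theorem existsUnique_outerConstrained (Λ : Finset (Site d)) (σ' : Site d → Fin q) :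
    ∃! ν, ν ∈ gibbsMeasures (outerConstrainedSpec Φ q Λ σ') :=
  existsUnique_outer hΦ (ρ := fun i => arcMeasure q (σ' i)) (Λ := Λ)
    (existsUnique_constrained hΦ hq σ')

lemma constrainedGibbs_mem (σ' : Site d → Fin q) :
    constrainedGibbs Φ q σ' ∈ gibbsMeasures (constrainedSpec Φ q σ') :=
  theGibbsMeasure_mem (existsUnique_constrained hΦ hq σ')

lemma eq_constrainedGibbs (σ' : Site d → Fin q) {ν : Measure (Site d → Spin)}
    (hν : ν ∈ gibbsMeasures (constrainedSpec Φ q σ')) : ν = constrainedGibbs Φ q σ' :=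
  (existsUnique_constrained hΦ hq σ').unique hν (constrainedGibbs_mem hΦ hq σ')

lemma outerConstrainedGibbs_mem (Λ : Finset (Site d)) (σ' : Site d → Fin q) :
    outerConstrainedGibbs Φ q Λ σ' ∈ gibbsMeasures (outerConstrainedSpec Φ q Λ σ') :=
  theGibbsMeasure_mem (existsUnique_outerConstrained hΦ hq Λ σ')

lemma mixedGibbs_mem (Λ : Finset (Site d)) (σ' : Site d → Fin q) :
    mixedGibbs Φ q Λ σ' ∈ gibbsMeasures (gibbsSpec Φ (mixedMeasure q Λ σ')) := by
  refine outerLift_mem_gibbsMeasures hΦ ?_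
  rw [gibbsSpec_mixedMeasure_outer]
  exact outerConstrainedGibbs_mem hΦ hq Λ σ'

/-- Off `Λ` the mixed and the constrained model have the same a priori measures. The restriction of
`ν` to `Λᶜ` is therefore the unique outer Gibbs measure, and lifting it back recovers `ν`. -/
lemma eq_mixedGibbs (Λ : Finset (Site d)) (σ' : Site d → Fin q) {ν : Measure (Site d → Spin)}
    (hν : ν ∈ gibbsMeasures (gibbsSpec Φ (mixedMeasure q Λ σ'))) : ν = mixedGibbs Φ q Λ σ' := by
  have h := outerRestrict_mem_gibbsMeasures hΦ (Λ := Λ) hν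
  rw [gibbsSpec_mixedMeasure_outer] at h
  rw [mixedGibbs, (existsUnique_outerConstrained hΦ hq Λ σ').unique
    (outerConstrainedGibbs_mem hΦ hq Λ σ') h, outerLift_outerRestrict hΦ hν]

lemma isProbabilityMeasure_constrainedGibbs (σ' : Site d → Fin q) :
    IsProbabilityMeasure (constrainedGibbs Φ q σ') := (constrainedGibbs_mem hΦ hq σ').1

lemma isProbabilityMeasure_mixedGibbs (Λ : Finset (Site d)) (σ' : Site d → Fin q) :
    IsProbabilityMeasure (mixedGibbs Φ q Λ σ') := (mixedGibbs_mem hΦ hq Λ σ').1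

lemma measurable_constrainedGibbs : Measurable (constrainedGibbs Φ q) :=
  measurable_of_forall_unique hΦ (r := fun _ k => arcMeasure q k) (fun _ _ => inferInstance)
    (fun _ _ => inferInstance) (isProbabilityMeasure_constrainedGibbs hΦ hq)
    fun σ' _ hν => eq_constrainedGibbs hΦ hq σ' hν

lemma measurable_mixedGibbs (Λ : Finset (Site d)) : Measurable (mixedGibbs Φ q Λ) :=
  measurable_of_forall_unique hΦ (r := fun i k => mixedMeasure q Λ (fun _ => k) i)
    (fun _ _ => inferInstance) (fun _ _ => inferInstance)
    (isProbabilityMeasure_mixedGibbs hΦ hq Λ) fun σ' _ hν => eq_mixedGibbs hΦ hq Λ σ' hν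

end models

end SampleRotateProject
end

/-! ### The two layers: discretizing and filling in are inverse to each other on Gibbs measures. -/

open MeasureTheory

noncomputable section

namespace SampleRotateProject

set_option linter.unusedSectionVars false

lemma ext_of_measurableCylinders {S X : Type*} [MeasurableSpace X] {μ ν : Measure (S → X)}
    [IsFiniteMeasure μ] (h : ∀ B ∈ measurableCylinders fun _ : S => X, μ B = ν B) : μ = ν :=
  ext_of_generate_finite _ (generateFrom_measurableCylinders (α := fun _ : S => X)).symm
    isPiSystem_measurableCylinders h (h _ (univ_mem_measurableCylinders _))

lemma normalize_map {Y Z : Type*} [MeasurableSpace Y] [MeasurableSpace Z] (m : Measure Y)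
    {f : Y → Z} (hf : Measurable f) : normalize (m.map f) = (normalize m).map f := by
  rw [normalize, normalize, Measure.map_apply hf MeasurableSet.univ, Set.preimage_univ,
    Measure.map_smul]

section disintegration

variable {d : ℕ} {Φ : Finset (Site d) → (Site d → Spin) → ℝ} {q : ℕ} [NeZero q]

lemma mixedMeasure_empty (σ' : Site d → Fin q) :
    mixedMeasure q ∅ σ' = fun i => arcMeasure q (σ' i) :=
  funext fun i => if_neg (Finset.notMem_empty i)

variable (hΦ : AbsSummable Φ) (hq : FineDiscretization Φ q)
include hΦ hq

lemma mixedGibbs_empty (σ' : Site d → Fin q) :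
    mixedGibbs Φ q ∅ σ' = constrainedGibbs Φ q σ' := by
  refine eq_constrainedGibbs hΦ hq σ' ?_
  have h := mixedGibbs_mem hΦ hq ∅ σ'
  rwa [mixedMeasure_empty] at h

/-- A Gibbs measure is a mixture of the Gibbs measures constrained off `Λ`. -/
lemma bind_mixedGibbs (Λ : Finset (Site d)) {μ : Measure (Site d → Spin)}
    (hμ : μ ∈ gibbsMeasures (rotatorSpec Φ)) :
    μ.bind (fun η => mixedGibbs Φ q Λ (coarseConfig q η)) = μ := by
  have hμ' := (mem_gibbsMeasures_iff hΦ (ρ := fun _ => volume) μ).1 hμ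
  have hμp := hμ.1
  -- A constant label in `Λ` reveals nothing there, so conditioning on the labels yields exactly the
  -- mixed model.
  let t (i : Site d) (φ : Spin) : Fin q := if i ∈ Λ then 0 else coarse q φ
  have ht (i : Site d) : Measurable (t i) := by
    by_cases hi : i ∈ Λ
    · simp only [t, hi, if_true]
      exact measurable_const
    · simp only [t, hi, if_false]
      exact measurable_coarse q
  have hl (η : Site d → Spin) :
      labelMeasure (fun _ => volume) t η = mixedMeasure q Λ (coarseConfig q η) := by
    funext i
    by_cases hi : i ∈ Λ
    · simp [labelMeasure, mixedMeasure, t, hi]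
    · simp only [labelMeasure, mixedMeasure, t, hi, if_false]
      rfl
  refine (ext_of_measurableCylinders fun B hB => ?_).symm
  have hm : Measurable fun η : Site d → Spin => mixedGibbs Φ q Λ (coarseConfig q η) :=
    (measurable_mixedGibbs hΦ hq Λ).comp (measurable_coarseConfig q d)
  rw [Measure.bind_apply (MeasurableSet.of_mem_measurableCylinders hB) hm.aemeasurable]
  refine (lintegral_conditional_gibbs hΦ ht (fun η i => ?_) (fun η ν hν => ?_) hμp hμ'.2 hB).symm
  · rw [hl]
    infer_instance
  · rw [hl] at hν
    exact eq_mixedGibbs hΦ hq Λ _ hν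

/-- A Gibbs measure is recovered from its discretization. -/
lemma map_coarseConfig_bind {μ : Measure (Site d → Spin)}
    (hμ : μ ∈ gibbsMeasures (rotatorSpec Φ)) :
    (μ.map (coarseConfig q)).bind (constrainedGibbs Φ q) = μ := by
  have hm := measurable_constrainedGibbs hΦ hq
  have hT := measurable_coarseConfig q d
  ext B hB
  have hmB : Measurable fun ξ => constrainedGibbs Φ q ξ B := (Measure.measurable_coe hB).comp hm
  have hmT : Measurable fun η : Site d → Spin => mixedGibbs Φ q ∅ (coarseConfig q η) :=
    (measurable_mixedGibbs hΦ hq ∅).comp hT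
  rw [Measure.bind_apply hB hm.aemeasurable, lintegral_map hmB hT]
  conv_rhs => rw [← bind_mixedGibbs hΦ hq ∅ hμ]
  rw [Measure.bind_apply hB hmT.aemeasurable]
  simp only [mixedGibbs_empty hΦ hq]

omit hΦ hq in
lemma measurable_joinCoarse (Λ : Finset (Site d)) (σ' : Site d → Fin q) :
    Measurable fun ω : Site d → Spin => join Λ (fun i => coarse q (ω i)) fun i => σ' i := by
  refine measurable_pi_lambda _ fun i => ?_
  by_cases hi : i ∈ Λ
  · simp only [join, hi, dif_pos]
    exact (measurable_coarse q).comp (measurable_pi_apply i)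
  · simp only [join, hi, dif_neg, not_false_eq_true]
    exact measurable_const

/-- Off `Λ` the arcs are already fixed. Disintegrating also along the arcs in `Λ` leaves fully
constrained models, whose Gibbs measures are unique. -/
lemma mixedGibbs_bind (Λ : Finset (Site d)) (σ' : Site d → Fin q) :
    (mixedGibbs Φ q Λ σ').bind (fun η => constrainedGibbs Φ q
      (join Λ (fun i => coarse q (η i)) fun i => σ' i)) = mixedGibbs Φ q Λ σ' := by
  have hμ' := (mem_gibbsMeasures_iff hΦ _).1 (mixedGibbs_mem hΦ hq Λ σ')
  have hμp := hμ'.1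
  let t (i : Site d) (φ : Spin) : Fin q := if i ∈ Λ then coarse q φ else 0
  have ht (i : Site d) : Measurable (t i) := by
    by_cases hi : i ∈ Λ
    · simp only [t, hi, if_true]
      exact measurable_coarse q
    · simp only [t, hi, if_false]
      exact measurable_const
  have hl (η : Site d → Spin) : labelMeasure (mixedMeasure q Λ σ') t η =
      fun i => arcMeasure q (join Λ (fun i => coarse q (η i)) (fun i => σ' i) i) := by
    funext i
    by_cases hi : i ∈ Λ
    · simp only [labelMeasure, mixedMeasure, t, hi, if_true, join, dif_pos]
      rfl
    · simp [labelMeasure, mixedMeasure, t, hi, join]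
  refine (ext_of_measurableCylinders fun B hB => ?_).symm
  have hm : Measurable fun η : Site d → Spin => constrainedGibbs Φ q
      (join Λ (fun i => coarse q (η i)) fun i => σ' i) :=
    (measurable_constrainedGibbs hΦ hq).comp (measurable_joinCoarse Λ σ')
  rw [Measure.bind_apply (MeasurableSet.of_mem_measurableCylinders hB) hm.aemeasurable]
  refine (lintegral_conditional_gibbs hΦ ht (fun η i => ?_) (fun η ν hν => ?_) hμp hμ'.2 hB).symm
  · rw [hl]
    infer_instance
  · rw [hl] at hν
    exact eq_constrainedGibbs hΦ hq _ hν

omit hΦ hq in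
lemma coarseSpec_eq_map_join (Λ : Finset (Site d)) (σ' : Site d → Fin q) :
    coarseSpec Φ q Λ σ' = (mixedGibbs Φ q Λ σ').map fun ω =>
      join Λ (fun i => coarse q (ω i)) fun i => σ' i := by
  have h : (fun i : Λ => mixedMeasure q Λ σ' i) = fun _ => volume := funext fun i => if_pos i.2
  rw [coarseSpec, normalize_map _ (measurable_joinCoarse Λ σ'), mixedGibbs, outerLift, h]

/-- The discrete specification is the discretization of the Gibbs measures constrained off `Λ`. -/
lemma coarseSpec_eq_map (Λ : Finset (Site d)) (σ' : Site d → Fin q) :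
    coarseSpec Φ q Λ σ' = (mixedGibbs Φ q Λ σ').map (coarseConfig q) := by
  rw [coarseSpec_eq_map_join]
  refine Measure.map_congr ?_
  have hμ := ((mem_gibbsMeasures_iff hΦ _).1 (mixedGibbs_mem hΦ hq Λ σ')).2
  have h (i : Site d) : ∀ᵐ ω ∂(mixedGibbs Φ q Λ σ'), i ∉ Λ → coarse q (ω i) = σ' i := by
    by_cases hi : i ∈ Λ
    · simp [hi]
    · refine ((hμ {i}).ae_mem hΦ (measurableSet_arc q (σ' i)) ?_).mono fun ω hω _ => hω
      rw [mixedMeasure, if_neg hi]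
      exact ae_arcMeasure q _
  filter_upwards [ae_all_iff.2 h] with ω hω
  funext i
  by_cases hi : i ∈ Λ
  · simp [join, hi, coarseConfig]
  · simp [join, hi, coarseConfig, hω i hi]

lemma measurable_coarseSpec (Λ : Finset (Site d)) : Measurable (coarseSpec Φ q Λ) := by
  have h : coarseSpec Φ q Λ = fun σ' => (mixedGibbs Φ q Λ σ').map (coarseConfig q) :=
    funext fun σ' => coarseSpec_eq_map hΦ hq Λ σ'
  rw [h]
  exact (Measure.measurable_map _ (measurable_coarseConfig q d)).comp
    (measurable_mixedGibbs hΦ hq Λ)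

lemma coarseSpec_bind (Λ : Finset (Site d)) (σ' : Site d → Fin q) {B : Set (Site d → Spin)}
    (hB : MeasurableSet B) :
    ∫⁻ ξ, constrainedGibbs Φ q ξ B ∂(coarseSpec Φ q Λ σ') = mixedGibbs Φ q Λ σ' B := by
  have hm := measurable_constrainedGibbs hΦ hq
  have hmB : Measurable fun ξ => constrainedGibbs Φ q ξ B := (Measure.measurable_coe hB).comp hm
  have hmJ : Measurable fun η : Site d → Spin => constrainedGibbs Φ q
      (join Λ (fun i => coarse q (η i)) fun i => σ' i) :=
    hm.comp (measurable_joinCoarse Λ σ')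
  rw [coarseSpec_eq_map_join, lintegral_map hmB (measurable_joinCoarse Λ σ')]
  conv_rhs => rw [← mixedGibbs_bind hΦ hq Λ σ']
  rw [Measure.bind_apply hB hmJ.aemeasurable]

/-- The discretization of a Gibbs measure is a Gibbs measure of the discrete specification. -/
theorem map_coarseConfig_mem {μ : Measure (Site d → Spin)}
    (hμ : μ ∈ gibbsMeasures (rotatorSpec Φ)) :
    μ.map (coarseConfig q) ∈ gibbsMeasures (coarseSpec Φ q) := by
  have hT := measurable_coarseConfig q d
  have := hμ.1
  refine ⟨Measure.isProbabilityMeasure_map hT.aemeasurable, fun Λ B hB => ?_⟩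
  have hmB : Measurable fun ξ => coarseSpec Φ q Λ ξ B :=
    (Measure.measurable_coe hB).comp (measurable_coarseSpec hΦ hq Λ)
  have hmT : Measurable fun η : Site d → Spin => mixedGibbs Φ q Λ (coarseConfig q η) :=
    (measurable_mixedGibbs hΦ hq Λ).comp hT
  rw [lintegral_map hmB hT, Measure.map_apply hT hB]
  conv_rhs => rw [← bind_mixedGibbs hΦ hq Λ hμ]
  rw [Measure.bind_apply (hT hB) hmT.aemeasurable]
  simp only [coarseSpec_eq_map hΦ hq, Measure.map_apply hT hB]

/-- Filling in the constrained Gibbs measures maps Gibbs measures of the discrete specification to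
Gibbs measures of the original one. -/
theorem bind_constrainedGibbs_mem {μ' : Measure (Site d → Fin q)}
    (hμ' : μ' ∈ gibbsMeasures (coarseSpec Φ q)) :
    μ'.bind (constrainedGibbs Φ q) ∈ gibbsMeasures (rotatorSpec Φ) := by
  have hK := measurable_constrainedGibbs hΦ hq
  have hKp := isProbabilityMeasure_constrainedGibbs hΦ hq
  have hp := hμ'.1
  refine ⟨⟨?_⟩, fun Λ B hB => ?_⟩
  · rw [Measure.bind_apply MeasurableSet.univ hK.aemeasurable]
    simp
  have hc := measurable_coarseSpec hΦ hq Λ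
  have hM := measurable_mixedGibbs hΦ hq Λ
  have h1 : μ'.bind (coarseSpec Φ q Λ) = μ' := by
    ext C hC
    rw [Measure.bind_apply hC hc.aemeasurable, hμ'.2 Λ C hC]
  -- Resampling the labels in `Λ` by `γ'_Λ` does not change `μ'`, but it turns the fully constrained
  -- Gibbs measures into mixed ones.
  have h2 : μ'.bind (constrainedGibbs Φ q) = μ'.bind (mixedGibbs Φ q Λ) := by
    ext C hC
    rw [Measure.bind_apply hC hK.aemeasurable, Measure.bind_apply hC hM.aemeasurable]
    conv_lhs => rw [← h1]
    have hKC : Measurable fun ξ => constrainedGibbs Φ q ξ C := (Measure.measurable_coe hC).comp hK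
    rw [Measure.lintegral_bind hc.aemeasurable hKC.aemeasurable]
    exact lintegral_congr fun σ' => coarseSpec_bind hΦ hq Λ σ' hC
  have hg : Measurable (rotatorSpec Φ Λ) := measurable_gibbsSpec hΦ (ρ := fun _ => volume) Λ
  have hgB : Measurable fun η => rotatorSpec Φ Λ η B := (Measure.measurable_coe hB).comp hg
  rw [h2, Measure.lintegral_bind hM.aemeasurable hgB.aemeasurable,
    Measure.bind_apply hB hM.aemeasurable]
  refine lintegral_congr fun σ' => ?_
  -- The kernel for `Λ` sees only the a priori measures in `Λ`, and these are Lebesgue in both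
  -- models.
  have h3 : rotatorSpec Φ Λ = gibbsSpec Φ (mixedMeasure q Λ σ') Λ :=
    gibbsSpec_congr Φ fun i hi => (if_pos hi).symm
  rw [h3]
  exact (mixedGibbs_mem hΦ hq Λ σ').2 Λ B hB

lemma constrainedGibbs_preimage (σ' : Site d → Fin q) (B : Set (Site d → Fin q)) :
    constrainedGibbs Φ q σ' (coarseConfig q ⁻¹' B) = B.indicator 1 σ' := by
  have := isProbabilityMeasure_constrainedGibbs hΦ hq σ'
  have h := IsDLR.ae_mem_boxConfig hΦ (fun i => measurableSet_arc q (σ' i))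
    (fun i => ae_arcMeasure q (σ' i))
    ((mem_gibbsMeasures_iff hΦ _).1 (constrainedGibbs_mem hΦ hq σ')).2
  have h' : ∀ᵐ ω ∂(constrainedGibbs Φ q σ'), coarseConfig q ω = σ' :=
    h.mono fun ω hω => funext hω
  by_cases hσ : σ' ∈ B
  · rw [Set.indicator_of_mem hσ, Pi.one_apply, ← measure_univ (μ := constrainedGibbs Φ q σ')]
    refine le_antisymm (measure_mono (Set.subset_univ _)) (measure_mono_ae ?_)
    exact h'.mono fun ω hω _ => show coarseConfig q ω ∈ B by rwa [hω]
  · rw [Set.indicator_of_notMem hσ]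
    refine le_antisymm ?_ zero_le
    rw [← measure_empty (μ := constrainedGibbs Φ q σ')]
    exact measure_mono_ae (h'.mono fun ω hω (h0 : coarseConfig q ω ∈ B) =>
      hσ (by rwa [hω] at h0))

lemma bind_constrainedGibbs_map {μ' : Measure (Site d → Fin q)} :
    (μ'.bind (constrainedGibbs Φ q)).map (coarseConfig q) = μ' := by
  have hT := measurable_coarseConfig q d
  ext B hB
  rw [Measure.map_apply hT hB, Measure.bind_apply (hT hB)
    (measurable_constrainedGibbs hΦ hq).aemeasurable]
  simp only [constrainedGibbs_preimage hΦ hq, lintegral_indicator_one hB]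

end disintegration

end SampleRotateProject
end

/-! ### Extreme points, lattice and rotation symmetries, uniform mixtures, and the dynamics. -/

open MeasureTheory

noncomputable section

namespace SampleRotateProject

set_option linter.unusedSectionVars false

section convexity

/-- An affine bijection preserves and reflects proper convex combinations. Convexity of `A` is
needed to keep combinations in the set where `f` is injective. -/
lemma extremePoints_eq_image {E F : Type*} [AddCommMonoid E] [Module ℝ≥0 E] [AddCommMonoid F]
    [Module ℝ≥0 F] {A : Set E} {B : Set F} {f : E → F}
    (hf : ∀ (a b : ℝ≥0) (x y : E), f (a • x + b • y) = a • f x + b • f y)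
    (hA : Convex ℝ≥0 A) (h : Set.BijOn f A B) :
    B.extremePoints ℝ≥0 = f '' A.extremePoints ℝ≥0 := by
  ext y
  constructor
  · intro hy
    obtain ⟨x, hx, rfl⟩ := h.surjOn hy.1
    refine ⟨x, ⟨hx, fun x₁ h₁ x₂ h₂ hs => h.injOn h₁ hx ?_⟩, rfl⟩
    refine hy.2 (h.mapsTo h₁) (h.mapsTo h₂) ?_
    obtain ⟨a, b, ha, hb, hab, rfl⟩ := hs
    exact ⟨a, b, ha, hb, hab, (hf a b x₁ x₂).symm⟩
  · rintro ⟨x, hx, rfl⟩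
    refine ⟨h.mapsTo hx.1, fun y₁ h₁ y₂ h₂ hs => ?_⟩
    obtain ⟨x₁, hx₁, rfl⟩ := h.surjOn h₁
    obtain ⟨x₂, hx₂, rfl⟩ := h.surjOn h₂
    obtain ⟨a, b, ha, hb, hab, hs⟩ := hs
    rw [← hf] at hs
    have := h.injOn (hA hx₁ hx₂ zero_le zero_le hab) hx.1 hs
    rw [hx.2 hx₁ hx₂ ⟨a, b, ha, hb, hab, this⟩]

lemma measurable_shift {d : ℕ} {X : Type*} [MeasurableSpace X] (i : Site d) :
    Measurable (shift i : (Site d → X) → Site d → X) :=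
  measurable_pi_lambda _ fun j => measurable_pi_apply (j + i)

lemma convex_invGibbsMeasures {d : ℕ} {X : Type*} [MeasurableSpace X]
    (γ : Finset (Site d) → (Site d → X) → Measure (Site d → X)) :
    Convex ℝ≥0 (invGibbsMeasures γ) := by
  intro x hx y hy a b _ _ hab
  refine ⟨⟨⟨?_⟩, fun Λ B hB => ?_⟩, fun i => ?_⟩
  · have := hx.1.1
    have := hy.1.1
    have h : (a : ℝ≥0∞) + b = 1 := by exact_mod_cast hab
    rw [Measure.add_apply, Measure.smul_apply, Measure.smul_apply, measure_univ, measure_univ,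
      ENNReal.smul_def, ENNReal.smul_def, smul_eq_mul, smul_eq_mul, mul_one, mul_one, h]
  · rw [lintegral_add_measure, lintegral_smul_measure, lintegral_smul_measure, hx.1.2 Λ B hB,
      hy.1.2 Λ B hB]
    rfl
  · rw [Measure.map_add _ _ (measurable_shift i), Measure.map_smul, Measure.map_smul, hx.2 i,
      hy.2 i]

end convexity

section shift

variable {d : ℕ} {Φ : Finset (Site d) → (Site d → Spin) → ℝ} (hΦ : IsRotatorPotential Φ)
include hΦ

lemma hamiltonian_shift (j : Site d) (Λ : Finset (Site d)) (ω : Site d → Spin) :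
    hamiltonian Φ Λ (shift j ω) = hamiltonian Φ (Λ.map (addRightEmbedding j)) ω := by
  rw [hamiltonian_eq_tsum_ite, hamiltonian_eq_tsum_ite,
    ← (Equiv.addRight j).finsetCongr.tsum_eq
      fun A => if (A ∩ Λ.map (addRightEmbedding j)).Nonempty then Φ A ω else 0]
  refine tsum_congr fun A => ?_
  have h : (Equiv.addRight j).finsetCongr A = A.map (addRightEmbedding j) := rfl
  rw [h, ← Finset.map_inter, hΦ.translationInvariant]
  simp only [Finset.map_nonempty]

lemma gibbsOp_shift (j : Site d) (Λ : Finset (Site d)) {f : (Site d → Spin) → ℝ≥0∞}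
    (hf : Measurable f) (ω : Site d → Spin) :
    gibbsOp Φ (fun _ => volume) Λ f (shift j ω) =
      gibbsOp Φ (fun _ => volume) (Λ.map (addRightEmbedding j)) (f ∘ shift j) ω := by
  have hw : weight Φ (Λ.map (addRightEmbedding j)) = weight Φ Λ ∘ shift j := by
    funext ω
    simp only [weight, Function.comp_apply, hamiltonian_shift hΦ]
  have key {g : (Site d → Spin) → ℝ≥0∞} (hg : Measurable g) :
      (∫⋯∫⁻_Λ.map (addRightEmbedding j), g ∘ shift j ∂fun _ => (volume : Measure Spin)) ω =
        (∫⋯∫⁻_Λ, g ∂fun _ => (volume : Measure Spin)) (shift j ω) := by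
    rw [Finset.map_eq_image]
    exact lmarginal_image (μ := fun _ => (volume : Measure Spin)) (e := fun i => i + j)
      (add_left_injective j) Λ hg ω
  have hm := hΦ.absSummable'.measurable_weight Λ
  have hc : (weight Φ Λ ∘ shift j) * (f ∘ shift j) = (weight Φ Λ * f) ∘ shift j := rfl
  simp only [gibbsOp, partitionFun, Pi.mul_apply, Pi.inv_apply]
  rw [hw, hc, key hm, key (hm.mul hf)]

/-- Translates of Gibbs measures are Gibbs measures. -/
lemma map_shift_mem (j : Site d) {μ : Measure (Site d → Spin)}
    (hμ : μ ∈ gibbsMeasures (rotatorSpec Φ)) :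
    μ.map (shift j) ∈ gibbsMeasures (rotatorSpec Φ) := by
  have hs := measurable_shift (X := Spin) j
  have hμ' := (mem_gibbsMeasures_iff hΦ.absSummable' (ρ := fun _ => volume) μ).1 hμ
  have := hμ.1
  refine (mem_gibbsMeasures_iff hΦ.absSummable' (ρ := fun _ => volume) _).2
    ⟨Measure.isProbabilityMeasure_map hs.aemeasurable, fun Λ f hf => ?_⟩
  rw [lintegral_map (measurable_gibbsOp hΦ.absSummable' Λ hf) hs, lintegral_map hf hs]
  simp only [gibbsOp_shift hΦ j Λ hf]
  exact hμ'.2 _ _ (hf.comp hs)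

end shift

section rotation

variable {d : ℕ} {Φ : Finset (Site d) → (Site d → Spin) → ℝ} (hΦ : IsRotatorPotential Φ)

lemma continuous_rotate (t : Spin) : Continuous (rotate (d := d) t) :=
  continuous_pi fun i => (continuous_apply i).add continuous_const

lemma measurable_rotate (t : Spin) : Measurable (rotate (d := d) t) :=
  (continuous_rotate t).measurable

include hΦ

lemma gibbsOp_rotate (t : Spin) (Λ : Finset (Site d)) {f : (Site d → Spin) → ℝ≥0∞}
    (hf : Measurable f) (ω : Site d → Spin) :
    gibbsOp Φ (fun _ => volume) Λ f (rotate t ω) =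
      gibbsOp Φ (fun _ => volume) Λ (f ∘ rotate t) ω := by
  have hw : weight Φ Λ = weight Φ Λ ∘ rotate t := by
    funext ω
    simp only [weight, Function.comp_apply, hamiltonian, hΦ.rotationInvariant]
  have key {g : (Site d → Spin) → ℝ≥0∞} (hg : Measurable g) :
      (∫⋯∫⁻_Λ, g ∘ rotate t ∂fun _ => (volume : Measure Spin)) ω =
        (∫⋯∫⁻_Λ, g ∂fun _ => (volume : Measure Spin)) (rotate t ω) := by
    have hp := measurePreserving_pi (fun _ : Λ => (volume : Measure Spin))
      (fun _ : Λ => (volume : Measure Spin)) (f := fun _ φ => φ + t)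
      fun _ => measurePreserving_add_right volume t
    have hr (ζ : Λ → Spin) : rotate t (Function.updateFinset ω Λ ζ) =
        Function.updateFinset (rotate t ω) Λ fun i => ζ i + t := by
      funext i
      by_cases hi : i ∈ Λ <;> simp [rotate, Function.updateFinset, hi]
    simp only [lmarginal, Function.comp_apply, hr]
    exact hp.lintegral_comp (hg.comp measurable_updateFinset)
  have hm := hΦ.absSummable'.measurable_weight Λ
  have hc : weight Φ Λ * (f ∘ rotate t) = (weight Φ Λ * f) ∘ rotate t := by
    conv_lhs => rw [hw]
    rfl
  simp only [gibbsOp, partitionFun, Pi.mul_apply, Pi.inv_apply]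
  rw [hc, key (hm.mul hf), ← key hm, ← hw]

lemma map_rotate_rotatorSpec (t : Spin) (Λ : Finset (Site d)) (η : Site d → Spin) :
    (rotatorSpec Φ Λ η).map (rotate t) = rotatorSpec Φ Λ (rotate t η) := by
  have ht := measurable_rotate (d := d) t
  ext B hB
  rw [Measure.map_apply ht hB, rotatorSpec, gibbsSpec_apply hΦ.absSummable' _ _ _ hB,
    gibbsSpec_apply hΦ.absSummable' _ _ _ (ht hB),
    gibbsOp_rotate hΦ t Λ (measurable_one.indicator hB)]
  rfl

end rotation

section mixture

variable {Y : Type*} [MeasurableSpace Y]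

lemma volume_spin_univ : (volume : Measure Spin) Set.univ = ENNReal.ofReal (2 * Real.pi) :=
  AddCircle.measure_univ _

lemma lintegral_uniformMixture {ν : Spin → Measure Y} (hν : Measurable ν) {f : Y → ℝ≥0∞}
    (hf : Measurable f) : ∫⁻ y, f y ∂(uniformMixture ν) =
      (ENNReal.ofReal (2 * Real.pi))⁻¹ * ∫⁻ φ, ∫⁻ y, f y ∂(ν φ) := by
  rw [uniformMixture, lintegral_smul_measure, Measure.lintegral_bind hν.aemeasurable
    hf.aemeasurable, smul_eq_mul]

lemma uniformMixture_apply {ν : Spin → Measure Y} (hν : Measurable ν) {B : Set Y}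
    (hB : MeasurableSet B) :
    uniformMixture ν B = (ENNReal.ofReal (2 * Real.pi))⁻¹ * ∫⁻ φ, ν φ B := by
  rw [uniformMixture, Measure.smul_apply, Measure.bind_apply hB hν.aemeasurable, smul_eq_mul]

lemma uniformMixture_mem {d : ℕ} {X : Type*} [MeasurableSpace X]
    {γ : Finset (Site d) → (Site d → X) → Measure (Site d → X)} (hγ : ∀ Λ, Measurable (γ Λ))
    {ν : Spin → Measure (Site d → X)} (hν : Measurable ν)
    (h : ∀ φ, ν φ ∈ invGibbsMeasures γ) : uniformMixture ν ∈ invGibbsMeasures γ := by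
  refine ⟨⟨⟨?_⟩, fun Λ B hB => ?_⟩, fun i => ?_⟩
  · have (φ : Spin) : ν φ Set.univ = 1 := (h φ).1.1.measure_univ
    rw [uniformMixture_apply hν MeasurableSet.univ]
    simp only [this, lintegral_one, volume_spin_univ]
    exact ENNReal.inv_mul_cancel (by simpa using Real.pi_pos) ENNReal.ofReal_ne_top
  · have hm : Measurable fun η => γ Λ η B := (Measure.measurable_coe hB).comp (hγ Λ)
    rw [lintegral_uniformMixture hν hm, uniformMixture_apply hν hB]
    simp only [(h _).1.2 Λ B hB]
  · have hs := measurable_shift (X := X) i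
    ext B hB
    rw [Measure.map_apply hs hB, uniformMixture_apply hν (hs hB), uniformMixture_apply hν hB]
    simp only [← Measure.map_apply hs hB, (h _).2 i]

/-- The kernel only shifts the mixing parameter, and Lebesgue measure on the circle is invariant
under this shift. -/
lemma uniformMixture_bind_eq {ν : Spin → Measure Y} (hν : Measurable ν) {κ : Y → Measure Y}
    (hκ : Measurable κ) (t : Spin) (h : ∀ φ, (ν φ).bind κ = ν (φ + t)) :
    (uniformMixture ν).bind κ = uniformMixture ν := by
  ext B hB
  have hm : Measurable fun y => κ y B := (Measure.measurable_coe hB).comp hκ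
  rw [Measure.bind_apply hB hκ.aemeasurable, lintegral_uniformMixture hν hm,
    uniformMixture_apply hν hB]
  simp only [← Measure.bind_apply hB hκ.aemeasurable, h]
  rw [lintegral_add_right_eq_self fun φ => ν φ B]

end mixture

namespace SymmetryBreaking

variable {d : ℕ} {Φ : Finset (Site d) → (Site d → Spin) → ℝ} (hΦ : IsRotatorPotential Φ)
  {μ : Spin → Measure (Site d → Spin)} (hμ : SymmetryBreaking Φ μ)
include hμ

lemma mem_invGibbsMeasures (φ : Spin) : μ φ ∈ invGibbsMeasures (rotatorSpec Φ) := by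
  have h : μ φ ∈ exInvGibbsMeasures (rotatorSpec Φ) := by
    rw [hμ.extremal]
    exact Set.mem_range_self φ
  exact h.1

lemma isProbabilityMeasure (φ : Spin) : IsProbabilityMeasure (μ φ) :=
  (hμ.mem_invGibbsMeasures φ).1.1

include hΦ

/-- The symmetry-breaking states are rotations of each other. -/
lemma map_rotate (φ t : Spin) : (μ φ).map (rotate t) = μ (φ + t) := by
  have ht := measurable_rotate (d := d) t
  have := hμ.isProbabilityMeasure
  have : IsProbabilityMeasure ((μ φ).map (rotate t)) :=
    Measure.isProbabilityMeasure_map ht.aemeasurable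
  refine ext_of_forall_integral_eq_of_IsFiniteMeasure fun f => ?_
  have h (m : Measure (Site d → Spin)) :
      ∫ ω, f ω ∂(m.map (rotate t)) = ∫ ω, f.compContinuous ⟨_, continuous_rotate t⟩ ω ∂m :=
    integral_map ht.aemeasurable f.continuous.measurable.aestronglyMeasurable
  rw [h]
  -- Rotating the finite-volume kernel with boundary condition `φ` gives the one with boundary
  -- condition `φ + t`, so both sides are limits of the same integrals.
  refine tendsto_nhds_unique (hμ.weakLimit φ _) ?_
  simp only [← h, map_rotate_rotatorSpec hΦ]
  exact hμ.weakLimit (φ + t) f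

/-- Every `μ φ` is the rotation of `μ 0` by `φ`, and rotation is jointly measurable in angle and
configuration; so `μ φ B` is the `μ 0`-measure of a section of a measurable set. -/
lemma measurable : Measurable μ := by
  have := hμ.isProbabilityMeasure 0
  have hr : Measurable fun p : Spin × (Site d → Spin) => rotate p.1 p.2 :=
    measurable_pi_lambda _ fun i =>
      ((measurable_pi_apply i).comp measurable_snd).add measurable_fst
  refine Measure.measurable_of_measurable_coe _ fun B hB => ?_
  have h (φ : Spin) : μ φ B =
      μ 0 (Prod.mk φ ⁻¹' ((fun p : Spin × (Site d → Spin) => rotate p.1 p.2) ⁻¹' B)) := by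
    rw [← zero_add φ, ← hμ.map_rotate hΦ 0 φ, Measure.map_apply (measurable_rotate φ) hB, zero_add]
    rfl
  simp only [h]
  exact measurable_measure_prodMk_left (hr hB)

end SymmetryBreaking

section secondLayer

variable {d : ℕ} {Φ : Finset (Site d) → (Site d → Spin) → ℝ} (hΦ : IsRotatorPotential Φ)
  {q : ℕ} [NeZero q] (hq : FineDiscretization Φ q)
include hΦ hq

lemma injOn_map_coarseConfig :
    Set.InjOn (fun μ : Measure (Site d → Spin) => μ.map (coarseConfig q))
      (gibbsMeasures (rotatorSpec Φ)) := by
  intro μ hμ ν hν h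
  simp only at h
  rw [← map_coarseConfig_bind hΦ.absSummable' hq hμ, h,
    map_coarseConfig_bind hΦ.absSummable' hq hν]

omit hΦ hq in
lemma map_shift_map_coarseConfig (i : Site d) (μ : Measure (Site d → Spin)) :
    (μ.map (coarseConfig q)).map (shift i) = (μ.map (shift i)).map (coarseConfig q) := by
  have hT := measurable_coarseConfig q d
  rw [Measure.map_map (measurable_shift i) hT, Measure.map_map hT (measurable_shift i)]
  rfl

/-- Discretization is a bijection between the translation-invariant Gibbs measures of the two
layers. -/
theorem bijOn_map_coarseConfig :
    Set.BijOn (fun μ : Measure (Site d → Spin) => μ.map (coarseConfig q))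
      (invGibbsMeasures (rotatorSpec Φ)) (invGibbsMeasures (coarseSpec Φ q)) := by
  have hinj := injOn_map_coarseConfig hΦ hq
  refine ⟨fun μ hμ => ⟨map_coarseConfig_mem hΦ.absSummable' hq hμ.1, fun i => ?_⟩,
    hinj.mono fun μ hμ => hμ.1, fun ν hν => ?_⟩
  · rw [map_shift_map_coarseConfig, hμ.2 i]
  · have h := bind_constrainedGibbs_mem hΦ.absSummable' hq hν.1
    have hmap := bind_constrainedGibbs_map hΦ.absSummable' hq (μ' := ν)
    -- The filled-in measure and its translate are Gibbs measures with the same discretization `ν`,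
    -- so injectivity makes them equal.
    refine ⟨_, ⟨h, fun i => hinj (map_shift_mem hΦ i h) h ?_⟩, hmap⟩
    simp only
    rw [← map_shift_map_coarseConfig, hmap, hν.2 i]

lemma measurable_transition (τ : ℝ) : Measurable (transition Φ q τ) :=
  (Measure.measurable_map _ ((measurable_coarseConfig q d).comp (measurable_rotate _))).comp
    (measurable_constrainedGibbs hΦ.absSummable' hq)

lemma isProbabilityMeasure_transition (τ : ℝ) (σ' : Site d → Fin q) :
    IsProbabilityMeasure (transition Φ q τ σ') :=
  have := isProbabilityMeasure_constrainedGibbs hΦ.absSummable' hq σ'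
  Measure.isProbabilityMeasure_map
    ((measurable_coarseConfig q d).comp (measurable_rotate _)).aemeasurable

/-- The first stage of the transition restores `μ` from its discretization; rotation and projection
then act on `μ` itself. -/
lemma map_coarseConfig_bind_transition (τ : ℝ) {μ : Measure (Site d → Spin)}
    (hμ : μ ∈ gibbsMeasures (rotatorSpec Φ)) :
    (μ.map (coarseConfig q)).bind (transition Φ q τ) =
      (μ.map (rotate (τ : Spin))).map (coarseConfig q) := by
  have hT := measurable_coarseConfig q d
  have hr := measurable_rotate (d := d) (τ : Spin)
  ext B hB
  rw [Measure.bind_apply hB (measurable_transition hΦ hq τ).aemeasurable,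
    Measure.map_apply hT hB, Measure.map_apply hr (hT hB)]
  conv_rhs => rw [← map_coarseConfig_bind hΦ.absSummable' hq hμ]
  rw [Measure.bind_apply (hr (hT hB))
    (measurable_constrainedGibbs hΦ.absSummable' hq).aemeasurable]
  exact lintegral_congr fun σ' => Measure.map_apply (hT.comp hr) hB

end secondLayer

end SampleRotateProject
end

open MeasureTheory SampleRotateProject
theorem mainTheorem6 (d : ℕ) (Φ : Finset (Site d) → (Site d → Spin) → ℝ)
    (hΦ : IsRotatorPotential Φ)
    (μ : Spin → Measure (Site d → Spin)) (hμ : SymmetryBreaking Φ μ)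
    (q : ℕ) [NeZero q] (hq : FineDiscretization Φ q) :
    -- the constrained Gibbs measures, hence `γ'` and `M_τ`, are well defined
    (∀ σ' : Site d → Fin q, ∃! ν, ν ∈ gibbsMeasures (constrainedSpec Φ q σ')) ∧
    (∀ (Λ : Finset (Site d)) (σ' : Site d → Fin q),
      ∃! ν, ν ∈ gibbsMeasures (outerConstrainedSpec Φ q Λ σ')) ∧
    -- the measures `μ'_φ` are the extremal translation-invariant Gibbs measures of `γ'`,
    -- labelled by the angles
    exInvGibbsMeasures (coarseSpec Φ q) = Set.range (discretized μ q) ∧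
    Function.Injective (discretized μ q) ∧
    -- the uniform mixture is a well-defined translation-invariant Gibbs measure
    Measurable (discretized μ q) ∧
    uniformMixture (discretized μ q) ∈ invGibbsMeasures (coarseSpec Φ q) ∧
    ∀ τ : ℝ,
      -- `M_τ` is a probability kernel
      Measurable (transition Φ q τ) ∧
      (∀ σ', IsProbabilityMeasure (transition Φ q τ σ')) ∧
      -- rotation property
      (∀ φ : Spin, (discretized μ q φ).bind (transition Φ q τ) = discretized μ q (φ + (τ : Spin))) ∧
      -- stationarity of the uniform mixture
      (uniformMixture (discretized μ q)).bind (transition Φ q τ) =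
        uniformMixture (discretized μ q) := by
  have hΦ' := hΦ.absSummable'
  have hmem := hμ.mem_invGibbsMeasures
  have hbij := bijOn_map_coarseConfig hΦ hq
  have hm : Measurable (discretized μ q) :=
    (Measure.measurable_map _ (measurable_coarseConfig q d)).comp (hμ.measurable hΦ)
  have hrot (τ : ℝ) (φ : Spin) : (discretized μ q φ).bind (transition Φ q τ) =
      discretized μ q (φ + (τ : Spin)) := by
    rw [discretized, map_coarseConfig_bind_transition hΦ hq τ (hmem φ).1, hμ.map_rotate hΦ]
    rfl
  refine ⟨existsUnique_constrained hΦ' hq, existsUnique_outerConstrained hΦ' hq, ?_,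
    fun φ ψ h => hμ.injective (hbij.injOn (hmem φ) (hmem ψ) h), hm,
    uniformMixture_mem (measurable_coarseSpec hΦ' hq) hm fun φ => hbij.mapsTo (hmem φ),
    fun τ => ⟨measurable_transition hΦ hq τ, isProbabilityMeasure_transition hΦ hq τ, hrot τ,
      uniformMixture_bind_eq hm (measurable_transition hΦ hq τ) τ (hrot τ)⟩⟩
  have hlin (a b : ℝ≥0) (x y : Measure (Site d → Spin)) :
      (a • x + b • y).map (coarseConfig q) =
        a • x.map (coarseConfig q) + b • y.map (coarseConfig q) := by
    rw [Measure.map_add _ _ (measurable_coarseConfig q d), Measure.map_smul, Measure.map_smul]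
  have hex := extremePoints_eq_image hlin (convex_invGibbsMeasures (rotatorSpec Φ)) hbij
  have hrange : (invGibbsMeasures (rotatorSpec Φ)).extremePoints ℝ≥0 = Set.range μ := hμ.extremal
  rw [exInvGibbsMeasures, hex, hrange, ← Set.range_comp]
  rfl
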